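/- Work over the complex numbers. Let $X$ and $Y$ be varieties (integral, separated, of finite type over $\mathbb{C}$), $X$ smooth of dimension $n$ and $Y$ smooth of dimension $m$. Let $D = D_1 + \dots + D_r$ be a reduced effective divisor on $X$ with irreducible components $D_i$; for $I \subseteq \{1,\dots,r\}$ let $D_I = \bigcap_{i \in I} D_i$ be the scheme-theoretic intersection, with $D_\emptyset = X$. Assume that $(X,D)$ is an snc pair: every non-empty $D_I$ is smooth, of codimension $|I|$ in $X$. Let $\phi : X \to Y$ be a morphism such that $D$ is relatively snc over $Y$: $\phi$ is surjective, and for every $I$ with $D_I \neq \emptyset$ the restriction $\phi|_{D_I} : D_I \to Y$ is smooth of relative dimension $n - m - |I|$. Write $\mathcal{I}_D \subseteq \mathcal{O}_X$ for the ideal sheaf of the reduced subscheme $D$, $\iota : D \to X$ and $\iota_i : D_i \to D$ for the inclusions, and $\Omega^p_{Z/Y} = \bigwedge^p \Omega^1_{Z/Y}$ for the sheaves of relative Kähler differentials, $Z = X, D, D_i$. Let $\Omega^1_{X/Y}(\log D)$ be the sheaf of $\mathcal{O}_X$-modules of rational relative one-forms on $X$ that is locally generated by the regular differentials and the forms $df_i/f_i$,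 where $f_i$ is a local equation of a component $D_i$, and let $\Omega^p_{X/Y}(\log D) = \bigwedge^p \Omega^1_{X/Y}(\log D)$, viewed as a sheaf of rational relative $p$-forms. Let $\check\Omega^p_{D/Y} = \Omega^p_{D/Y} / \operatorname{tor} \Omega^p_{D/Y}$, where the torsion subsheaf consists of the sections that are locally annihilated by a non-zerodivisor of $\mathcal{O}_D$. Then for every integer $p \geq 0$ there is a short exact sequence of sheaves of $\mathcal{O}_X$-modules $$0 \longrightarrow \Omega^p_{X/Y}(\log D) \otimes \mathcal{I}_D \xrightarrow{\ A\ } \Omega^p_{X/Y} \xrightarrow{\ B\ } \iota_* \check\Omega^p_{D/Y} \longrightarrow 0,$$ where $A$ is the natural map $\omega \otimes f \mapsto f\omega$ and $B$ is the restriction of forms to $D$ followed by the quotient map $\Omega^p_{D/Y} \to \check\Omega^p_{D/Y}$. Moreover, $\check\Omega^p_{D/Y}$ is isomorphic to the image of the restriction map $\psi : \Omega^p_{D/Y} \to \bigoplus_i (\iota_i)_* \Omega^p_{D_i/Y}$, by an isomorphism through which $\psi$ factors as $\Omega^p_{D/Y} \to \check\Omega^p_{D/Y} \cong \operatorname{im}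 \psi \hookrightarrow \bigoplus_i (\iota_i)_* \Omega^p_{D_i/Y}$. -/

import Mathlib

open CategoryTheory AlgebraicGeometry TopologicalSpace Opposite

universe u

namespace LogSequence

noncomputable section

/-! ### Relative differential forms of a ring homomorphism -/

section Forms

variable {A B A' B' A'' B'' : CommRingCat.{u}}

/-- The module `⋀ᵖ Ω_{B/A}` of relative `p`-forms of a ring homomorphism `f : A ⟶ B`. -/
def Forms (f : A ⟶ B) (p : ℕ) : ModuleCat.{u} B :=
  (CommRingCat.KaehlerDifferential f).exteriorPower p

variable {f : A ⟶ B} {f' : A' ⟶ B'} {f'' : A'' ⟶ B''}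
  {g : A ⟶ A'} {g' : B ⟶ B'} {h : A' ⟶ A''} {h' : B' ⟶ B''}

/-- The wedge product `ω₁ ∧ ⋯ ∧ ωₚ` of relative one-forms. -/
def wedge {p : ℕ} (ω : Fin p → CommRingCat.KaehlerDifferential f) : Forms f p :=
  exteriorPower.ιMulti B p ω

/-- The map `Ω_{B/A} → Ω_{B'/A'}`, `b₀ db ↦ g'(b₀) d(g' b)`, induced by a commutative square. -/
def kaehlerMap (fac : g ≫ f' = f ≫ g') :
    CommRingCat.KaehlerDifferential f →ₛₗ[g'.hom] CommRingCat.KaehlerDifferential f' where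
  toFun x := CommRingCat.KaehlerDifferential.map fac x
  map_add' x y := map_add (CommRingCat.KaehlerDifferential.map fac).hom x y
  map_smul' r x := (CommRingCat.KaehlerDifferential.map fac).hom.map_smul r x

theorem kaehlerMap_d (fac : g ≫ f' = f ≫ g') (b : B) :
    kaehlerMap fac (CommRingCat.KaehlerDifferential.d b) =
      CommRingCat.KaehlerDifferential.d (g' b) :=
  CommRingCat.KaehlerDifferential.map_d fac b

/-- The map `⋀ᵖ Ω_{B/A} → ⋀ᵖ Ω_{B'/A'}` induced by a commutative square; on wedge products it is
given by `kaehlerMap` on every factor, see `Forms.map_wedge`. -/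
def Forms.map (fac : g ≫ f' = f ≫ g') (p : ℕ) : Forms f p →ₛₗ[g'.hom] Forms f' p :=
  letI : Module B (Forms f' p) := Module.compHom _ g'.hom
  let alt : (CommRingCat.KaehlerDifferential f) [⋀^Fin p]→ₗ[B] (Forms f' p) :=
    { toFun := fun ω => wedge fun i => kaehlerMap fac (ω i)
      map_update_add' := by
        intro _ ω i x y
        have e : ∀ z, (fun j => kaehlerMap fac (Function.update ω i z j)) =
            Function.update (fun j => kaehlerMap fac (ω j)) i (kaehlerMap fac z) := fun z =>
          funext fun j => Function.apply_update (fun _ => kaehlerMap fac) ω i z j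
        simp only [e, map_add]
        exact (exteriorPower.ιMulti B' p).map_update_add _ _ _ _
      map_update_smul' := by
        intro _ ω i r x
        have e : ∀ z, (fun j => kaehlerMap fac (Function.update ω i z j)) =
            Function.update (fun j => kaehlerMap fac (ω j)) i (kaehlerMap fac z) := fun z =>
          funext fun j => Function.apply_update (fun _ => kaehlerMap fac) ω i z j
        simp only [e, map_smulₛₗ]
        exact (exteriorPower.ιMulti B' p).map_update_smul _ _ _ _
      map_eq_zero_of_eq' := fun ω i j hij hne =>
        (exteriorPower.ιMulti B' p).map_eq_zero_of_eq _ (congrArg (kaehlerMap fac) hij) hne }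
  { toFun := fun x => exteriorPower.alternatingMapLinearEquiv alt x
    map_add' := fun x y => map_add (exteriorPower.alternatingMapLinearEquiv alt) x y
    map_smul' := fun r x => map_smul (exteriorPower.alternatingMapLinearEquiv alt) r x }

theorem Forms.map_wedge (fac : g ≫ f' = f ≫ g') {p : ℕ}
    (ω : Fin p → CommRingCat.KaehlerDifferential f) :
    Forms.map fac p (wedge ω) = wedge fun i => kaehlerMap fac (ω i) :=
  let : Module B (Forms f' p) := Module.compHom _ g'.hom
  exteriorPower.alternatingMapLinearEquiv_apply_ιMulti _ ω

theorem kaehlerMap_comp (fac : g ≫ f' = f ≫ g') (fac' : h ≫ f'' = f' ≫ h')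
    (fac'' : (g ≫ h) ≫ f'' = f ≫ (g' ≫ h')) (x : CommRingCat.KaehlerDifferential f) :
    kaehlerMap fac' (kaehlerMap fac x) = kaehlerMap fac'' x := by
  let := f.hom.toAlgebra
  have hx : x ∈ Submodule.span B (M := CommRingCat.KaehlerDifferential f)
      (Set.range (fun b => CommRingCat.KaehlerDifferential.d b)) :=
    Submodule.eq_top_iff'.mp (KaehlerDifferential.span_range_derivation A B) x
  induction hx using Submodule.span_induction with
  | mem x hx =>
    obtain ⟨b, rfl⟩ := hx
    exact (congrArg _ (kaehlerMap_d fac b)).trans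
      ((kaehlerMap_d fac' _).trans (kaehlerMap_d fac'' b).symm)
  | zero => exact (congrArg _ (map_zero _)).trans ((map_zero _).trans (map_zero _).symm)
  | add x y _ _ hx hy =>
    exact (congrArg _ (map_add _ x y)).trans ((map_add _ _ _).trans
      ((congrArg₂ _ hx hy).trans (map_add _ x y).symm))
  | smul r x _ hx =>
    exact (congrArg _ ((kaehlerMap fac).map_smulₛₗ r x)).trans
      (((kaehlerMap fac').map_smulₛₗ _ _).trans
      ((congrArg _ hx).trans ((kaehlerMap fac'').map_smulₛₗ r x).symm))

theorem Forms.map_map (fac : g ≫ f' = f ≫ g') (fac' : h ≫ f'' = f' ≫ h')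
    (fac'' : (g ≫ h) ≫ f'' = f ≫ (g' ≫ h')) (p : ℕ) (x : Forms f p) :
    Forms.map fac' p (Forms.map fac p x) = Forms.map fac'' p x := by
  have hx : x ∈ Submodule.span B (M := Forms f p) (Set.range fun ω => wedge ω) :=
    Submodule.eq_top_iff'.mp (exteriorPower.ιMulti_span B p
      (CommRingCat.KaehlerDifferential f)) x
  induction hx using Submodule.span_induction with
  | mem x hx =>
    obtain ⟨ω, rfl⟩ := hx
    exact (congrArg _ (Forms.map_wedge fac ω)).trans ((Forms.map_wedge fac' _).trans
      ((congrArg wedge (funext fun i => kaehlerMap_comp fac fac' fac'' (ω i))).trans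
        (Forms.map_wedge fac'' ω).symm))
  | zero => exact (congrArg _ (map_zero _)).trans ((map_zero _).trans (map_zero _).symm)
  | add x y _ _ hx hy =>
    exact (congrArg _ (map_add _ x y)).trans ((map_add _ _ _).trans
      ((congrArg₂ _ hx hy).trans (map_add _ x y).symm))
  | smul r x _ hx =>
    exact (congrArg _ ((Forms.map fac p).map_smulₛₗ r x)).trans
      (((Forms.map fac' p).map_smulₛₗ _ _).trans
      ((congrArg _ hx).trans ((Forms.map fac'' p).map_smulₛₗ r x).symm))

/-- Functoriality of `Forms.map`. -/
theorem Forms.map_comp {k : A ⟶ A''} {k' : B ⟶ B''} (fac : g ≫ f' = f ≫ g')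
    (fac' : h ≫ f'' = f' ≫ h') (fac'' : k ≫ f'' = f ≫ k') (hk : g ≫ h = k) (hk' : g' ≫ h' = k')
    (p : ℕ) (x : Forms f p) :
    Forms.map fac' p (Forms.map fac p x) = Forms.map fac'' p x := by
  subst hk hk'
  exact Forms.map_map fac fac' fac'' p x

end Forms
/-! ### Sheaves of modules made of families of germs -/

/-- A condition which cuts a sheaf of `𝒪_X`-modules out of the families `(s(x))_{x ∈ U}` with
`s(x)` in a given `𝒪_{X,x}`-module `M x`: the families that satisfy it form a submodule, and the
condition is local. -/
structure SectionCondition {X : Scheme.{u}} (M : ∀ x : X, ModuleCat.{u} (X.presheaf.stalk x)) where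
  /-- the families over `U` that satisfy the condition -/
  sections (U : X.Opens) : AddSubgroup (∀ x : U, M x)
  smul_mem {U : X.Opens} (r : Γ(X, U)) {s : ∀ x : U, M x} (hs : s ∈ sections U) :
    (fun x : U => X.presheaf.germ U x x.2 r • s x) ∈ sections U
  res_mem {U V : X.Opens} (h : V ≤ U) {s : ∀ x : U, M x} (hs : s ∈ sections U) :
    (fun x : V => s ⟨x, h x.2⟩) ∈ sections V
  locality {U : X.Opens} (s : ∀ x : U, M x)
    (hs : ∀ x : U, ∃ (V : X.Opens) (_ : x.1 ∈ V) (h : V ≤ U),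
      (fun y : V => s ⟨y, h y.2⟩) ∈ sections V) : s ∈ sections U

namespace SectionCondition

variable {X : Scheme.{u}} {M : ∀ x : X, ModuleCat.{u} (X.presheaf.stalk x)}
  (P : SectionCondition M)

instance (U : X.Opens) : Module Γ(X, U) (P.sections U) where
  smul r s := ⟨fun x : U => X.presheaf.germ U x x.2 r • s.1 x, P.smul_mem r s.2⟩
  one_smul s := Subtype.ext <| funext fun x => by
    change X.presheaf.germ U x x.2 1 • s.1 x = _
    rw [map_one, one_smul]
  mul_smul r r' s := Subtype.ext <| funext fun x => by
    change X.presheaf.germ U x x.2 (r * r') • s.1 x =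
      X.presheaf.germ U x x.2 r • X.presheaf.germ U x x.2 r' • s.1 x
    rw [map_mul, mul_smul]
  smul_zero r := Subtype.ext <| funext fun x => smul_zero _
  smul_add r s t := Subtype.ext <| funext fun x => smul_add _ _ _
  add_smul r r' s := Subtype.ext <| funext fun x => by
    change X.presheaf.germ U x x.2 (r + r') • s.1 x =
      X.presheaf.germ U x x.2 r • s.1 x + X.presheaf.germ U x x.2 r' • s.1 x
    rw [map_add, add_smul]
  zero_smul s := Subtype.ext <| funext fun x => by
    change X.presheaf.germ U x x.2 0 • s.1 x = 0
    rw [map_zero, zero_smul]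

/-- The presheaf of abelian groups of families that satisfy the condition. -/
def abPresheaf : TopCat.Presheaf Ab.{u} X where
  obj U := AddCommGrpCat.of (P.sections U.unop)
  map i := AddCommGrpCat.ofHom
    { toFun := fun s => ⟨fun x => s.1 ⟨x, i.unop.le x.2⟩, P.res_mem i.unop.le s.2⟩
      map_zero' := rfl
      map_add' := fun _ _ => rfl }

instance (U : X.Opensᵒᵖ) : Module (X.ringCatSheaf.obj.obj U) (P.abPresheaf.obj U) :=
  inferInstanceAs (Module Γ(X, U.unop) (P.sections U.unop))

/-- The condition as a local predicate. -/
def localPredicate : TopCat.LocalPredicate (X := X.toTopCat) (fun x : X => M x) where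
  pred s := s ∈ P.sections _
  res i _ hs := P.res_mem i.le hs
  locality {U} s hs := P.locality s fun x =>
    let ⟨V, hx, i, h⟩ := hs x
    ⟨V, hx, i.le, h⟩

/-- The sheaf of `𝒪_X`-modules of all families that satisfy the condition; a function acts on a
family through its germs. -/
def sheaf : X.Modules where
  val := .ofPresheaf P.abPresheaf fun U V i r s => Subtype.ext <| funext fun x => by
    change X.presheaf.germ U.unop x _ r • s.1 ⟨x, _⟩ =
      X.presheaf.germ V.unop x _ (X.presheaf.map i r) • s.1 ⟨x, _⟩
    rw [TopCat.Presheaf.germ_res_apply' X.presheaf i x x.2 r]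
  isSheaf := (TopCat.Presheaf.isSheaf_iff_isSheaf_comp (forget AddCommGrpCat) _).2
    (TopCat.subsheafToTypes P.localPredicate).2

/-- The member `s(x)` of a section `s`. -/
def value {U : X.Opens} (s : Γ(P.sheaf, U)) (x : U) : M x :=
  (show P.sections U from s).1 x

variable {Z : Scheme.{u}} (g : Z ⟶ X) {N : ∀ z : Z, ModuleCat.{u} (Z.presheaf.stalk z)}
  (Q : SectionCondition N)

/-- Maps `M (g z) → N z` that are linear over `𝒪_{X,g(z)} → 𝒪_{Z,z}` and respect the two conditions
give a map to the push-forward along `g : Z ⟶ X`, namely `s ↦ (z ↦ t_z(s(g z)))`. -/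
def pullbackHom (t : ∀ z : Z, M (g z) →ₛₗ[(g.stalkMap z).hom] N z)
    (ht : ∀ (U : X.Opens) (s : ∀ x : U, M x), s ∈ P.sections U →
      (fun z : (g ⁻¹ᵁ U : Z.Opens) => t z (s ⟨g z, z.2⟩)) ∈ Q.sections (g ⁻¹ᵁ U)) :
    P.sheaf ⟶ (Scheme.Modules.pushforward g).obj Q.sheaf where
  val := PresheafOfModules.homMk (R := X.ringCatSheaf.obj)
    { app := fun U => AddCommGrpCat.ofHom (X := P.sections U.unop) (Y := Q.sections (g ⁻¹ᵁ U.unop))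
        { toFun := fun s => ⟨fun z => t z (s.1 ⟨g z, z.2⟩), ht _ s.1 s.2⟩
          map_zero' := Subtype.ext <| funext fun z => map_zero (t z)
          map_add' := fun s s' => Subtype.ext <| funext fun z => map_add (t z) _ _ }
      naturality := fun U V i => rfl }
    fun U r s => Subtype.ext <| funext fun z => by
      refine ((t z).map_smulₛₗ _ _).trans ?_
      change (g.stalkMap z).hom (X.presheaf.germ U.unop (g z) _ r) • _ =
        Z.presheaf.germ (g ⁻¹ᵁ U.unop) z _ (g.app U.unop r) • _
      exact congrArg (· • _) (Scheme.Hom.germ_stalkMap_apply g U.unop z z.2 r)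

end SectionCondition

section Subsheaf

variable {X : Scheme.{u}} (M : X.Modules) (S : M.val.Submodule)

/-- The subsheaf of a sheaf of modules given by a local family of submodules of sections. -/
def subsheaf
    (hS : ∀ (U : X.Opens) (s : Γ(M, U)), (∀ x ∈ U, ∃ (V : X.Opens) (_ : x ∈ V) (i : V ⟶ U),
      M.presheaf.map i.op s ∈ S.obj (op V)) → s ∈ S.obj (op U)) : X.Modules where
  val := S.toPresheafOfModules
  isSheaf := by
    refine (TopCat.Presheaf.isSheaf_iff_isSheaf_comp (forget AddCommGrpCat) _).2 ?_
    have hM := (TopCat.Presheaf.isSheaf_iff_isSheaf_comp (forget AddCommGrpCat) _).1 M.isSheaf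
    refine TopCat.Presheaf.isSheaf_of_isSheafUniqueGluing_types _ fun ι U sf hsf => ?_
    obtain ⟨s, hs, hu⟩ := ((TopCat.Presheaf.isSheaf_iff_isSheafUniqueGluing_types _).1 hM)
      U (fun i => (show S.obj (op (U i)) from sf i).1) (fun i j => congrArg Subtype.val (hsf i j))
    refine ⟨⟨s, hS _ s fun x hx => ?_⟩, fun i => Subtype.ext (hs i), fun t ht =>
      Subtype.ext (hu _ fun i => congrArg Subtype.val (ht i))⟩
    obtain ⟨i, hi⟩ := Opens.mem_iSup.mp hx
    refine ⟨U i, hi, Opens.leSupr U i, ?_⟩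
    exact Eq.mpr (congrArg (· ∈ S.obj (op (U i))) (hs i)) (show S.obj (op (U i)) from sf i).2

/-- The inclusion of a subsheaf. -/
def subsheafι (hS) : subsheaf M S hS ⟶ M := ⟨S.ι⟩

end Subsheaf

/-! ### The sheaf of relative differential forms -/

section RelativeForms

variable {X Y : Scheme.{u}} (φ : X ⟶ Y) (p : ℕ)

theorem germ_appLE {V : Y.Opens} {W : X.Opens} (e : W ≤ φ ⁻¹ᵁ V) (y : X) (hy : y ∈ W) :
    Y.presheaf.germ V (φ y) (e hy) ≫ φ.stalkMap y =
      φ.appLE V W e ≫ X.presheaf.germ W y hy := by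
  refine (Scheme.Hom.germ_stalkMap φ V y (e hy)).trans ?_
  rw [Scheme.Hom.appLE, Category.assoc, TopCat.Presheaf.germ_res']

theorem appLE_restrict {V V' : Y.Opens} {W W' : X.Opens} (e : W ≤ φ ⁻¹ᵁ V) (e' : W' ≤ φ ⁻¹ᵁ V')
    (hV : V' ≤ V) (hW : W' ≤ W) :
    Y.presheaf.map (homOfLE hV).op ≫ φ.appLE V' W' e' =
      φ.appLE V W e ≫ X.presheaf.map (homOfLE hW).op := by
  rw [Scheme.Hom.map_appLE, Scheme.Hom.appLE_map]

/-- The germ at `y` of a `p`-form `ω` that is given over an open set `W` of `X` lying over an open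
set `V` of `Y`. -/
def formGerm {V : Y.Opens} {W : X.Opens} (e : W ≤ φ ⁻¹ᵁ V) (ω : Forms (φ.appLE V W e) p)
    (y : X) (hy : y ∈ W) : Forms (φ.stalkMap y) p :=
  Forms.map (germ_appLE φ e y hy) p ω

theorem formGerm_restrict {V V' : Y.Opens} {W W' : X.Opens} (e : W ≤ φ ⁻¹ᵁ V)
    (e' : W' ≤ φ ⁻¹ᵁ V') (hV : V' ≤ V) (hW : W' ≤ W) (ω : Forms (φ.appLE V W e) p)
    (y : X) (hy : y ∈ W') :
    formGerm φ p e' (Forms.map (appLE_restrict φ e e' hV hW) p ω) y hy =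
      formGerm φ p e ω y (hW hy) := by
  exact Forms.map_comp (appLE_restrict φ e e' hV hW) (germ_appLE φ e' y hy)
    (germ_appLE φ e y (hW hy)) (Y.presheaf.germ_res _ _ _) (X.presheaf.germ_res _ _ _) p ω

/-- The sheaf `Ω^p_{X/Y}` of relative Kähler differential forms: the families of elements of the
stalks `⋀ᵖ Ω_{𝒪_{X,x}/𝒪_{Y,φ(x)}}` that are locally the germs of an element of `⋀ᵖ Ω` of the ring
homomorphism `𝒪_Y(V) → 𝒪_X(W)`, with `W` mapping into `V`. -/
def relForms : SectionCondition fun x : X => Forms (φ.stalkMap x) p where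
  sections U :=
    { carrier := {s | ∀ x : U, ∃ (V : Y.Opens) (W : X.Opens) (_ : x.1 ∈ W) (h : W ≤ U)
        (e : W ≤ φ ⁻¹ᵁ V) (ω : Forms (φ.appLE V W e) p),
        ∀ y : W, s ⟨y, h y.2⟩ = formGerm φ p e ω y y.2}
      zero_mem' := fun x => ⟨⊤, U, x.2, le_rfl, le_top, 0, fun y => (map_zero (Forms.map _ p)).symm⟩
      neg_mem' := by
        intro s hs x
        obtain ⟨V, W, hx, h, e, ω, hω⟩ := hs x
        exact ⟨V, W, hx, h, e, -ω, fun y =>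
          (congrArg Neg.neg (hω y)).trans (map_neg (Forms.map (germ_appLE φ e y y.2) p) ω).symm⟩
      add_mem' := by
        intro s s' hs hs' x
        obtain ⟨V, W, hx, h, e, ω, hω⟩ := hs x
        obtain ⟨V', W', hx', h', e', ω', hω'⟩ := hs' x
        refine ⟨V ⊓ V', W ⊓ W', ⟨hx, hx'⟩, inf_le_left.trans h, inf_le_inf e e',
          Forms.map (appLE_restrict φ e _ inf_le_left inf_le_left) p ω +
          Forms.map (appLE_restrict φ e' _ inf_le_right inf_le_right) p ω', fun y => ?_⟩
        refine (congrArg₂ (· + ·) ((hω ⟨y, y.2.1⟩).trans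
          (formGerm_restrict φ p e (inf_le_inf e e') inf_le_left inf_le_left ω y y.2).symm)
          ((hω' ⟨y, y.2.2⟩).trans (formGerm_restrict φ p e' (inf_le_inf e e')
            inf_le_right inf_le_right ω' y y.2).symm)).trans ?_
        exact (map_add (Forms.map (germ_appLE φ (inf_le_inf e e') y y.2) p) _ _).symm }
  smul_mem := by
    intro U r s hs x
    obtain ⟨V, W, hx, h, e, ω, hω⟩ := hs x
    refine ⟨V, W, hx, h, e, X.presheaf.map (homOfLE h).op r • ω, fun y => ?_⟩
    refine (congrArg₂ (· • ·) ?_ (hω y)).trans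
      ((Forms.map (germ_appLE φ e y y.2) p).map_smulₛₗ _ _).symm
    exact (X.presheaf.germ_res_apply (homOfLE h) y y.2 r).symm
  res_mem := by
    intro U U' hU s hs x
    obtain ⟨V, W, hx, h, e, ω, hω⟩ := hs ⟨x, hU x.2⟩
    refine ⟨V, W ⊓ U', ⟨hx, x.2⟩, inf_le_right, inf_le_left.trans e,
      Forms.map (appLE_restrict φ e _ le_rfl inf_le_left) p ω, fun y => ?_⟩
    exact (hω ⟨y, y.2.1⟩).trans
      (formGerm_restrict φ p e (inf_le_left.trans e) le_rfl inf_le_left ω y y.2).symm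
  locality := by
    intro U s hs x
    obtain ⟨U', hx, hU, h'⟩ := hs x
    obtain ⟨V, W, hx, h, e, ω, hω⟩ := h' ⟨x, hx⟩
    exact ⟨V, W, hx, h.trans hU, e, ω, hω⟩

variable {φ} {Z : Scheme.{u}} (g : Z ⟶ X)

/-- Pull-back of the stalks of Kähler differential forms along `g : Z ⟶ X` over `Y`. -/
def stalkPullback (z : Z) : Forms (φ.stalkMap (g z)) p →ₛₗ[(g.stalkMap z).hom]
    Forms ((g ≫ φ).stalkMap z) p :=
  Forms.map (g := 𝟙 _) (f := φ.stalkMap (g z)) (f' := (g ≫ φ).stalkMap z) (g' := g.stalkMap z)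
    ((Category.id_comp _).trans (Scheme.Hom.stalkMap_comp g φ z)) p

/-- The pull-back map `Ω^p_{X/Y} → g_* Ω^p_{Z/Y}` of Kähler differential forms, for `g : Z ⟶ X` over
`Y`. -/
def kaehlerPullback :
    (relForms φ p).sheaf ⟶ (Scheme.Modules.pushforward g).obj (relForms (g ≫ φ) p).sheaf :=
  (relForms φ p).pullbackHom g (relForms (g ≫ φ) p) (stalkPullback p g) (by
    intro U s hs z
    obtain ⟨V, W, hx, h, e, ω, hω⟩ := hs ⟨g z, z.2⟩
    have e' : g ⁻¹ᵁ W ≤ (g ≫ φ) ⁻¹ᵁ V := fun y hy => e hy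
    have fac : 𝟙 _ ≫ (g ≫ φ).appLE V (g ⁻¹ᵁ W) e' = φ.appLE V W e ≫ g.app W := by
      rw [Category.id_comp, Scheme.Hom.app_eq_appLE, Scheme.Hom.appLE_comp_appLE]
    refine ⟨V, g ⁻¹ᵁ W, hx, fun y hy => h hy, e', Forms.map fac p ω, fun y => ?_⟩
    refine (congrArg _ (hω ⟨g y, y.2⟩)).trans ?_
    refine (Forms.map_comp (germ_appLE φ e (g y) y.2) _
      (k := Y.presheaf.germ V (φ (g y)) (e y.2))
      (k' := g.app W ≫ Z.presheaf.germ (g ⁻¹ᵁ W) y y.2) ?_ (Category.comp_id _)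
      (Scheme.Hom.germ_stalkMap g W y y.2) p ω).trans
      (Forms.map_comp fac (germ_appLE (g ≫ φ) e' y y.2) _ (Category.id_comp _) rfl p ω).symm
    rw [← Category.assoc, ← fac, Category.id_comp]
    exact germ_appLE (g ≫ φ) e' y y.2)

end RelativeForms

/-! ### Torsion and torsion-free differential forms -/

section Torsion

variable {X Y : Scheme.{u}} (φ : X ⟶ Y) (p : ℕ)

/-- The torsion sections of `Ω^p_{X/Y}`: those whose germ at every point `x` is annihilated by a
nonzerodivisor of `𝒪_{X,x}`, that is, vanishes in `Ω^p_{X/Y} ⊗ 𝓡_X`, where `𝓡_X` is the sheaf of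
rational functions (total quotient rings). -/
def torsionSections : (relForms φ p).sheaf.val.Submodule where
  obj U :=
    { carrier := {s : (relForms φ p).sections U.unop | ∀ x : U.unop,
        s.1 x ∈ Submodule.torsion (X.presheaf.stalk x) (Forms (φ.stalkMap x.1) p)}
      zero_mem' := fun _ => Submodule.zero_mem _
      add_mem' := fun hs ht x => Submodule.add_mem _ (hs x) (ht x)
      smul_mem' := fun _ _ hs x => Submodule.smul_mem _ _ (hs x) }
  map i _ hs x := hs ⟨x, i.unop.le x.2⟩

/-- The torsion subsheaf `tor Ω^p_{X/Y}`. -/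
def torsionForms : X.Modules :=
  subsheaf (relForms φ p).sheaf (torsionSections φ p) fun _ _ hs x =>
    let ⟨_, hx, _, h⟩ := hs x x.2
    h ⟨x, hx⟩

/-- The inclusion `tor Ω^p_{X/Y} → Ω^p_{X/Y}`. -/
def torsionFormsι : torsionForms φ p ⟶ (relForms φ p).sheaf := subsheafι _ _ _

/-- The sheaf `Ω̌^p_{X/Y} = Ω^p_{X/Y} / tor` of torsion-free differential forms. -/
def torsionFreeForms : X.Modules := Limits.cokernel (torsionFormsι φ p)

/-- The quotient map `Ω^p_{X/Y} → Ω̌^p_{X/Y}`. -/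
def toTorsionFreeForms : (relForms φ p).sheaf ⟶ torsionFreeForms φ p :=
  Limits.cokernel.π (torsionFormsι φ p)

end Torsion

/-! ### Tensor products and ideal sheaves as sheaves of modules -/

section Tensor

variable {X : Scheme.{u}} (M N : X.Modules)

/-- The presheaf tensor product `U ↦ M(U) ⊗ N(U)`. -/
def presheafTensor : X.PresheafOfModules :=
  MonoidalCategory.tensorObj (C := PresheafOfModules.{u} (X.presheaf ⋙ forget₂ CommRingCat RingCat))
    M.val N.val

/-- The tensor product `M ⊗ N` of sheaves of `𝒪_X`-modules. -/
def tensor : X.Modules :=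
  (PresheafOfModules.sheafification (𝟙 X.ringCatSheaf.obj)).obj (presheafTensor M N)

variable {M N} in
/-- The section `m ⊗ n` of `M ⊗ N`. -/
def tmul {U : X.Opens} (m : Γ(M, U)) (n : Γ(N, U)) : Γ(tensor M N, U) :=
  ((PresheafOfModules.sheafificationAdjunction (𝟙 X.ringCatSheaf.obj)).unit.app
    (presheafTensor M N)).app (op U) (TensorProduct.tmul Γ(X, U) m n)

end Tensor

section IdealSheaf

variable {X : Scheme.{u}} (I : X.IdealSheafData)

/-- The structure sheaf as a sheaf of modules. -/
def structureModule (X : Scheme.{u}) : X.Modules := SheafOfModules.unit X.ringCatSheaf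

/-- The functions that restrict to `0` on the closed subscheme of an ideal sheaf. -/
def idealSections : (structureModule X).val.Submodule where
  obj U := RingHom.ker (I.subschemeι.app U.unop).hom
  map {U V} i s hs := by
    have : I.subschemeι.app U.unop s = 0 := hs
    change I.subschemeι.app V.unop (X.presheaf.map i s) = 0
    exact (ConcreteCategory.congr_hom (I.subschemeι.naturality i) s).trans
      ((congrArg _ this).trans (RingHom.map_zero _))

/-- The ideal sheaf as a sheaf of `𝒪_X`-modules: the kernel of the restriction of functions to the
closed subscheme. -/
def idealModule : X.Modules :=
  subsheaf (structureModule X) (idealSections I) fun U s hs => by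
    change I.subschemeι.app U s = 0
    refine TopCat.Presheaf.IsSheaf.section_ext I.subscheme.sheaf.2 fun z hz => ?_
    obtain ⟨V, hV, i, h⟩ := hs (I.subschemeι z) hz
    refine ⟨I.subschemeι ⁻¹ᵁ V, fun y hy => i.le hy, hV, ?_⟩
    refine (ConcreteCategory.congr_hom (I.subschemeι.naturality i.op) s).symm.trans ?_
    exact (show I.subschemeι.app V (X.presheaf.map i.op s) = 0 from h).trans
      (RingHom.map_zero _).symm

/-- A section of the ideal sheaf, regarded as a function. -/
def idealModule.toSection {U : X.Opens} {I : X.IdealSheafData} (f : Γ(idealModule I, U)) :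
    Γ(X, U) :=
  (show (idealSections I).obj (op U) from f).1

end IdealSheaf

/-! ### Reduced divisors, snc pairs and snc morphisms -/

/-- A reduced effective Weil divisor `D = D₁ + ⋯ + D_r`: a finite set of distinct irreducible
closed subsets of codimension one. -/
structure ReducedDivisor (X : Scheme.{u}) where
  /-- the irreducible components of the divisor -/
  components : Finset (IrreducibleCloseds X)
  codim_one : ∀ Z ∈ components, Order.coheight Z = 1

/-- The ideal sheaf of an irreducible closed subset with its reduced scheme structure. -/
def componentIdeal {X : Scheme.{u}} (Z : IrreducibleCloseds X) : X.IdealSheafData :=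
  .vanishingIdeal ⟨Z, Z.isClosed⟩

namespace ReducedDivisor

variable {X Y : Scheme.{u}} (D : ReducedDivisor X)

/-- The support of `D`, the union of its components. -/
def support : Closeds X := ⨆ Z ∈ D.components, (⟨Z, Z.isClosed⟩ : Closeds X)

/-- The ideal sheaf `I_D` of `D` with its reduced scheme structure. -/
def ideal : X.IdealSheafData := .vanishingIdeal D.support

theorem ideal_le (Z : D.components) : D.ideal ≤ componentIdeal Z.1 :=
  Scheme.IdealSheafData.vanishingIdeal_antimono <|
    le_iSup₂ (f := fun Z (_ : Z ∈ D.components) => (⟨Z, Z.isClosed⟩ : Closeds X)) Z.1 Z.2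

/-- `D` as a reduced closed subscheme of `X`. -/
abbrev scheme : Scheme.{u} := D.ideal.subscheme

/-- The inclusion `D → X`. -/
abbrev ι : D.scheme ⟶ X := D.ideal.subschemeι

/-- The component `Dᵢ` as a reduced closed subscheme. -/
abbrev component (Z : D.components) : Scheme.{u} := (componentIdeal Z.1).subscheme

/-- The inclusion `Dᵢ → D`. -/
def componentι (Z : D.components) : D.component Z ⟶ D.scheme :=
  Scheme.IdealSheafData.inclusion (D.ideal_le Z)

/-- The ideal sheaf of the scheme-theoretic intersection `D_I = ⋂_{i ∈ I} Dᵢ`; it is zero, so that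
`D_I = X`, if `I` is empty. -/
def stratumIdeal (I : Finset D.components) : X.IdealSheafData :=
  ⨆ Z ∈ I, componentIdeal Z.1

/-- The scheme-theoretic intersection `D_I`. -/
abbrev stratum (I : Finset D.components) : Scheme.{u} := (D.stratumIdeal I).subscheme

/-- The inclusion `D_I → X`. -/
abbrev stratumι (I : Finset D.components) : D.stratum I ⟶ X := (D.stratumIdeal I).subschemeι

/-- `(X, D)` is an snc pair over the base field, with `X` smooth of dimension `n`: all nonempty
intersections `D_I` (in particular `D_∅ = X`) are smooth of codimension `|I|` in `X`, that is, of
pure dimension `n - |I|`. Here `π` is the structure morphism of `X`. -/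
def IsSNC {S : Scheme.{u}} (π : X ⟶ S) (n : ℕ) : Prop :=
  SmoothOfRelativeDimension n π ∧ ∀ I : Finset D.components, Nonempty (D.stratum I) →
    ∃ d : ℕ, d + I.card = n ∧ SmoothOfRelativeDimension d (D.stratumι I ≫ π)

/-- `D` is relatively snc over `Y`, where `dim X = n` and `dim Y = m`: the morphism `φ : X ⟶ Y` is
surjective, and its restriction to every nonempty `D_I` (in particular to `D_∅ = X`) is smooth of
relative dimension `n - m - |I|`. -/
def IsRelativelySNC (φ : X ⟶ Y) (n m : ℕ) : Prop :=
  Surjective φ ∧ ∀ I : Finset D.components, Nonempty (D.stratum I) →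
    ∃ d : ℕ, d + m + I.card = n ∧ SmoothOfRelativeDimension d (D.stratumι I ≫ φ)

/-! ### Logarithmic differential forms -/

section Log

variable [IsIntegral X] (φ : X ⟶ Y) (p : ℕ)

/-- The map from the local ring at `x` to the function field of `X`. -/
abbrev toGeneric (x : X) : X.presheaf.stalk x ⟶ X.functionField :=
  X.presheaf.stalkSpecializes ((genericPoint_spec X).specializes (by trivial))

/-- The rational relative one-forms on `X`, a vector space over the function field: the stalk of
`Ω¹_{X/Y}` at the generic point. -/
abbrev RationalOneForms : ModuleCat X.functionField :=
  CommRingCat.KaehlerDifferential (φ.stalkMap (genericPoint X))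

/-- The rational relative `p`-forms on `X`: the stalk of `Ω^p_{X/Y}` at the generic point. -/
abbrev RationalForms : ModuleCat X.functionField := Forms (φ.stalkMap (genericPoint X)) p

/-- The rational form defined by a germ of a form at `x`. -/
def formToGeneric (x : X) :
    Forms (φ.stalkMap x) p →ₛₗ[(toGeneric x).hom] RationalForms φ p :=
  Forms.map (Scheme.Hom.stalkSpecializes_stalkMap φ _ _ _) p

/-- `f` is an equation of `Z` on the affine open set `V`: it generates the ideal of `Z`. -/
def IsLocalEquation (Z : IrreducibleCloseds X) (V : X.affineOpens) (f : Γ(X, V.1)) : Prop :=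
  (componentIdeal Z).ideal V = Ideal.span {f}

/-- The stalk `Ω¹_{X/Y}(log D)_x`: the `𝒪_{X,x}`-module of rational one-forms generated by the
regular differentials `db` and by `df / f` for the local equations `f` of the components of `D`. -/
def logOneForms (x : X) : Submodule (X.presheaf.stalk x)
    ((ModuleCat.restrictScalars (toGeneric x).hom).obj (RationalOneForms φ)) :=
  Submodule.span _
    ({ω : RationalOneForms φ | ∃ b : X.presheaf.stalk x,
        ω = CommRingCat.KaehlerDifferential.d (toGeneric x b)} ∪
      {ω : RationalOneForms φ | ∃ Z ∈ D.components, ∃ (V : X.affineOpens) (hx : x ∈ V.1)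
        (f : Γ(X, V.1)), IsLocalEquation Z V f ∧
        ω = (toGeneric x (X.presheaf.germ V.1 x hx f))⁻¹ •
          CommRingCat.KaehlerDifferential.d (toGeneric x (X.presheaf.germ V.1 x hx f))})

/-- The stalk `Ω^p_{X/Y}(log D)_x = ⋀ᵖ Ω¹_{X/Y}(log D)_x`: the `𝒪_{X,x}`-module of rational `p`-forms
generated by the wedge products of logarithmic one-forms. -/
def logFormsStalk (x : X) : Submodule (X.presheaf.stalk x)
    ((ModuleCat.restrictScalars (toGeneric x).hom).obj (RationalForms φ p)) :=
  Submodule.span _ {ω : RationalForms φ p | ∃ η : Fin p → RationalOneForms φ,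
    (∀ j, η j ∈ D.logOneForms φ x) ∧ ω = wedge η}

/-- The sheaf `Ω^p_{X/Y}(log D)` of relative logarithmic forms: the rational forms (locally constant
families of elements of the space of rational forms) which are logarithmic at every point. -/
def logForms : SectionCondition fun x : X =>
    (ModuleCat.restrictScalars (toGeneric x).hom).obj (RationalForms φ p) where
  sections U :=
    { carrier := {s | ∀ x : U, s x ∈ D.logFormsStalk φ p x ∧
        ∃ (W : X.Opens) (_ : x.1 ∈ W) (h : W ≤ U), ∀ y : W,
          (show RationalForms φ p from s ⟨y, h y.2⟩) = s x}
      zero_mem' := fun x => ⟨Submodule.zero_mem _, U, x.2, le_rfl, fun _ => rfl⟩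
      neg_mem' := by
        intro s hs x
        obtain ⟨hx, W, hW, h, e⟩ := hs x
        exact ⟨Submodule.neg_mem _ hx, W, hW, h, fun y => congrArg Neg.neg (e y)⟩
      add_mem' := by
        intro s t hs ht x
        obtain ⟨hx, W, hW, h, e⟩ := hs x
        obtain ⟨hx', W', hW', h', e'⟩ := ht x
        exact ⟨Submodule.add_mem _ hx hx', W ⊓ W', ⟨hW, hW'⟩, inf_le_left.trans h,
          fun y => congrArg₂ (fun a b : RationalForms φ p => a + b) (e ⟨y, y.2.1⟩) (e' ⟨y, y.2.2⟩)⟩ }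
  smul_mem := by
    intro U r s hs x
    obtain ⟨hx, W, hW, h, e⟩ := hs x
    refine ⟨Submodule.smul_mem _ _ hx, W, hW, h, fun y => ?_⟩
    refine congrArg₂ (fun (a : X.functionField) (b : RationalForms φ p) => a • b) ?_ (e y)
    exact (X.presheaf.germ_stalkSpecializes_apply _ _ _).trans
      (X.presheaf.germ_stalkSpecializes_apply _ _ _).symm
  res_mem := by
    intro U U' hU s hs x
    obtain ⟨hx, W, hW, h, e⟩ := hs ⟨x, hU x.2⟩
    exact ⟨hx, W ⊓ U', ⟨hW, x.2⟩, inf_le_right, fun y => e ⟨y, y.2.1⟩⟩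
  locality := by
    intro U s hs x
    obtain ⟨U', hx', hU, h'⟩ := hs x
    obtain ⟨hx, W, hW, h, e⟩ := h' ⟨x, hx'⟩
    exact ⟨hx, W, hW, h.trans hU, e⟩

end Log
section Sequence

attribute [local instance] Abelian.hasFiniteBiproducts

variable (φ : X ⟶ Y) (p : ℕ)

/-- The map `B : Ω^p_{X/Y} → Ω^p_{D/Y} → Ω̌^p_{D/Y}` of sheaves on `X` (sheaves on `D` are regarded as
sheaves on `X` by push-forward): restrict forms to `D`, then divide by torsion. -/
def restrictTorsionFree : (relForms φ p).sheaf ⟶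
    (Scheme.Modules.pushforward D.ι).obj (torsionFreeForms (D.ι ≫ φ) p) :=
  kaehlerPullback p D.ι ≫
    (Scheme.Modules.pushforward D.ι).map (toTorsionFreeForms (D.ι ≫ φ) p)

/-- The map `ψ : Ω^p_{D/Y} → ⨁ᵢ (ιᵢ)_* Ω^p_{Dᵢ/Y}` of sheaves on `D` given by restricting forms to
the components `Dᵢ` of `D`. -/
def restrictComponents : (relForms (D.ι ≫ φ) p).sheaf ⟶
    ⨁ fun Z : D.components => (Scheme.Modules.pushforward (D.componentι Z)).obj
      (relForms (D.componentι Z ≫ D.ι ≫ φ) p).sheaf :=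
  Limits.biproduct.lift fun Z => kaehlerPullback p (D.componentι Z)

/-- `A : Ω^p_{X/Y}(log D) ⊗ I_D → Ω^p_{X/Y}` is the natural map: it sends `ω ⊗ f` to the product
`f · ω`, an equality of rational forms. -/
def IsMultiplication [IsIntegral X]
    (A : tensor (D.logForms φ p).sheaf (idealModule D.ideal) ⟶ (relForms φ p).sheaf) : Prop :=
  ∀ (U : X.Opens) (ω : Γ((D.logForms φ p).sheaf, U)) (f : Γ(idealModule D.ideal, U)) (x : U),
    formToGeneric φ p x ((relForms φ p).value (A.app U (tmul ω f)) x) =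
      toGeneric x.1 (X.presheaf.germ U x x.2 (idealModule.toSection f)) •
        (show RationalForms φ p from (D.logForms φ p).value ω x)

end Sequence

end ReducedDivisor

end

end LogSequence

open LogSequence

/-!
All statements are local, and near a point `x` of `X` the situation is that of coordinates. Since the
strata of `D` are smooth over `Y` of the expected dimensions, every component through `x` has one local
equation `f t`, a prime element of `𝒪_{X,x}`, and the differentials `d(f t)` are part of a basis of the
free module `Ω¹_{X/Y,x}` (`ReducedDivisor.Frame`, `IsRelativelySNC.nonempty_frame`). With `f = ∏ f t`
the equation of `D`, forms are compared through their coordinates in the wedge products of this basis: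

* A form vanishes on the component `f t = 0` if and only if its coordinates that do not involve
  `d(f t)` are divisible by `f t` (`LogFrame.map_eq_zero_iff`).
* A form on `D` is torsion if and only if it vanishes on all components (`LogFrame.mem_torsion_iff`).
  One implication holds since the components are integral with free differentials. For the other, let
  `g t` be the product of the equations other than `f t`. From `0 = d(f t * g t)` on `D` one gets
  `(g t)² d(f t) = 0`, and a form that vanishes on all components is killed by the nonzerodivisor
  `∑ (g t)²`.
* The stalk of `Ω^p(log D)` is free on the wedge products of the `d(f t) / f t` and the remaining basis
  elements. So a rational form `ω` is logarithmic if and only if `f ω` is regular with coordinates as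
  in the first item for all `t`, that is, if and only if `f ω` is a regular form whose restriction to
  `D` is torsion (`Frame.mem_logFormsStalk_iff_restrictsToTorsion`).

The third item says that multiplication by `f` identifies `Ω^p(log D)` with the kernel of
`B : Ω^p_{X/Y} → Ω̌^p_{D/Y}`, which gives the left part of the sequence (`IsMultiplication.mono`,
`IsMultiplication.exact`); `B` is an epimorphism since forms on a closed subscheme lift locally
(`epi_restrictTorsionFree`). The second item says that the torsion of `Ω^p_{D/Y}` is the kernel of the
restriction to the components, so that `Ω̌^p_{D/Y}` is its image (`exists_iso_image_restrictComponents`).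
-/

namespace LogSequence

/-! ### Products of distinct primes -/

section Products

variable {R : Type*} [CommRing R] {I T : Type*} {p : ℕ}

/-- The product of the `f t` whose coordinate `pos t` does not occur in `s`. -/
noncomputable def coProd [Fintype T] (f : T → R) (pos : T → I) (s : Set.powersetCard I p) : R :=
  haveI := Classical.decPred fun t => pos t ∈ s
  ∏ t with pos t ∉ s, f t

theorem dvd_coProd [Fintype T] (f : T → R) (pos : T → I) (s : Set.powersetCard I p)
    {t : T} (ht : pos t ∉ s) : f t ∣ coProd f pos s :=
  Finset.dvd_prod_of_mem f (by simpa using ht)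

theorem prod_dvd_of_prime [IsDomain R] (f : T → R) (hf : ∀ t, Prime (f t))
    (hne : ∀ t t', f t ∣ f t' → t = t') (s : Finset T) {r : R} (h : ∀ t ∈ s, f t ∣ r) :
    ∏ t ∈ s, f t ∣ r := by
  classical
  induction s using Finset.induction_on with
  | empty => simp
  | insert a s ha ih =>
    obtain ⟨q, rfl⟩ := ih fun t ht => h t (Finset.mem_insert_of_mem ht)
    rw [Finset.prod_insert ha, mul_comm]
    refine mul_dvd_mul_left _ ?_
    rcases (hf a).dvd_or_dvd (h a (Finset.mem_insert_self a s)) with hd | hd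
    · obtain ⟨t, ht, hd⟩ := ((hf a).dvd_finsetProd_iff _).1 hd
      exact absurd (hne _ _ hd ▸ ht) ha
    · exact hd

/-- `coProd f pos s` divides whatever the `f t` with `pos t ∉ s` divide, because these are primes
none of which divides another. -/
theorem coProd_dvd [Fintype T] [IsDomain R] (f : T → R) (pos : T → I)
    (s : Set.powersetCard I p)
    (hf : ∀ t, Prime (f t)) (hne : ∀ t t', f t ∣ f t' → t = t') {r : R}
    (h : ∀ t, pos t ∉ s → f t ∣ r) : coProd f pos s ∣ r :=
  prod_dvd_of_prime f hf hne _ fun t ht => h t (by simpa using ht)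

end Products

/-! ### Coordinates on exterior powers along semilinear maps -/

section ExteriorPower

open exteriorPower Module Set.powersetCard

theorem smul_ιMulti_eq_zero {R M : Type*} [CommRing R] [AddCommGroup M] [Module R M] {p : ℕ}
    (v : Fin p → M) (k : Fin p) (r : R) (h : r • v k = 0) : r • ιMulti R p v = 0 := by
  have := (ιMulti R p).map_update_smul v k r (v k)
  rwa [h, (ιMulti R p).map_update_zero, Function.update_eq_self, eq_comm] at this

variable {R S : Type*} [CommRing R] [CommRing S] {σ : R →+* S} {M N : Type*}
  [AddCommGroup M] [Module R M] [AddCommGroup N] [Module S N] {I : Type*} [LinearOrder I] {p : ℕ}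

/-- Let `F` be the map of exterior powers induced by a semilinear map `u`. If functionals `c i` with
`i ∈ s` compute along `u` the coordinates with respect to a basis `e`, then the wedge product of the
`c i` computes along `F` the coordinate with index `s`. -/
theorem pairingDual_semilinear (u : M →ₛₗ[σ] N) (F : ⋀[R]^p M →ₛₗ[σ] ⋀[S]^p N)
    (hF : ∀ v, F (ιMulti R p v) = ιMulti S p (u ∘ v)) (e : Basis I R M) (c : I → Dual S N)
    (s : Set.powersetCard I p) (hc : ∀ i ∈ s, ∀ m, c i (u m) = σ (e.coord i m)) (x : ⋀[R]^p M) :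
    pairingDual S N p (ιMulti_family S p c s) (F x) = σ ((e.exteriorPower p).repr x s) := by
  have hx : x ∈ Submodule.span R (Set.range (ιMulti R p (M := M))) := by
    rw [ιMulti_span]; trivial
  induction hx using Submodule.span_induction with
  | mem x hx =>
    obtain ⟨v, rfl⟩ := hx
    rw [hF, ιMulti_family, pairingDual_ιMulti_ιMulti, basis_repr_apply, ιMultiDual_apply_ιMulti,
      RingHom.map_det]
    congr 1
    ext i j
    exact hc _ ((mem_range_ofFinEmbEquiv_symm_iff_mem s _).1 ⟨j, rfl⟩) _
  | zero => simp
  | add x y _ _ hx hy => simp [hx, hy]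
  | smul r x _ hx => simp [hx]

theorem repr_exteriorPower_semilinear (u : M →ₛₗ[σ] N) (F : ⋀[R]^p M →ₛₗ[σ] ⋀[S]^p N)
    (hF : ∀ v, F (ιMulti R p v) = ιMulti S p (u ∘ v)) (e : Basis I R M) (e' : Basis I S N)
    (he : ∀ i, e' i = u (e i)) (x : ⋀[R]^p M) (s : Set.powersetCard I p) :
    (e'.exteriorPower p).repr (F x) s = σ ((e.exteriorPower p).repr x s) := by
  rw [basis_repr_apply, ιMultiDual]
  refine pairingDual_semilinear u F hF e e'.coord s (fun i _ m => ?_) x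
  induction e.mem_span m using Submodule.span_induction with
  | zero => simp
  | add x y _ _ hx hy => simp_all
  | smul r x _ hx => simp_all
  | mem m hm =>
    obtain ⟨j, rfl⟩ := hm
    rw [← he]
    by_cases h : j = i <;> simp [h]

/-- Values of `F` lie in a submodule if their components along the basis do. -/
theorem mem_of_repr (F : ⋀[R]^p M →ₛₗ[σ] ⋀[S]^p N) (e : Basis I R M) (P : Submodule S (⋀[S]^p N))
    (x : ⋀[R]^p M) (h : ∀ s, σ ((e.exteriorPower p).repr x s) • F (ιMulti_family R p e s) ∈ P) :
    F x ∈ P := by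
  rw [← (e.exteriorPower p).linearCombination_repr x, Finsupp.linearCombination_apply,
    Finsupp.sum, map_sum]
  refine sum_mem fun s _ => ?_
  rw [map_smulₛₗ, coe_basis]
  exact h s

/-- If `e i₀` spans the kernel of `u` modulo `f`, a form whose coordinates avoiding `i₀` are
divisible by `f` restricts to zero. -/
theorem map_eq_zero_of_dvd_repr (u : M →ₛₗ[σ] N) (F : ⋀[R]^p M →ₛₗ[σ] ⋀[S]^p N)
    (hF : ∀ v, F (ιMulti R p v) = ιMulti S p (u ∘ v)) (e : Basis I R M) {i₀ : I} {f : R}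
    (hf : σ f = 0) (he : u (e i₀) = 0) (x : ⋀[R]^p M)
    (h : ∀ s : Set.powersetCard I p, i₀ ∉ s → f ∣ (e.exteriorPower p).repr x s) : F x = 0 := by
  refine (Submodule.mem_bot S).1 (mem_of_repr F e ⊥ x fun s => (Submodule.mem_bot S).2 ?_)
  by_cases hs : i₀ ∈ s
  · obtain ⟨k, hk⟩ := (mem_range_ofFinEmbEquiv_symm_iff_mem s i₀).2 hs
    rw [ιMulti_family, hF, (ιMulti S p).map_coord_zero k, smul_zero]
    simp [hk, he]
  · obtain ⟨r, hr⟩ := h s hs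
    rw [hr, map_mul, hf, zero_mul, zero_smul]

/-- The converse of `map_eq_zero_of_dvd_repr` if the target is a domain: a form of which a nonzero
multiple restricts to zero has all coordinates avoiding `i₀` divisible by `f`. The functionals `c i`
stand for the coordinates on the target, where the image of `e` without `e i₀` need not be known
to be a basis. -/
theorem dvd_repr_of_smul_map_eq_zero [NoZeroDivisors S] (u : M →ₛₗ[σ] N)
    (F : ⋀[R]^p M →ₛₗ[σ] ⋀[S]^p N)
    (hF : ∀ v, F (ιMulti R p v) = ιMulti S p (u ∘ v)) (e : Basis I R M) {i₀ : I} {f : R}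
    (hf : ∀ r, σ r = 0 → f ∣ r) (c : I → Dual S N)
    (hc : ∀ i, i ≠ i₀ → ∀ m, c i (u m) = σ (e.coord i m)) (x : ⋀[R]^p M) {a : S} (ha : a ≠ 0)
    (hx : a • F x = 0) (s : Set.powersetCard I p) (hs : i₀ ∉ s) :
    f ∣ (e.exteriorPower p).repr x s := by
  apply hf
  rw [← pairingDual_semilinear u F hF e c s (fun i hi => hc i (by rintro rfl; exact hs hi)) x]
  have := congrArg (pairingDual S N p (ιMulti_family S p c s)) hx
  rw [map_smul, map_zero, smul_eq_mul] at this
  exact (mul_eq_zero.1 this).resolve_left ha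

/-- The product of all `f t` splits into the part of the indices in `s`, which is the product of the
denominators `φ` over `s`, and the complementary part. -/
theorem prod_eq_coProd_mul {T : Type*} [Fintype T] (f : T → R) (pos : T → I)
    (hpos : Function.Injective pos) (φ : I → R) (hφ : ∀ t, φ (pos t) = f t)
    (hφ' : ∀ i, i ∉ Set.range pos → φ i = 1) (s : Set.powersetCard I p) :
    ∏ t, f t = coProd f pos s * ∏ j, φ (ofFinEmbEquiv.symm s j) := by
  classical
  have h0 : coProd f pos s = ∏ t with pos t ∉ s, f t := by
    rw [coProd]
  rw [h0, ← Finset.prod_filter_not_mul_prod_filter Finset.univ (fun t => pos t ∈ s) f]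
  congr 1
  have h1 : ∏ j, φ (ofFinEmbEquiv.symm s j) = ∏ i ∈ s.1, φ i := by
    refine (Finset.prod_map Finset.univ (ofFinEmbEquiv.symm s).toEmbedding φ).symm.trans ?_
    refine Finset.prod_congr ?_ fun _ _ => rfl
    ext i
    refine Iff.trans ?_ (mem_range_ofFinEmbEquiv_symm_iff_mem s i)
    simp
  rw [h1, ← Finset.prod_subset (s₁ := (Finset.univ.filter fun t => pos t ∈ s).image pos)]
  · rw [Finset.prod_image fun _ _ _ _ h => hpos h]
    exact Finset.prod_congr rfl fun t _ => (hφ t).symm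
  · intro i hi
    obtain ⟨t, ht, rfl⟩ := Finset.mem_image.1 hi
    exact (Finset.mem_filter.1 ht).2
  · intro i hi hi'
    refine hφ' i ?_
    rintro ⟨t, rfl⟩
    exact hi' (Finset.mem_image.2 ⟨t, Finset.mem_filter.2 ⟨Finset.mem_univ _, hi⟩, rfl⟩)

end ExteriorPower

/-! ### Coordinates in a logarithmic basis -/

section LogBasis

open exteriorPower Module Set.powersetCard

variable {R K : Type*} [CommRing R] [CommRing K] {σ : R →+* K} {M N : Type*}
  [AddCommGroup M] [Module R M] [AddCommGroup N] [Module K N] {I : Type*} [LinearOrder I] {p : ℕ}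

theorem exists_repr_ιMulti_eq (ε : Basis I K N) (η : Fin p → N)
    (h : ∀ j i, ∃ r, ε.repr (η j) i = σ r) (s : Set.powersetCard I p) :
    ∃ r, (ε.exteriorPower p).repr (ιMulti K p η) s = σ r := by
  choose r hr using h
  -- The coordinates of a wedge product are minors of the coordinate matrix.
  refine ⟨(Matrix.of fun i j => r i (ofFinEmbEquiv.symm s j)).det, ?_⟩
  rw [basis_repr_apply, ιMultiDual_apply_ιMulti, RingHom.map_det]
  congr 1
  ext i j
  exact hr _ _

/-- A rational form has integral coordinates with respect to a logarithmic basis `e' i / φ i` if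
and only if its multiple by `∏ f t` is a regular form whose coordinates are divisible by the
complementary products of the `f t`. -/
theorem exists_repr_eq_iff [IsDomain R] [IsDomain K] (hσ : Function.Injective σ)
    (u : M →ₛₗ[σ] N) (F : ⋀[R]^p M →ₛₗ[σ] ⋀[K]^p N)
    (hF : ∀ v, F (ιMulti R p v) = ιMulti K p (u ∘ v)) (e : Basis I R M) (e' : Basis I K N)
    (he : ∀ i, e' i = u (e i)) {T : Type*} [Fintype T] (f : T → R) (pos : T → I)
    (hpos : Function.Injective pos) (hf : ∀ t, Prime (f t)) (hne : ∀ t t', f t ∣ f t' → t = t')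
    (φ : I → R) (hφ : ∀ t, φ (pos t) = f t)
    (hφ' : ∀ i, i ∉ Set.range pos → φ i = 1) (ε : Basis I K N)
    (hε : ∀ i, σ (φ i) • ε i = e' i) (ω : ⋀[K]^p N) :
    (∀ s, ∃ r, (ε.exteriorPower p).repr ω s = σ r) ↔
      ∃ x : ⋀[R]^p M, F x = σ (∏ t, f t) • ω ∧
        ∀ t (s : Set.powersetCard I p), pos t ∉ s → f t ∣ (e.exteriorPower p).repr x s := by
  classical
  have hrel : ∀ (ω : ⋀[K]^p N) (s : Set.powersetCard I p),
      (ε.exteriorPower p).repr ω s =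
        σ (∏ j, φ (ofFinEmbEquiv.symm s j)) * (e'.exteriorPower p).repr ω s := by
    intro ω s
    have hv : ∀ s : Set.powersetCard I p, ιMulti_family K p e' s =
        σ (∏ j, φ (ofFinEmbEquiv.symm s j)) • ιMulti_family K p ε s := by
      intro s
      have : (fun j => e' (ofFinEmbEquiv.symm s j)) = fun j =>
          σ (φ (ofFinEmbEquiv.symm s j)) • ε (ofFinEmbEquiv.symm s j) :=
        funext fun j => (hε _).symm
      rw [ιMulti_family, map_prod, ιMulti_family, ← AlternatingMap.map_smul_univ]
      exact congrArg _ this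
    induction (e'.exteriorPower p).mem_span ω using Submodule.span_induction with
    | zero => simp
    | add x y _ _ hx hy => simp [hx, hy, mul_add]
    | smul r x _ hx =>
      simp only [map_smul, Finsupp.smul_apply, hx, smul_eq_mul]
      ring
    | mem x hx =>
      obtain ⟨s', rfl⟩ := hx
      rw [coe_basis]
      nth_rw 1 [hv]
      rw [map_smul, basis_repr, basis_repr]
      by_cases hs : s' = s
      · subst hs; simp
      · simp [hs]
  have hprod := prod_eq_coProd_mul (p := p) f pos hpos φ hφ hφ'
  constructor
  · intro h
    choose r hr using h
    let c : Set.powersetCard I p →₀ R :=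
      Finsupp.onFinset ((ε.exteriorPower p).repr ω).support
        (fun s => coProd f pos s * r s) fun s hs => by
          rw [Finsupp.mem_support_iff, hr]
          intro h0
          rw [map_eq_zero_iff σ hσ] at h0
          exact hs (by rw [h0, mul_zero])
    refine ⟨(e.exteriorPower p).repr.symm c, ?_, fun t s hs => ?_⟩
    · apply (e'.exteriorPower p).repr.injective
      ext s
      rw [repr_exteriorPower_semilinear u F hF e e' he, LinearEquiv.apply_symm_apply, map_smul,
        Finsupp.smul_apply, hprod s, map_mul, smul_eq_mul, mul_assoc, ← hrel, hr, ← map_mul]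
      rfl
    · rw [LinearEquiv.apply_symm_apply]
      exact (dvd_coProd f pos s hs).mul_right _
  · rintro ⟨x, hx, hd⟩ s
    obtain ⟨r, hr⟩ := coProd_dvd f pos s hf hne fun t ht => hd t s ht
    refine ⟨r, ?_⟩
    have h1 := repr_exteriorPower_semilinear u F hF e e' he x s
    rw [hx, hr, map_smul, Finsupp.smul_apply, hprod s, smul_eq_mul, map_mul, mul_assoc, ← hrel,
      map_mul] at h1
    refine mul_left_cancel₀ ?_ h1
    intro h0
    have : σ (∏ t, f t) = 0 := by rw [hprod s, map_mul, h0, zero_mul]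
    rw [map_eq_zero_iff σ hσ] at this
    obtain ⟨t, -, ht⟩ := Finset.prod_eq_zero_iff.1 this
    exact (hf t).ne_zero ht

end LogBasis

/-! ### Coordinates adapted to a divisor, and torsion forms on the divisor -/

section LocalAlgebra

open Module

theorem forms_map_ιMulti {A B A' B' : CommRingCat.{u}} {f : A ⟶ B} {f' : A' ⟶ B'} {g : A ⟶ A'}
    {g' : B ⟶ B'} (fac : g ≫ f' = f ≫ g') (p : ℕ)
    (v : Fin p → CommRingCat.KaehlerDifferential f) :
    Forms.map fac p (exteriorPower.ιMulti B p v) =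
      exteriorPower.ιMulti B' p (kaehlerMap fac ∘ v) :=
  Forms.map_wedge fac v

variable {A B C : CommRingCat.{u}} {f : A ⟶ B} {f' : A ⟶ C} {q : B ⟶ C}

theorem d_mul (b b' : B) : CommRingCat.KaehlerDifferential.d (f := f) (b * b') =
    b • CommRingCat.KaehlerDifferential.d b' + b' • CommRingCat.KaehlerDifferential.d b :=
  ModuleCat.Derivation.d_mul _ _ _

theorem d_map (a : A) : CommRingCat.KaehlerDifferential.d (f := f) (f a) = 0 :=
  ModuleCat.Derivation.d_map _ _

theorem span_range_d (f : A ⟶ B) :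
    Submodule.span B (M := CommRingCat.KaehlerDifferential f)
      (Set.range (fun b => CommRingCat.KaehlerDifferential.d b)) = ⊤ :=
  let := f.hom.toAlgebra
  KaehlerDifferential.span_range_derivation A B

/-- A functional on `Ω_{B/A}` that kills `db` modulo `ker q` for all `b ∈ ker q` descends to
`Ω_{C/A}`. -/
theorem exists_descend (fac : 𝟙 A ≫ f' = f ≫ q) (hq : Function.Surjective q)
    (l : CommRingCat.KaehlerDifferential f →ₗ[B] B)
    (hl : ∀ b, q b = 0 → q (l (CommRingCat.KaehlerDifferential.d b)) = 0) :
    ∃ c : CommRingCat.KaehlerDifferential f' →ₗ[C] C, ∀ m, c (kaehlerMap fac m) = q (l m) := by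
  have hwd : ∀ b b', q b = q b' → q (l (CommRingCat.KaehlerDifferential.d b)) =
      q (l (CommRingCat.KaehlerDifferential.d b')) := by
    intro b b' h
    have h0 := hl (b - b') (by rw [map_sub, h, sub_self])
    have h1 : CommRingCat.KaehlerDifferential.d (f := f) b =
        CommRingCat.KaehlerDifferential.d (b - b') + CommRingCat.KaehlerDifferential.d b' := by
      rw [← ModuleCat.Derivation.d_add, sub_add_cancel]
    rw [h1, map_add, map_add, h0, zero_add]
  let s := Function.surjInv hq
  have hs : ∀ c, q (s c) = c := Function.surjInv_eq hq
  let D : (ModuleCat.of C C).Derivation f' := ModuleCat.Derivation.mk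
    (fun c => q (l (CommRingCat.KaehlerDifferential.d (s c))))
    (fun b b' => by
      rw [← map_add, ← map_add, ← ModuleCat.Derivation.d_add]
      exact hwd _ _ (by rw [map_add, hs, hs, hs]))
    (fun b b' => by
      refine (hwd _ (s b * s b') (by rw [map_mul, hs, hs, hs])).trans ?_
      rw [d_mul, map_add, map_add, l.map_smul, l.map_smul, smul_eq_mul,
        smul_eq_mul, map_mul, map_mul, hs, hs]
      rfl)
    (fun a => by
      refine (hwd _ (f a) ?_).trans ?_
      · rw [hs]
        exact congrArg (fun h => h a) (congrArg (fun h => h.hom) fac)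
      · rw [d_map, map_zero, map_zero])
  refine ⟨D.desc.hom, fun m => ?_⟩
  have hm : m ∈ Submodule.span B (M := CommRingCat.KaehlerDifferential f)
      (Set.range (fun b => CommRingCat.KaehlerDifferential.d b)) := by
    rw [span_range_d]; trivial
  induction hm using Submodule.span_induction with
  | mem x hx =>
    obtain ⟨b, rfl⟩ := hx
    change D.desc (kaehlerMap fac (CommRingCat.KaehlerDifferential.d b)) = _
    rw [kaehlerMap_d, ModuleCat.Derivation.desc_d]
    exact hwd _ _ (hs _)
  | zero => simp
  | add x y _ _ hx hy => simp [hx, hy]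
  | smul r x _ hx =>
    rw [map_smulₛₗ, map_smul, hx, map_smul, smul_eq_mul, smul_eq_mul, map_mul]

/-- Local coordinates for relative forms adapted to the components of a divisor: a basis of
`Ω_{B/A}` that contains the differentials of prime elements, the local equations of the
components. -/
structure LogFrame (f : A ⟶ B) (T : Type*) where
  /-- the index set of the basis -/
  index : Type
  /-- a linear order on the index set, to order the factors of wedge products -/
  [order : LinearOrder index]
  /-- the basis -/
  basis : Basis index B (CommRingCat.KaehlerDifferential f)
  /-- the equation of a component -/
  equation : T → B
  /-- the position of the differential of the equation in the basis -/
  pos : T → index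
  pos_injective : Function.Injective pos
  basis_pos : ∀ t, basis (pos t) = CommRingCat.KaehlerDifferential.d (equation t)
  prime : ∀ t, Prime (equation t)

namespace LogFrame

attribute [instance] LogFrame.order

variable {T : Type*} (E : LogFrame f T)

theorem coord_d_equation (i : E.index) (t : T) (hi : i ≠ E.pos t) :
    E.basis.coord i (CommRingCat.KaehlerDifferential.d (E.equation t)) = 0 := by
  rw [← E.basis_pos]
  simp [hi.symm]

/-- Distinct equations do not divide one another: `f' = f b` gives `df' = f db + b df`, whose
`df'`-coordinate, which is `1`, would be a multiple of `f`. -/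
theorem eq_of_dvd {t t' : T} (h : E.equation t ∣ E.equation t') : t = t' := by
  by_contra hne
  obtain ⟨b, hb⟩ := h
  have h1 : E.basis.coord (E.pos t') (CommRingCat.KaehlerDifferential.d (E.equation t')) = 1 := by
    rw [← E.basis_pos]
    simp
  rw [hb, d_mul, map_add, map_smul, map_smul,
    E.coord_d_equation _ t fun h => hne (E.pos_injective h).symm] at h1
  rw [smul_zero, add_zero, smul_eq_mul] at h1
  exact (E.prime t).not_isUnit (IsUnit.of_mul_eq_one _ h1)

variable {p : ℕ}

/-- The coordinate of a `p`-form with respect to the wedge products of the basis elements with indices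
in `s`. -/
noncomputable def repr (x : Forms f p) (s : Set.powersetCard E.index p) : B :=
  (E.basis.exteriorPower p).repr x s

theorem map_eq_zero_of_dvd (fac : 𝟙 A ≫ f' = f ≫ q) (t : T) (h0 : q (E.equation t) = 0)
    (x : Forms f p) (h : ∀ s, E.pos t ∉ s → E.equation t ∣ E.repr x s) :
    Forms.map fac p x = 0 :=
  map_eq_zero_of_dvd_repr (R := B) (S := C) (kaehlerMap fac) (Forms.map fac p)
    (forms_map_ιMulti fac p) E.basis h0
    (by rw [E.basis_pos, kaehlerMap_d, h0, ← map_zero f'.hom]; exact d_map _)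
    x h

/-- A form of which a nonzero multiple vanishes on the component with equation `f t` has all
coordinates not involving `d(f t)` divisible by `f t`. -/
theorem dvd_of_smul_map_eq_zero [IsDomain C] (fac : 𝟙 A ≫ f' = f ≫ q)
    (hq : Function.Surjective q) (t : T) (h0 : ∀ b, q b = 0 ↔ E.equation t ∣ b)
    (x : Forms f p) {a : C} (ha : a ≠ 0) (hx : a • Forms.map fac p x = 0)
    (s) (hs : E.pos t ∉ s) : E.equation t ∣ E.repr x s := by
  have hc : ∀ i, ∃ c : CommRingCat.KaehlerDifferential f' →ₗ[C] C,
      i ≠ E.pos t → ∀ m, c (kaehlerMap fac m) = q (E.basis.coord i m) := by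
    intro i
    by_cases hi : i = E.pos t
    · exact ⟨0, fun h => absurd hi h⟩
    obtain ⟨c, hc⟩ := exists_descend fac hq (E.basis.coord i) (fun b hb => by
      obtain ⟨b', rfl⟩ := (h0 b).1 hb
      rw [d_mul, map_add, map_smul, map_smul, E.coord_d_equation i t hi,
        smul_zero, add_zero, smul_eq_mul, map_mul, (h0 _).2 dvd_rfl, zero_mul])
    exact ⟨c, fun _ => hc⟩
  choose c hc using hc
  exact dvd_repr_of_smul_map_eq_zero (R := B) (S := C) (kaehlerMap fac) (Forms.map fac p)
    (forms_map_ιMulti fac p) E.basis (fun r hr => (h0 r).1 hr) c hc x ha hx s hs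

theorem _root_.LogSequence.forms_map_surjective {A B C : CommRingCat.{u}} {f : A ⟶ B} {f' : A ⟶ C}
    {q : B ⟶ C} (fac : 𝟙 A ≫ f' = f ≫ q)
    (hq : Function.Surjective q) (p : ℕ) : Function.Surjective (Forms.map fac p) := by
  have h1 : Function.Surjective (kaehlerMap fac) := by
    intro m
    have hm : m ∈ Submodule.span C (M := CommRingCat.KaehlerDifferential f')
        (Set.range (fun b => CommRingCat.KaehlerDifferential.d b)) := by
      rw [span_range_d]; trivial
    induction hm using Submodule.span_induction with
    | mem x hx =>
      obtain ⟨c, rfl⟩ := hx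
      obtain ⟨b, rfl⟩ := hq c
      exact ⟨_, kaehlerMap_d fac b⟩
    | zero => exact ⟨0, map_zero _⟩
    | add x y _ _ hx hy =>
      obtain ⟨x, rfl⟩ := hx
      obtain ⟨y, rfl⟩ := hy
      exact ⟨_, map_add _ x y⟩
    | smul r x _ hx =>
      obtain ⟨x, rfl⟩ := hx
      obtain ⟨r, rfl⟩ := hq r
      exact ⟨_, (kaehlerMap fac).map_smulₛₗ r x⟩
  intro m
  have hm : m ∈ Submodule.span C (M := Forms f' p) (Set.range fun ω => wedge ω) :=
    Submodule.eq_top_iff'.mp (exteriorPower.ιMulti_span C p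
      (CommRingCat.KaehlerDifferential f')) m
  induction hm using Submodule.span_induction with
  | mem x hx =>
    obtain ⟨ω, rfl⟩ := hx
    choose η hη using fun j => h1 (ω j)
    exact ⟨wedge η, (Forms.map_wedge fac η).trans (congrArg wedge (funext hη))⟩
  | zero => exact ⟨0, map_zero _⟩
  | add x y _ _ hx hy =>
    obtain ⟨x, rfl⟩ := hx
    obtain ⟨y, rfl⟩ := hy
    exact ⟨_, map_add _ x y⟩
  | smul r x _ hx =>
    obtain ⟨x, rfl⟩ := hx
    obtain ⟨r, rfl⟩ := hq r
    exact ⟨_, (Forms.map fac p).map_smulₛₗ r x⟩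

theorem not_dvd_prod_erase [Fintype T] [DecidableEq T] (t : T) :
    ¬ E.equation t ∣ ∏ t' ∈ Finset.univ.erase t, E.equation t' := by
  rw [(E.prime t).dvd_finsetProd_iff]
  rintro ⟨t', ht', hd⟩
  exact (Finset.ne_of_mem_erase ht') (E.eq_of_dvd hd).symm

section Torsion

variable [Fintype T] {D : CommRingCat.{u}} {fD : A ⟶ D} {qD : B ⟶ D}

theorem prod_dvd [IsDomain B] {b : B} (h : ∀ t, E.equation t ∣ b) : ∏ t, E.equation t ∣ b :=
  prod_dvd_of_prime _ E.prime (fun _ _ => E.eq_of_dvd) _ fun t _ => h t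

/-- The form on `D` with the coordinate of the `t`-th component is killed by the square of the
equation of the other components, because `0 = d(f g)` implies `g² df = 0`. -/
theorem smul_map_family_eq_zero [DecidableEq T] (facD : 𝟙 A ≫ fD = f ≫ qD)
    (hD : ∀ b, qD b = 0 ↔ ∏ t, E.equation t ∣ b)
    (t : T) (s : Set.powersetCard E.index p) (hs : E.pos t ∈ s) :
    qD ((∏ t' ∈ Finset.univ.erase t, E.equation t') ^ 2) •
      Forms.map facD p (exteriorPower.ιMulti_family B p E.basis s) = 0 := by
  set g := ∏ t' ∈ Finset.univ.erase t, E.equation t' with hg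
  have hfg : qD (E.equation t * g) = 0 :=
    (hD _).2 (by rw [hg, Finset.mul_prod_erase _ _ (Finset.mem_univ t)])
  have h1 : qD (g ^ 2) • CommRingCat.KaehlerDifferential.d (f := fD) (qD (E.equation t)) = 0 := by
    have h2 : CommRingCat.KaehlerDifferential.d (f := fD) (qD (E.equation t * g)) = 0 := by
      rw [hfg, ← map_zero fD.hom]
      exact d_map _
    rw [map_mul, d_mul] at h2
    have h3 := congrArg (fun z => qD g • z) h2
    simp only [smul_add, smul_smul, smul_zero] at h3
    rw [← map_mul, ← map_mul, mul_comm g, hfg, zero_smul, zero_add, ← pow_two] at h3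
    exact h3
  obtain ⟨k, hk⟩ := (Set.powersetCard.mem_range_ofFinEmbEquiv_symm_iff_mem s _).2 hs
  rw [exteriorPower.ιMulti_family, forms_map_ιMulti]
  refine smul_ιMulti_eq_zero (R := D) (M := CommRingCat.KaehlerDifferential fD) _ k _ ?_
  refine Eq.trans (congrArg _ ?_) h1
  refine (congrArg (fun i => kaehlerMap facD (E.basis i)) hk).trans ?_
  exact (congrArg _ (E.basis_pos t)).trans (kaehlerMap_d facD _)

/-- A form on the divisor with equation `∏ f t` is torsion if and only if it vanishes on every
component `f t = 0`. If it vanishes on all components, then it is killed by the sum of the squares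
of the products of all equations but one. -/
theorem mem_torsion_iff [IsDomain B] (facD : 𝟙 A ≫ fD = f ≫ qD) (hqD : Function.Surjective qD)
    (hD : ∀ b, qD b = 0 ↔ ∏ t, E.equation t ∣ b)
    {C : T → CommRingCat.{u}} [∀ t, IsDomain (C t)] {fC : ∀ t, A ⟶ C t} {r : ∀ t, D ⟶ C t}
    (facC : ∀ t, 𝟙 A ≫ fC t = fD ≫ r t) (hr : ∀ t, Function.Surjective (r t))
    (hC : ∀ t b, r t (qD b) = 0 ↔ E.equation t ∣ b) (y : Forms fD p) :
    y ∈ Submodule.torsion D (Forms fD p) ↔ ∀ t, Forms.map (facC t) p y = 0 := by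
  classical
  obtain ⟨x, rfl⟩ := forms_map_surjective facD hqD p y
  have fac : ∀ t, 𝟙 A ≫ fC t = f ≫ (qD ≫ r t) := fun t => by
    rw [facC, ← Category.assoc, ← facD, Category.id_comp]
  have hmap : ∀ t, Forms.map (facC t) p (Forms.map facD p x) = Forms.map (fac t) p x := fun t =>
    Forms.map_comp facD (facC t) (fac t) (Category.id_comp _) rfl p x
  have hC' : ∀ t b, (qD ≫ r t) b = 0 ↔ E.equation t ∣ b := hC
  set g : T → B := fun t => ∏ t' ∈ Finset.univ.erase t, E.equation t' with hg
  have hgt : ∀ t, E.equation t * g t = ∏ t, E.equation t := fun t =>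
    Finset.mul_prod_erase _ _ (Finset.mem_univ t)
  have hndvd : ∀ t, ¬ E.equation t ∣ g t := E.not_dvd_prod_erase
  constructor
  · rw [Submodule.mem_torsion_iff]
    rintro ⟨⟨a, ha⟩, hax⟩ t
    have hax : a • Forms.map facD p x = 0 := hax
    have hat : r t a ≠ 0 := by
      obtain ⟨b, rfl⟩ := hqD a
      intro h0
      obtain ⟨c, rfl⟩ := (hC t b).1 h0
      have h1 : qD (g t) * qD (E.equation t * c) = 0 := by
        rw [← map_mul, hD]
        exact ⟨c, by rw [← hgt t]; ring⟩
      have h2 : qD (g t) = 0 := (mem_nonZeroDivisors_iff.1 ha).2 _ h1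
      exact hndvd t (((Dvd.intro _ (hgt t)).trans ((hD _).1 h2)))
    rw [hmap]
    refine E.map_eq_zero_of_dvd (fac t) t ((hC' t _).2 dvd_rfl) x fun s hs => ?_
    refine E.dvd_of_smul_map_eq_zero (fac t) ((hr t).comp hqD) t (hC' t) x hat ?_ s hs
    rw [← hmap]
    exact ((Forms.map (facC t) p).map_smulₛₗ a _).symm.trans ((congrArg _ hax).trans (map_zero _))
  · intro h
    have hdvd : ∀ t s, E.pos t ∉ s → E.equation t ∣ E.repr x s := fun t s hs =>
      E.dvd_of_smul_map_eq_zero (fac t) ((hr t).comp hqD) t (hC' t) x one_ne_zero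
        (by rw [one_smul, ← hmap, h t]) s hs
    -- No `f t` divides `∑ g t ^ 2`, since `f t` divides all `g t'` with `t' ≠ t` but not `g t`.
    set G : B := ∑ t, g t ^ 2 with hG
    have hnd : ∀ t, ¬ E.equation t ∣ G := by
      intro t hd
      rw [hG, ← Finset.add_sum_erase _ _ (Finset.mem_univ t)] at hd
      refine hndvd t ((E.prime t).dvd_of_dvd_pow ((dvd_add_left ?_).1 hd))
      refine Finset.dvd_sum fun t' ht' => dvd_pow ?_ two_ne_zero
      exact Finset.dvd_prod_of_mem _
        (Finset.mem_erase.2 ⟨(Finset.ne_of_mem_erase ht').symm, Finset.mem_univ t⟩)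
    have hGnz : qD G ∈ nonZeroDivisors D := by
      refine mem_nonZeroDivisors_iff_right.2 fun c hc => ?_
      obtain ⟨c, rfl⟩ := hqD c
      rw [← map_mul, hD] at hc
      refine (hD _).2 (E.prod_dvd fun t => ?_)
      have ht : E.equation t ∣ c * G := (Dvd.intro _ (hgt t)).trans hc
      exact ((E.prime t).dvd_or_dvd ht).resolve_right (hnd t)
    refine (Submodule.mem_torsion_iff _).2 ⟨⟨qD G, hGnz⟩, ?_⟩
    change qD G • Forms.map facD p x = 0
    let P : Submodule D (Forms fD p) := LinearMap.ker (LinearMap.lsmul D (Forms fD p) (qD G))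
    change Forms.map facD p x ∈ P
    refine mem_of_repr (R := B) (S := D) (Forms.map facD p) E.basis P x fun s => ?_
    change qD G • (qD (E.repr x s) • Forms.map facD p _) = 0
    rw [hG, map_sum, Finset.sum_smul]
    refine Finset.sum_eq_zero fun t _ => ?_
    by_cases hs : E.pos t ∈ s
    · rw [smul_comm, E.smul_map_family_eq_zero facD hD t s hs, smul_zero]
    · rw [smul_smul, ← map_mul, (hD _).2, zero_smul]
      obtain ⟨c, hc⟩ := hdvd t s hs
      exact ⟨g t * c, by rw [hc, ← hgt t]; ring⟩

end Torsion

end LogFrame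

end LocalAlgebra

/-! ### Quotients of smooth local algebras -/

section SmoothQuotient

open Module KaehlerDifferential TensorProduct

variable {R P C : Type*} [CommRing R] [CommRing P] [CommRing C] [Algebra R P] [Algebra R C]
  [Algebra P C] [IsScalarTower R P C]

/-- The conormal sequence: a differential that vanishes on the quotient `C = P / J` is `dx` with
`x ∈ J`, up to an element of `J Ω`. -/
theorem exists_sub_mem_of_map_eq_zero (hq : Function.Surjective (algebraMap P C))
    (m : Ω[P⁄R]) (hm : KaehlerDifferential.map R R P C m = 0) :
    ∃ x ∈ RingHom.ker (algebraMap P C),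
      m - D R P x ∈ (RingHom.ker (algebraMap P C)) • (⊤ : Submodule P Ω[P⁄R]) := by
  have h1 : mapBaseChange R P C (1 ⊗ₜ m) = 0 := by simp [hm]
  obtain ⟨y, hy⟩ := (exact_kerCotangentToTensor_mapBaseChange R P C hq _).1 h1
  obtain ⟨⟨x, hx⟩, rfl⟩ := Ideal.toCotangent_surjective _ y
  refine ⟨x, hx, ?_⟩
  rw [kerCotangentToTensor_toCotangent] at hy
  have h2 : (1 : C) ⊗ₜ[P] (m - D R P x) = 0 := by
    rw [TensorProduct.tmul_sub, hy, sub_self]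
  let e := Ideal.quotientKerAlgEquivOfSurjective (R₁ := P) (f := Algebra.ofId P C) hq
  have h3 : (1 : P ⧸ RingHom.ker (Algebra.ofId P C)) ⊗ₜ[P] (m - D R P x) = 0 := by
    have := congrArg (LinearMap.rTensor Ω[P⁄R] e.symm.toLinearMap) h2
    simpa using this
  have h4 : m - D R P x ∈ LinearMap.ker
      (TensorProduct.mk P (P ⧸ RingHom.ker (Algebra.ofId P C)) Ω[P⁄R] 1) := h3
  rw [LinearMap.ker_tensorProductMk] at h4
  exact h4

/-- If `C = P / (f t)` and the ranks of the modules of differentials differ by the number of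
the `f t`, then the differentials of the `f t` are part of a basis. -/
theorem exists_basis_of_ker_eq_span [IsLocalRing P] [Nontrivial C] {T : Type*} [Fintype T]
    {d c : ℕ} (hq : Function.Surjective (algebraMap P C)) (f : T → P)
    (hf : RingHom.ker (algebraMap P C) = Ideal.span (Set.range f))
    (bP : Basis (Fin d) P Ω[P⁄R]) (bC : Basis (Fin c) C Ω[C⁄R]) (hdc : c + Fintype.card T = d) :
    ∃ b : Basis (T ⊕ Fin c) P Ω[P⁄R], ∀ t, b (Sum.inl t) = D R P (f t) := by
  classical
  have hsurj := KaehlerDifferential.map_surjective_of_surjective R R P C hq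
  choose w hw using fun j => hsurj (bC j)
  let v : T ⊕ Fin c → Ω[P⁄R] := Sum.elim (fun t => D R P (f t)) w
  let J := RingHom.ker (algebraMap P C)
  have hJ : J ≤ Ideal.jacobson ⊥ := by
    rw [IsLocalRing.jacobson_eq_maximalIdeal _ bot_ne_top]
    exact IsLocalRing.le_maximalIdeal (RingHom.ker_ne_top _)
  have hfin : Module.Finite P Ω[P⁄R] := Module.Finite.of_basis bP
  let N := Submodule.span P (Set.range v)
  have hfJ : ∀ t, f t ∈ J := fun t => by
    change f t ∈ RingHom.ker (algebraMap P C)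
    rw [hf]; exact Ideal.subset_span ⟨t, rfl⟩
  have hDJ : ∀ x ∈ J, D R P x ∈ N ⊔ J • ⊤ := by
    intro x hx
    change x ∈ RingHom.ker (algebraMap P C) at hx
    rw [hf] at hx
    induction hx using Submodule.span_induction with
    | mem x hx =>
      obtain ⟨t, rfl⟩ := hx
      exact Submodule.mem_sup_left (Submodule.subset_span ⟨Sum.inl t, rfl⟩)
    | zero => simp
    | add x y _ _ hx hy =>
      rw [map_add]; exact add_mem hx hy
    | smul a x hx ih =>
      rw [smul_eq_mul, Derivation.leibniz]
      refine add_mem (Submodule.smul_mem _ _ ih) (Submodule.mem_sup_right ?_)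
      refine Submodule.smul_mem_smul ?_ trivial
      change x ∈ RingHom.ker (algebraMap P C)
      rw [hf]; exact hx
  have hspan : ⊤ ≤ N := by
    -- By Nakayama's lemma it suffices to generate modulo `J`.
    refine Submodule.le_of_le_smul_of_le_jacobson_bot (I := J) hfin.1 hJ fun m _ => ?_
    have : ∃ m' ∈ N, KaehlerDifferential.map R R P C m' = KaehlerDifferential.map R R P C m := by
      generalize KaehlerDifferential.map R R P C m = y
      induction bC.mem_span y using Submodule.span_induction with
      | mem x hx =>
        obtain ⟨j, rfl⟩ := hx
        exact ⟨w j, Submodule.subset_span ⟨Sum.inr j, rfl⟩, hw j⟩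
      | zero => exact ⟨0, zero_mem _, map_zero _⟩
      | add x y _ _ hx hy =>
        obtain ⟨x, hx, rfl⟩ := hx
        obtain ⟨y, hy, rfl⟩ := hy
        exact ⟨x + y, add_mem hx hy, map_add _ _ _⟩
      | smul a x _ hx =>
        obtain ⟨x, hx, rfl⟩ := hx
        obtain ⟨a, rfl⟩ := hq a
        exact ⟨a • x, Submodule.smul_mem _ _ hx, by rw [map_smul, algebraMap_smul]⟩
    obtain ⟨m', hm', he⟩ := this
    obtain ⟨x, hx, hx'⟩ := exists_sub_mem_of_map_eq_zero (R := R) hq (m - m')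
      (by rw [map_sub, he, sub_self])
    have : m = m' + D R P x + (m - m' - D R P x) := by abel
    rw [this]
    exact add_mem (add_mem (Submodule.mem_sup_left hm') (hDJ x hx)) (Submodule.mem_sup_right hx')
  have hrank : finrank P Ω[P⁄R] = d := by rw [finrank_eq_card_basis bP, Fintype.card_fin]
  refine ⟨basisOfTopLeSpanOfCardEqFinrank v hspan ?_, fun t => ?_⟩
  · rw [hrank, Fintype.card_sum, Fintype.card_fin, ← hdc, add_comm]
  · rw [coe_basisOfTopLeSpanOfCardEqFinrank]
    rfl

/-- The kernel of a surjection of smooth local algebras whose relative dimensions differ by one is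
principal, because its conormal module is free of rank one. -/
theorem exists_ker_eq_span_singleton [IsLocalRing P] [IsNoetherianRing P] [Nontrivial C]
    [Algebra.FormallySmooth R P] [Algebra.FormallySmooth R C] {c : ℕ}
    (hq : Function.Surjective (algebraMap P C))
    (bP : Basis (Fin (c + 1)) P Ω[P⁄R]) (bC : Basis (Fin c) C Ω[C⁄R]) :
    ∃ f, RingHom.ker (algebraMap P C) = Ideal.span {f} := by
  have : IsLocalRing C := IsLocalRing.of_surjective' (algebraMap P C) hq
  obtain ⟨l, hl⟩ := (Algebra.FormallySmooth.iff_split_injection (R := R) hq).1 inferInstance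
  have hinj : Function.Injective (kerCotangentToTensor R P C) :=
    Function.LeftInverse.injective (g := l) fun x => LinearMap.congr_fun hl x
  let bQ : Basis (Fin (c + 1)) C (C ⊗[P] Ω[P⁄R]) := bP.baseChange C
  have : Module.Finite C (C ⊗[P] Ω[P⁄R]) := Module.Finite.of_basis bQ
  have : Module.Finite C Ω[C⁄R] := Module.Finite.of_basis bC
  have : Module.Free C Ω[C⁄R] := Module.Free.of_basis bC
  let μ := mapBaseChange R P C
  have hμ : Function.Surjective μ := mapBaseChange_surjective R P C hq
  obtain ⟨s, hs⟩ := Module.projective_lifting_property μ LinearMap.id hμ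
  have hs' : ∀ x, μ (s x) = x := fun x => LinearMap.congr_fun hs x
  -- `W` is the conormal module; it is a direct summand of a free module of finite rank.
  let W := LinearMap.ker μ
  let π : (C ⊗[P] Ω[P⁄R]) →ₗ[C] W := LinearMap.codRestrict W (LinearMap.id - s ∘ₗ μ) fun x => by
    simp [W, hs']
  have hπ : ∀ w : W, π w = w := fun w => Subtype.ext (by
    have : μ w = 0 := w.2
    simp [π, this])
  have hπs : Function.Surjective π := fun w => ⟨w, hπ w⟩
  have : Module.Finite C W := Module.Finite.of_surjective π hπs
  have : Module.Projective C W := Module.Projective.of_split W.subtype π (LinearMap.ext hπ)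
  have : Module.Flat C W := Module.Flat.of_projective
  have : Module.Free C W := Module.free_of_flat_of_isLocalRing (R := C) (P := W)
  let e : (C ⊗[P] Ω[P⁄R]) ≃ₗ[C] W × Ω[C⁄R] := LinearEquiv.ofBijective (π.prod μ) (by
    constructor
    · refine (injective_iff_map_eq_zero (π.prod μ)).2 fun x hx => ?_
      obtain ⟨h1, h2⟩ := Prod.ext_iff.1 hx
      have h2 : μ x = 0 := h2
      have h1 : π x = 0 := h1
      exact congrArg Subtype.val ((hπ ⟨x, h2⟩).symm.trans h1)
    · rintro ⟨w, y⟩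
      refine ⟨w + s y, Prod.ext ?_ ?_⟩
      · change π (w + s y) = w
        have h0 : π (s y) = 0 := Subtype.ext (by simp [π, hs'])
        rw [map_add, hπ, h0, add_zero]
      · change μ (w + s y) = y
        rw [map_add, hs', show μ w = 0 from w.2, zero_add])
  have hrank : finrank C W = 1 := by
    have h1 := e.finrank_eq
    rw [finrank_prod, finrank_eq_card_basis bQ, finrank_eq_card_basis bC, Fintype.card_fin,
      Fintype.card_fin] at h1
    omega
  -- A lift of a generator of the conormal module `J / J²` generates `J`, by Nakayama's lemma.
  let bW := Module.finBasisOfFinrankEq C W hrank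
  obtain ⟨y, hy⟩ := (exact_kerCotangentToTensor_mapBaseChange R P C hq _).1 (bW 0).2
  obtain ⟨⟨x, hx⟩, rfl⟩ := Ideal.toCotangent_surjective _ y
  refine ⟨x, le_antisymm ?_ ((Ideal.span_singleton_le_iff_mem _).2 hx)⟩
  set J := RingHom.ker (algebraMap P C) with hJdef
  have hJ : J ≤ Ideal.jacobson ⊥ := by
    rw [IsLocalRing.jacobson_eq_maximalIdeal _ bot_ne_top]
    exact IsLocalRing.le_maximalIdeal (RingHom.ker_ne_top _)
  refine Submodule.le_of_le_smul_of_le_jacobson_bot (I := J) (IsNoetherian.noetherian J) hJ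
    fun z hz => ?_
  have hzW : kerCotangentToTensor R P C (J.toCotangent ⟨z, hz⟩) ∈ W :=
    (exact_kerCotangentToTensor_mapBaseChange R P C hq _).2 ⟨_, rfl⟩
  have h1 := bW.sum_repr ⟨_, hzW⟩
  rw [Fin.sum_univ_one] at h1
  obtain ⟨b, hb⟩ := hq (bW.repr ⟨_, hzW⟩ 0)
  have h2 : kerCotangentToTensor R P C (J.toCotangent ⟨z, hz⟩) =
      kerCotangentToTensor R P C (b • J.toCotangent ⟨x, hx⟩) := by
    rw [map_smul, hy, ← algebraMap_smul C b, hb]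
    exact (congrArg Subtype.val h1).symm
  have h3 := hinj h2
  rw [← map_smul, Ideal.toCotangent_eq] at h3
  have h4 : z = b * x + (z - b * x) := by ring
  rw [h4]
  refine add_mem (Submodule.mem_sup_left (Ideal.mul_mem_left _ _ (Ideal.mem_span_singleton_self x)))
    (Submodule.mem_sup_right ?_)
  rw [smul_eq_mul, ← pow_two]
  exact h3

end SmoothQuotient

/-! ### Existence of adapted coordinates -/

section Frame

open Module

variable {A B C : CommRingCat.{u}} {f : A ⟶ B} {f' : A ⟶ C} {q : B ⟶ C}

theorem exists_ker_eq_span_singleton_hom (fac : f' = f ≫ q) [IsLocalRing B] [IsNoetherianRing B]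
    [Nontrivial C] (hf : f.hom.FormallySmooth) (hf' : f'.hom.FormallySmooth)
    (hq : Function.Surjective q) {c : ℕ}
    (bB : Basis (Fin (c + 1)) B (CommRingCat.KaehlerDifferential f))
    (bC : Basis (Fin c) C (CommRingCat.KaehlerDifferential f')) :
    ∃ x, RingHom.ker q.hom = Ideal.span {x} := by
  subst fac
  let := f.hom.toAlgebra
  let := q.hom.toAlgebra
  let := (f ≫ q).hom.toAlgebra
  have : IsScalarTower A B C := IsScalarTower.of_algebraMap_eq' rfl
  have : Algebra.FormallySmooth A B := hf
  have : Algebra.FormallySmooth A C := hf'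
  exact exists_ker_eq_span_singleton (R := A) hq bB bC

/-- Prime elements that generate the kernel of a map to a quotient of the expected relative dimension
are the equations of a system of adapted coordinates. -/
theorem exists_logFrame (fac : f' = f ≫ q) [IsLocalRing B] [Nontrivial C]
    (hq : Function.Surjective q) {T : Type} [Fintype T] {c d : ℕ} (x : T → B)
    (hx : RingHom.ker q.hom = Ideal.span (Set.range x)) (hprime : ∀ t, Prime (x t))
    (bB : Basis (Fin d) B (CommRingCat.KaehlerDifferential f))
    (bC : Basis (Fin c) C (CommRingCat.KaehlerDifferential f')) (hdc : c + Fintype.card T = d) :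
    ∃ E : LogFrame f T, E.equation = x ∧ Finite E.index ∧ Nat.card E.index = d := by
  subst fac
  obtain ⟨b, hb⟩ : ∃ b : Basis (T ⊕ Fin c) B (CommRingCat.KaehlerDifferential f),
      ∀ t, b (Sum.inl t) = CommRingCat.KaehlerDifferential.d (x t) := by
    let := f.hom.toAlgebra
    let := q.hom.toAlgebra
    let := (f ≫ q).hom.toAlgebra
    have : IsScalarTower A B C := IsScalarTower.of_algebraMap_eq' rfl
    exact exists_basis_of_ker_eq_span (R := A) hq x hx bB bC hdc
  classical
  let : LinearOrder (T ⊕ Fin c) := linearOrderOfSTO WellOrderingRel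
  let E : LogFrame f T :=
    { index := T ⊕ Fin c
      basis := b
      equation := x
      pos := Sum.inl
      pos_injective := Sum.inl_injective
      basis_pos := hb
      prime := hprime }
  refine ⟨E, rfl, inferInstanceAs (Finite (T ⊕ Fin c)), ?_⟩
  change Nat.card (T ⊕ Fin c) = d
  rw [Nat.card_sum, Nat.card_eq_fintype_card, Nat.card_fin, ← hdc, add_comm]

end Frame

/-! ### Stalks of smooth morphisms -/

section Stalks

/-- Relative differentials of localizations: a basis of `Ω_{S/R}` yields one of `Ω_{S'/R'}`. -/
theorem nonempty_basis_kaehler_localization {R S R' S' : Type*} [CommRing R] [CommRing S]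
    [CommRing R'] [CommRing S'] [Algebra R S] [Algebra R R'] [Algebra R S'] [Algebra S S']
    [Algebra R' S'] [IsScalarTower R S S'] [IsScalarTower R R' S'] (M : Submonoid R)
    (N : Submonoid S) [IsLocalization M R'] [IsLocalization N S'] {ι : Type*}
    (b : Module.Basis ι S (Ω[S⁄R])) : Nonempty (Module.Basis ι S' (Ω[S'⁄R'])) := by
  have : Algebra.FormallyEtale S S' := .of_isLocalization N
  have : Algebra.FormallyUnramified R R' := .of_isLocalization M
  let e : Ω[S'⁄R] →ₗ[S'] Ω[S'⁄R'] := KaehlerDifferential.map R R' S' S'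
  have hsurj : Function.Surjective e := KaehlerDifferential.map_surjective R R' S'
  have hinj : Function.Injective e := by
    rw [injective_iff_map_eq_zero]
    intro x hx
    obtain ⟨y, rfl⟩ := (KaehlerDifferential.exact_mapBaseChange_map R R' S' x).mp hx
    rw [Subsingleton.elim y 0, map_zero]
  exact ⟨((b.baseChange S').map (KaehlerDifferential.tensorKaehlerEquivOfFormallyEtale R S S')).map
    (LinearEquiv.ofBijective e ⟨hinj, hsurj⟩)⟩

variable {X Y : Scheme.{u}} (φ : X ⟶ Y)

/-- The relative differentials of the stalks of a smooth morphism are free, of rank the relative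
dimension. -/
theorem exists_basis_kaehler_stalkMap (d : ℕ) [h : SmoothOfRelativeDimension d φ] (x : X) :
    Nonempty (Module.Basis (Fin d) (X.presheaf.stalk x)
      (CommRingCat.KaehlerDifferential (φ.stalkMap x))) := by
  obtain ⟨U, hU, V, hV, hx, e, hst⟩ := h.exists_isStandardSmoothOfRelativeDimension x
  algebraize [(φ.appLE U V e).hom]
  let := Y.presheaf.algebra_section_stalk ⟨φ x, e hx⟩
  have := hU.isLocalization_stalk ⟨φ x, e hx⟩
  let := X.presheaf.algebra_section_stalk ⟨x, hx⟩
  have := hV.isLocalization_stalk ⟨x, hx⟩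
  let := (φ.stalkMap x).hom.toAlgebra
  let := ((φ.appLE U V e) ≫ X.presheaf.germ V x hx).hom.toAlgebra
  have : IsScalarTower Γ(Y, U) Γ(X, V) (X.presheaf.stalk x) := .of_algebraMap_eq' rfl
  have : IsScalarTower Γ(Y, U) (Y.presheaf.stalk (φ x)) (X.presheaf.stalk x) :=
    .of_algebraMap_eq' (congrArg CommRingCat.Hom.hom (germ_appLE φ e x hx)).symm
  have : Nontrivial Γ(X, V) := (X.presheaf.germ V x hx).hom.domain_nontrivial
  have hs : Algebra.IsStandardSmooth Γ(Y, U) Γ(X, V) :=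
    Algebra.IsStandardSmoothOfRelativeDimension.isStandardSmooth d
  have hrk := Algebra.IsStandardSmoothOfRelativeDimension.rank_kaehlerDifferential
    (R := Γ(Y, U)) (S := Γ(X, V)) d
  have hfr : Module.finrank Γ(X, V) (Ω[Γ(X, V)⁄Γ(Y, U)]) = d :=
    Module.finrank_eq_of_rank_eq hrk
  have b : Module.Basis (Fin d) Γ(X, V) (Ω[Γ(X, V)⁄Γ(Y, U)]) :=
    Module.finBasisOfFinrankEq _ _ hfr
  exact nonempty_basis_kaehler_localization
    (hU.primeIdealOf ⟨φ x, e hx⟩).asIdeal.primeCompl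
    (hV.primeIdealOf ⟨x, hx⟩).asIdeal.primeCompl b

theorem formallySmooth_stalkMap [Smooth φ] (x : X) : (φ.stalkMap x).hom.FormallySmooth :=
  Scheme.Hom.mem_smoothLocus.mp (φ.smoothLocus_eq_top ▸ Opens.mem_top x)

end Stalks

/-! ### Stalks of ideal sheaves -/

section StalkIdeal

variable {X : Scheme.{u}} (I : X.IdealSheafData)

/-- The stalk at `x` of an ideal sheaf, generated by the germs of its sections over all affine open
neighbourhoods of `x`; one neighbourhood suffices, see `stalkIdeal_eq_map`. -/
noncomputable def stalkIdeal (x : X) : Ideal (X.presheaf.stalk x) :=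
  ⨆ (V : X.affineOpens) (hx : x ∈ V.1), (I.ideal V).map (X.presheaf.germ V.1 x hx).hom

theorem map_ideal_germ_of_le {V W : X.affineOpens} (h : W ≤ V) (x : X) (hx : x ∈ W.1) :
    (I.ideal W).map (X.presheaf.germ W.1 x hx).hom =
      (I.ideal V).map (X.presheaf.germ V.1 x (h hx)).hom := by
  rw [← I.map_ideal h, Ideal.map_map]
  exact congrArg (fun g : Γ(X, V.1) ⟶ _ => (I.ideal V).map g.hom) (X.presheaf.germ_res _ _ _)

theorem exists_affine_le {x : X} {U : X.Opens} (hx : x ∈ U) :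
    ∃ V : X.affineOpens, x ∈ V.1 ∧ V.1 ≤ U := by
  obtain ⟨_, ⟨V, hV, rfl⟩, hxV, hVU⟩ := X.isBasis_affineOpens.exists_subset_of_mem_open hx U.2
  exact ⟨⟨V, hV⟩, hxV, hVU⟩

theorem stalkIdeal_eq_map (x : X) (V : X.affineOpens) (hx : x ∈ V.1) :
    stalkIdeal I x = (I.ideal V).map (X.presheaf.germ V.1 x hx).hom := by
  refine le_antisymm (iSup₂_le fun V' hx' => ?_)
    (le_iSup₂ (f := fun (V : X.affineOpens) (hx : x ∈ V.1) =>
      (I.ideal V).map (X.presheaf.germ V.1 x hx).hom) V hx)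
  obtain ⟨W, hxW, hW⟩ := exists_affine_le (U := V.1 ⊓ V'.1) ⟨hx, hx'⟩
  rw [← map_ideal_germ_of_le I (hW.trans inf_le_left : W ≤ V) x hxW,
    ← map_ideal_germ_of_le I (hW.trans inf_le_right : W ≤ V') x hxW]

theorem exists_affine_germ_eq (x : X) (a : X.presheaf.stalk x) {U : X.Opens} (hx : x ∈ U) :
    ∃ (V : X.affineOpens) (hxV : x ∈ V.1) (f : Γ(X, V.1)), V.1 ≤ U ∧
      X.presheaf.germ V.1 x hxV f = a := by
  obtain ⟨W, hW, g, rfl⟩ := X.presheaf.exists_germ_eq a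
  obtain ⟨V, hxV, hV⟩ := exists_affine_le (U := W ⊓ U) ⟨hW, hx⟩
  exact ⟨V, hxV, X.presheaf.map (homOfLE (hV.trans inf_le_left)).op g, hV.trans inf_le_right,
    X.presheaf.germ_res_apply _ _ _ _⟩

theorem mem_ideal_iff_app (V : X.affineOpens) (f : Γ(X, V.1)) :
    f ∈ I.ideal V ↔ I.subschemeι.app V.1 f = 0 := by
  rw [← I.ker_subschemeι_app V]; exact Iff.rfl

theorem map_mem_ideal {V W : X.affineOpens} (h : W ≤ V) {f : Γ(X, V.1)} (hf : f ∈ I.ideal V) :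
    X.presheaf.map (homOfLE (show W.1 ≤ V.1 from h)).op f ∈ I.ideal W :=
  I.ideal_le_comap_ideal h hf

/-- The elements of the stalk are germs of sections of the ideal over small affine
neighbourhoods. -/
theorem exists_mem_ideal_of_mem_stalkIdeal {x : X} {a : X.presheaf.stalk x}
    (ha : a ∈ stalkIdeal I x) {U : X.Opens} (hx : x ∈ U) :
    ∃ (V : X.affineOpens) (hxV : x ∈ V.1) (f : Γ(X, V.1)), V.1 ≤ U ∧ f ∈ I.ideal V ∧
      X.presheaf.germ V.1 x hxV f = a := by
  obtain ⟨V₀, hx₀, hV₀⟩ := exists_affine_le hx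
  rw [stalkIdeal_eq_map I x V₀ hx₀] at ha
  suffices ∃ (V : X.affineOpens) (hxV : x ∈ V.1) (f : Γ(X, V.1)), V ≤ V₀ ∧ f ∈ I.ideal V ∧
      X.presheaf.germ V.1 x hxV f = a by
    obtain ⟨V, hxV, f, hV, hf⟩ := this
    exact ⟨V, hxV, f, le_trans hV hV₀, hf⟩
  induction ha using Submodule.span_induction with
  | mem a ha =>
    obtain ⟨f, hf, rfl⟩ := ha
    exact ⟨V₀, hx₀, f, le_rfl, hf, rfl⟩
  | zero => exact ⟨V₀, hx₀, 0, le_rfl, zero_mem _, map_zero _⟩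
  | add a b _ _ ha hb =>
    obtain ⟨V, hV, f, hVle, hf, rfl⟩ := ha
    obtain ⟨W, hW, g, hWle, hg, rfl⟩ := hb
    obtain ⟨V', hxV', hV'⟩ := exists_affine_le (U := V.1 ⊓ W.1) ⟨hV, hW⟩
    have h1 : V' ≤ V := hV'.trans inf_le_left
    have h2 : V' ≤ W := hV'.trans inf_le_right
    refine ⟨V', hxV', X.presheaf.map (homOfLE h1).op f + X.presheaf.map (homOfLE h2).op g,
      h1.trans hVle, add_mem (map_mem_ideal I h1 hf) (map_mem_ideal I h2 hg), ?_⟩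
    rw [map_add]
    exact congrArg₂ (· + ·) (X.presheaf.germ_res_apply _ _ _ _) (X.presheaf.germ_res_apply _ _ _ _)
  | smul r a _ ha =>
    obtain ⟨V, hV, f, hVle, hf, rfl⟩ := ha
    obtain ⟨W, hW, g, hWle, rfl⟩ := exists_affine_germ_eq x r hV
    have h1 : W ≤ V := hWle
    refine ⟨W, hW, g * X.presheaf.map (homOfLE h1).op f, h1.trans hVle,
      Ideal.mul_mem_left _ _ (map_mem_ideal I h1 hf), ?_⟩
    rw [map_mul, smul_eq_mul]
    exact congrArg₂ (· * ·) rfl (X.presheaf.germ_res_apply _ _ _ _)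

theorem germ_mem_stalkIdeal {x : X} (V : X.affineOpens) (hx : x ∈ V.1) {f : Γ(X, V.1)}
    (hf : f ∈ I.ideal V) : X.presheaf.germ V.1 x hx f ∈ stalkIdeal I x := by
  rw [stalkIdeal_eq_map I x V hx]
  exact Ideal.mem_map_of_mem _ hf

theorem ker_stalkMap_subschemeι (z : I.subscheme) :
    RingHom.ker (I.subschemeι.stalkMap z).hom = stalkIdeal I (I.subschemeι z) := by
  ext a
  rw [RingHom.mem_ker]
  constructor
  · intro ha
    obtain ⟨V, hxV, f, -, rfl⟩ := exists_affine_germ_eq _ a (Opens.mem_top (I.subschemeι z))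
    have h0 : I.subscheme.presheaf.germ (I.subschemeι ⁻¹ᵁ V.1) z hxV (I.subschemeι.app V.1 f) =
        I.subscheme.presheaf.germ (I.subschemeι ⁻¹ᵁ V.1) z hxV 0 := by
      rw [map_zero]
      exact (Scheme.Hom.germ_stalkMap_apply I.subschemeι V.1 z hxV f).symm.trans ha
    obtain ⟨W, hzW, i, j, hW⟩ := I.subscheme.presheaf.germ_eq z hxV hxV _ _ h0
    obtain ⟨W', hW', hWW'⟩ :=
      (I.subschemeι.isEmbedding.isInducing.isOpen_iff (s := (W : Set I.subscheme))).mp W.2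
    obtain ⟨V', hxV', hV'⟩ := exists_affine_le (x := I.subschemeι z) (U := V.1 ⊓ ⟨W', hW'⟩)
      ⟨hxV, show I.subschemeι z ∈ W' from (show z ∈ _ ⁻¹' W' from hWW' ▸ hzW)⟩
    have h1 : V' ≤ V := hV'.trans inf_le_left
    have h2 : I.subschemeι ⁻¹ᵁ V'.1 ≤ W := fun y hy => by
      have : y ∈ I.subschemeι ⁻¹' W' := (hV' hy).2
      rw [hWW'] at this
      exact this
    have : X.presheaf.map (homOfLE h1).op f ∈ I.ideal V' := by
      rw [mem_ideal_iff_app]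
      refine (ConcreteCategory.congr_hom (I.subschemeι.naturality (homOfLE h1).op) f).trans ?_
      change I.subscheme.presheaf.map _ (I.subschemeι.app V.1 f) = 0
      have h3 := congrArg (I.subscheme.presheaf.map (homOfLE h2).op) hW
      rw [map_zero, map_zero] at h3
      rw [← h3, ← ConcreteCategory.comp_apply, ← ConcreteCategory.comp_apply,
        ← ConcreteCategory.comp_apply, ← Functor.map_comp]
      rfl
    have h4 := germ_mem_stalkIdeal I V' hxV' this
    exact Eq.mp (congrArg (· ∈ stalkIdeal I (I.subschemeι z))
      (X.presheaf.germ_res_apply (homOfLE h1) _ hxV' f)) h4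
  · intro ha
    obtain ⟨V, hxV, f, -, hf, rfl⟩ := exists_mem_ideal_of_mem_stalkIdeal I ha (Opens.mem_top _)
    refine (Scheme.Hom.germ_stalkMap_apply I.subschemeι V.1 z hxV f).trans ?_
    rw [(mem_ideal_iff_app I V f).mp hf, map_zero]

theorem germ_mem_stalkIdeal_iff {x : X} {U : X.Opens} (hx : x ∈ U) (f : Γ(X, U)) :
    X.presheaf.germ U x hx f ∈ stalkIdeal I x ↔ ∃ (V : X.affineOpens) (_ : x ∈ V.1) (h : V.1 ≤ U),
      X.presheaf.map (homOfLE h).op f ∈ I.ideal V := by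
  constructor
  · intro h
    obtain ⟨V, hxV, g, hV, hg, e⟩ := exists_mem_ideal_of_mem_stalkIdeal I h hx
    obtain ⟨W, hxW, i, j, hW⟩ := X.presheaf.germ_eq x hxV hx _ _ e
    obtain ⟨V', hxV', hV'⟩ := exists_affine_le hxW
    refine ⟨V', hxV', hV'.trans j.le, ?_⟩
    have h1 : V' ≤ V := hV'.trans i.le
    have h2 := I.ideal_le_comap_ideal h1 hg
    have h3 := congrArg (X.presheaf.map (homOfLE hV').op) hW
    rw [← ConcreteCategory.comp_apply, ← ConcreteCategory.comp_apply, ← Functor.map_comp,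
      ← Functor.map_comp] at h3
    exact Eq.mp (congrArg (· ∈ I.ideal V') h3) h2
  · rintro ⟨V, hxV, hV, h⟩
    have := germ_mem_stalkIdeal I V hxV h
    rwa [X.presheaf.germ_res_apply] at this

theorem mem_support_iff_stalkIdeal {x : X} :
    x ∈ I.support ↔ stalkIdeal I x ≤ IsLocalRing.maximalIdeal (X.presheaf.stalk x) := by
  obtain ⟨V, hx, -⟩ := exists_affine_le (Opens.mem_top x)
  rw [I.mem_support_iff_of_mem hx, stalkIdeal_eq_map I x V hx, Ideal.map_le_iff_le_comap,
    Scheme.mem_zeroLocus_iff]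
  refine forall₂_congr fun f _ => ?_
  rw [Scheme.mem_basicOpen _ _ _ hx, Ideal.mem_comap, IsLocalRing.mem_maximalIdeal, mem_nonunits_iff]

theorem stalkIdeal_iSup {ι : Type*} (J : ι → X.IdealSheafData) (x : X) :
    stalkIdeal (⨆ i, J i) x = ⨆ i, stalkIdeal (J i) x := by
  obtain ⟨V, hx, -⟩ := exists_affine_le (Opens.mem_top x)
  simp only [stalkIdeal_eq_map _ x V hx, Scheme.IdealSheafData.ideal_iSup, iSup_apply, Ideal.map_iSup]

/-- A function on an affine open set lies in the radical ideal of a closed set `Z` if and only if it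
vanishes at the points of `Z`. -/
theorem mem_ideal_vanishingIdeal_iff (Z : Closeds X) (V : X.affineOpens) (f : Γ(X, V.1)) :
    f ∈ (Scheme.IdealSheafData.vanishingIdeal Z).ideal V ↔
      ∀ y ∈ V.1, y ∈ Z → y ∉ X.basicOpen f := by
  rw [Scheme.IdealSheafData.vanishingIdeal_ideal, PrimeSpectrum.mem_vanishingIdeal]
  have key : ∀ q, V.2.fromSpec q ∈ X.basicOpen f ↔ f ∉ q.asIdeal := fun q => by
    have := V.2.fromSpec_preimage_basicOpen f
    exact (SetLike.ext_iff.mp this q)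
  constructor
  · intro h y hy hyZ hyf
    obtain ⟨q, rfl⟩ : y ∈ Set.range (IsAffineOpen.fromSpec V.2) :=
      (IsAffineOpen.range_fromSpec V.2).symm ▸ hy
    exact (key q).mp hyf (h q hyZ)
  · intro h q hq
    by_contra hf
    refine h (V.2.fromSpec q) ?_ hq ((key q).mpr hf)
    exact (IsAffineOpen.range_fromSpec V.2).subset ⟨q, rfl⟩

/-- A germ lies in the stalk of the radical ideal of a closed set `Z` if and only if it vanishes at
the points of `Z` near `x`. -/
theorem germ_mem_stalkIdeal_vanishingIdeal_iff (Z : Closeds X) {x : X} {U : X.Opens} (hx : x ∈ U)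
    (f : Γ(X, U)) : X.presheaf.germ U x hx f ∈ stalkIdeal (.vanishingIdeal Z) x ↔
      ∃ W : X.Opens, x ∈ W ∧ ∀ y ∈ W, y ∈ Z → y ∉ X.basicOpen f := by
  rw [germ_mem_stalkIdeal_iff]
  have key : ∀ (V : X.Opens) (h : V ≤ U) (y) (_ : y ∈ V),
      y ∈ X.basicOpen (X.presheaf.map (homOfLE h).op f) ↔ y ∈ X.basicOpen f := fun V h y hy => by
    rw [Scheme.basicOpen_res]
    exact ⟨fun h => h.2, fun h => ⟨hy, h⟩⟩
  constructor
  · rintro ⟨V, hxV, hV, h⟩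
    rw [mem_ideal_vanishingIdeal_iff] at h
    exact ⟨V.1, hxV, fun y hy hyZ hyf => h y hy hyZ ((key _ hV y hy).mpr hyf)⟩
  · rintro ⟨W, hxW, h⟩
    obtain ⟨V, hxV, hV⟩ := exists_affine_le (U := W ⊓ U) ⟨hxW, hx⟩
    refine ⟨V, hxV, hV.trans inf_le_right, ?_⟩
    rw [mem_ideal_vanishingIdeal_iff]
    exact fun y hy hyZ hyf => h y (hV hy).1 hyZ ((key _ (hV.trans inf_le_right) y hy).mp hyf)

theorem mem_stalkIdeal_vanishingIdeal_biSup_iff {ι : Type*} (s : Finset ι) (Z : ι → Closeds X)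
    (x : X) (a : X.presheaf.stalk x) :
    a ∈ stalkIdeal (.vanishingIdeal (⨆ i ∈ s, Z i)) x ↔
      ∀ i ∈ s, a ∈ stalkIdeal (.vanishingIdeal (Z i)) x := by
  classical
  obtain ⟨U, hU, f, rfl⟩ := X.presheaf.exists_germ_eq a
  simp only [germ_mem_stalkIdeal_vanishingIdeal_iff]
  induction s using Finset.induction_on with
  | empty =>
    refine iff_of_true ⟨⊤, Opens.mem_top _, fun y _ hy => ?_⟩ (by simp)
    simp only [Finset.notMem_empty, iSup_false, iSup_bot] at hy
    exact hy.elim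
  | insert i s his ih =>
    rw [Finset.forall_mem_insert, ← ih, Finset.iSup_insert]
    constructor
    · rintro ⟨W, hxW, h⟩
      exact ⟨⟨W, hxW, fun y hy hyZ => h y hy (Or.inl hyZ)⟩,
        ⟨W, hxW, fun y hy hyZ => h y hy (Or.inr hyZ)⟩⟩
    · rintro ⟨⟨W, hxW, h⟩, ⟨W', hxW', h'⟩⟩
      exact ⟨W ⊓ W', ⟨hxW, hxW'⟩, fun y hy hyZ => hyZ.elim (h y hy.1) (h' y hy.2)⟩

/-- The stalk of the ideal of an irreducible closed set at one of its points is prime. -/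
theorem stalkIdeal_componentIdeal_isPrime (Z : IrreducibleCloseds X) {x : X}
    (hx : x ∈ (Z : Set X)) : (stalkIdeal (componentIdeal Z) x).IsPrime := by
  refine ⟨fun htop => ?_, fun {a b} hab => ?_⟩
  · have h1 : X.presheaf.germ ⊤ x (Opens.mem_top x) 1 ∈ stalkIdeal (componentIdeal Z) x :=
      htop ▸ Submodule.mem_top
    obtain ⟨W, hxW, h⟩ := (germ_mem_stalkIdeal_vanishingIdeal_iff _ _ _).mp h1
    exact h x hxW hx (by rw [Scheme.basicOpen_of_isUnit _ isUnit_one]; trivial)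
  · obtain ⟨U, hU, f, rfl⟩ := X.presheaf.exists_germ_eq a
    obtain ⟨U', hU', g, rfl⟩ := X.presheaf.exists_germ_eq b
    rw [← X.presheaf.germ_res_apply (homOfLE (inf_le_left : U ⊓ U' ≤ U)) x ⟨hU, hU'⟩ f,
      ← X.presheaf.germ_res_apply (homOfLE (inf_le_right : U ⊓ U' ≤ U')) x ⟨hU, hU'⟩ g] at *
    generalize X.presheaf.map (homOfLE (inf_le_left : U ⊓ U' ≤ U)).op f = f at *
    generalize X.presheaf.map (homOfLE (inf_le_right : U ⊓ U' ≤ U')).op g = g at *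
    rw [← map_mul] at hab
    obtain ⟨W, hxW, h⟩ := (germ_mem_stalkIdeal_vanishingIdeal_iff _ _ _).mp hab
    by_contra hcon
    rw [not_or] at hcon
    obtain ⟨ha, hb⟩ := hcon
    have key : ∀ f : Γ(X, U ⊓ U'), X.presheaf.germ (U ⊓ U') x ⟨hU, hU'⟩ f ∉
          stalkIdeal (componentIdeal Z) x →
        ((Z : Set X) ∩ (W ⊓ X.basicOpen f : X.Opens)).Nonempty := fun f hf => by
      by_contra hemp
      refine hf ((germ_mem_stalkIdeal_vanishingIdeal_iff _ _ _).mpr ⟨W, hxW, fun y hy hyZ hyf => ?_⟩)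
      exact hemp ⟨y, hyZ, hy, hyf⟩
    obtain ⟨y, hyZ, hy1, hy2⟩ := Z.isIrreducible.2 _ _ (W ⊓ X.basicOpen f).2 (W ⊓ X.basicOpen g).2
      (key f ha) (key g hb)
    refine h y hy1.1 hyZ ?_
    rw [Scheme.basicOpen_mul]
    exact ⟨hy1.2, hy2.2⟩

end StalkIdeal

/-! ### Forms that restrict to torsion forms -/

section TorsionOfRestriction

variable {A B C D : CommRingCat.{u}} {f : A ⟶ B} {T : Type*} (E : LogFrame f T)

theorem LogFrame.map_eq_zero_iff {f' : A ⟶ C} {q : B ⟶ C} [IsDomain C] (fac : 𝟙 A ≫ f' = f ≫ q)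
    (hq : Function.Surjective q) (t : T) (h0 : ∀ b, q b = 0 ↔ E.equation t ∣ b) {p : ℕ}
    (x : Forms f p) :
    Forms.map fac p x = 0 ↔ ∀ s, E.pos t ∉ s → E.equation t ∣ E.repr x s :=
  ⟨fun h => E.dvd_of_smul_map_eq_zero fac hq t h0 x one_ne_zero (by rw [one_smul, h]),
    E.map_eq_zero_of_dvd fac t ((h0 _).2 dvd_rfl) x⟩

/-- A form on the ambient space restricts to a torsion form on the divisor if and only if its
coordinates that do not involve `d(f t)` are divisible by `f t`, for all components. -/
theorem LogFrame.map_mem_torsion_iff [Fintype T] {fD : A ⟶ D} {qD : B ⟶ D} [IsDomain B]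
    (facD : 𝟙 A ≫ fD = f ≫ qD) (hqD : Function.Surjective qD)
    (hD : ∀ b, qD b = 0 ↔ ∏ t, E.equation t ∣ b)
    {C : T → CommRingCat.{u}} [∀ t, IsDomain (C t)] {fC : ∀ t, A ⟶ C t} {r : ∀ t, D ⟶ C t}
    (facC : ∀ t, 𝟙 A ≫ fC t = fD ≫ r t) (hr : ∀ t, Function.Surjective (r t))
    (hC : ∀ t b, r t (qD b) = 0 ↔ E.equation t ∣ b) {p : ℕ} (x : Forms f p) :
    Forms.map facD p x ∈ Submodule.torsion D (Forms fD p) ↔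
      ∀ t s, E.pos t ∉ s → E.equation t ∣ E.repr x s := by
  rw [E.mem_torsion_iff facD hqD hD facC hr hC]
  refine forall_congr' fun t => ?_
  have fac : 𝟙 A ≫ fC t = f ≫ (qD ≫ r t) := by
    rw [facC, ← Category.assoc, ← facD, Category.id_comp]
  rw [Forms.map_comp facD (facC t) fac (Category.id_comp _) rfl p x]
  exact E.map_eq_zero_iff fac ((hr t).comp hqD) t (hC t) x

end TorsionOfRestriction

/-! ### Components and strata of a divisor -/

section Subschemes

variable {X : Scheme.{u}} (I : X.IdealSheafData)

theorem stalkMap_subschemeι_surjective (z : I.subscheme) :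
    Function.Surjective (I.subschemeι.stalkMap z) :=
  I.subschemeι.stalkMap_surjective z

theorem exists_subschemeι_eq {x : X} (hx : x ∈ I.support) : ∃ z, I.subschemeι z = x := by
  have : x ∈ Set.range I.subschemeι := I.range_subschemeι.symm ▸ hx
  exact this

theorem subschemeι_mem_support (z : I.subscheme) : I.subschemeι z ∈ I.support :=
  I.range_subschemeι.subset ⟨z, rfl⟩

theorem mem_componentIdeal_support (Z : IrreducibleCloseds X) (x : X) :
    x ∈ (componentIdeal Z).support ↔ x ∈ (Z : Set X) := by
  rw [← SetLike.mem_coe, componentIdeal, Scheme.IdealSheafData.coe_support_vanishingIdeal]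
  rfl

theorem stalkIdeal_componentIdeal_eq_top {Z : IrreducibleCloseds X} {x : X}
    (hx : x ∉ (Z : Set X)) : stalkIdeal (componentIdeal Z) x = ⊤ := by
  by_contra h
  exact hx ((mem_componentIdeal_support Z x).mp
    ((mem_support_iff_stalkIdeal _).mpr (IsLocalRing.le_maximalIdeal h)))

/-- The ideal of a closed set of codimension one is nonzero at every point: otherwise it would vanish
on an open set, and the closed set would contain the generic point. -/
theorem stalkIdeal_componentIdeal_ne_bot [IsIntegral X] {Z : IrreducibleCloseds X}
    (hZ : Order.coheight Z = 1) (x : X) : stalkIdeal (componentIdeal Z) x ≠ ⊥ := by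
  intro h
  obtain ⟨V, hx, -⟩ := exists_affine_le (Opens.mem_top x)
  rw [stalkIdeal_eq_map _ x V hx, Ideal.map_eq_bot_iff_le_ker] at h
  have hinj : Function.Injective (X.presheaf.germ V.1 x hx) := germ_injective_of_isIntegral X x hx
  have h0 : (componentIdeal Z).ideal V = ⊥ := by
    rw [eq_bot_iff]
    refine h.trans fun f hf => ?_
    exact hinj (hf.trans (map_zero _).symm)
  have hVZ : (V.1 : Set X) ⊆ Z := fun y hy => by
    rw [← mem_componentIdeal_support, Scheme.IdealSheafData.mem_support_iff_of_mem hy, h0,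
      Scheme.mem_zeroLocus_iff]
    intro f hf
    have : f = 0 := hf
    subst this
    simp
  have hgen : genericPoint X ∈ (Z : Set X) := hVZ
    ((genericPoint_spec X).mem_open_set_iff V.1.2 |>.mpr ⟨x, trivial, hx⟩)
  have htop : (Z : Set X) = Set.univ := by
    refine Set.eq_univ_of_univ_subset ?_
    rw [← (genericPoint_spec X).def]
    exact closure_minimal (Set.singleton_subset_iff.mpr hgen) Z.isClosed
  have hmax : IsMax Z := fun Z' _ => by
    change (Z' : Set X) ⊆ Z
    rw [htop]
    exact Set.subset_univ _
  rw [Order.coheight_eq_zero.mpr hmax] at hZ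
  exact zero_ne_one hZ

theorem isDomain_of_ker_isPrime {B C : Type*} [CommRing B] [CommRing C] (q : B →+* C)
    (hq : Function.Surjective q) (h : (RingHom.ker q).IsPrime) : IsDomain C :=
  (RingHom.quotientKerEquivOfSurjective hq).symm.toMulEquiv.isDomain

end Subschemes

namespace ReducedDivisor

variable {X Y : Scheme.{0}} (D : ReducedDivisor X) (φ : X ⟶ Y)

/-- The components of `D` that pass through `x`. -/
abbrev Through (x : X) : Type := {Z : D.components // x ∈ (Z.1 : Set X)}

noncomputable instance (x : X) : Fintype (D.Through x) := by
  classical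
  exact inferInstanceAs (Fintype {Z : D.components // x ∈ (Z.1 : Set X)})

theorem mem_stratumIdeal_support (I : Finset D.components) (x : X) :
    x ∈ (D.stratumIdeal I).support ↔ ∀ Z ∈ I, x ∈ (Z.1 : Set X) := by
  rw [stratumIdeal]
  simp only [Scheme.IdealSheafData.support_iSup, ← mem_componentIdeal_support]
  simp only [← SetLike.mem_coe, Closeds.coe_iInf, Set.mem_iInter]

/-- Locally, the ideal of `D` is the intersection of the ideals of the components through the
point. -/
theorem mem_stalkIdeal_ideal_iff (x : X) (a : X.presheaf.stalk x) :
    a ∈ stalkIdeal D.ideal x ↔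
      ∀ t : D.Through x, a ∈ stalkIdeal (componentIdeal t.1.1) x := by
  rw [ideal, support, mem_stalkIdeal_vanishingIdeal_biSup_iff]
  constructor
  · exact fun h t => h t.1.1 t.1.2
  · intro h Z hZ
    by_cases hx : x ∈ (Z : Set X)
    · exact h ⟨⟨Z, hZ⟩, hx⟩
    · have := stalkIdeal_componentIdeal_eq_top hx
      rw [componentIdeal] at this
      rw [this]; trivial

theorem stalkIdeal_stratumIdeal (I : Finset D.components) (x : X) :
    stalkIdeal (D.stratumIdeal I) x = ⨆ Z ∈ I, stalkIdeal (componentIdeal Z.1) x := by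
  rw [stratumIdeal, iSup_subtype', iSup_subtype', stalkIdeal_iSup]

variable {D φ} {n m : ℕ}

/-- The stalks of a non-empty stratum are quotients with free differentials of the expected
rank. -/
theorem IsRelativelySNC.exists_quotient (h : D.IsRelativelySNC φ n m) (I : Finset D.components)
    (x : X) (hx : ∀ Z ∈ I, x ∈ (Z.1 : Set X)) :
    ∃ (c : ℕ) (_ : c + m + I.card = n) (C : CommRingCat.{0}) (_ : Nontrivial C)
      (f' : Y.presheaf.stalk (φ x) ⟶ C) (q : X.presheaf.stalk x ⟶ C),
      f' = φ.stalkMap x ≫ q ∧ Function.Surjective q ∧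
      RingHom.ker q.hom = ⨆ Z ∈ I, stalkIdeal (componentIdeal Z.1) x ∧ f'.hom.FormallySmooth ∧
      Nonempty (Module.Basis (Fin c) C (CommRingCat.KaehlerDifferential f')) := by
  obtain ⟨z, rfl⟩ := exists_subschemeι_eq _ ((D.mem_stratumIdeal_support I x).mpr hx)
  obtain ⟨c, hc, hsm⟩ := h.2 I ⟨z⟩
  have := hsm.smooth
  exact ⟨c, hc, _, inferInstance, (D.stratumι I ≫ φ).stalkMap z, (D.stratumι I).stalkMap z,
    Scheme.Hom.stalkMap_comp _ _ _, stalkMap_subschemeι_surjective _ z,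
    (ker_stalkMap_subschemeι _ z).trans (D.stalkIdeal_stratumIdeal I _),
    formallySmooth_stalkMap _ z, exists_basis_kaehler_stalkMap _ c z⟩

theorem IsRelativelySNC.smoothOfRelativeDimension [Nonempty X] (h : D.IsRelativelySNC φ n m) :
    ∃ d, d + m = n ∧ SmoothOfRelativeDimension d φ := by
  have hiso : IsIso (D.stratumι ∅) :=
    (Scheme.isIso_subschemeι_iff_eq_bot _).mpr (by simp [stratumIdeal])
  obtain ⟨x⟩ := ‹Nonempty X›
  obtain ⟨d, hd, hsm⟩ := h.2 ∅ ⟨(inv (D.stratumι ∅)) x⟩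
  refine ⟨d, by simpa using hd, ?_⟩
  have h1 := smoothOfRelativeDimension_comp (n := 0) (m := d) (inv (D.stratumι ∅))
    (D.stratumι ∅ ≫ φ)
  rwa [IsIso.inv_hom_id_assoc, zero_add] at h1

/-- At every point there are local coordinates on `X` relative to `Y` among which are the equations of
the components of `D` through the point. The strata of one component show that these components have
local equations; the stratum of all components through the point shows that the equations are part
of a coordinate system. -/
theorem IsRelativelySNC.exists_frame [IsIntegral X] [IsLocallyNoetherian X]
    (h : D.IsRelativelySNC φ n m) (x : X) {d : ℕ} (hd : d + m = n)
    [hsm : SmoothOfRelativeDimension d φ] :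
    ∃ E : LogFrame (φ.stalkMap x) (D.Through x),
      (∀ t, Ideal.span {E.equation t} = stalkIdeal (componentIdeal t.1.1) x) ∧
      Finite E.index ∧ Nat.card E.index = d := by
  obtain ⟨bB⟩ := exists_basis_kaehler_stalkMap φ d x
  have : Smooth φ := hsm.smooth
  have hB := formallySmooth_stalkMap φ x
  have key : ∀ t : D.Through x, ∃ a : X.presheaf.stalk x,
      stalkIdeal (componentIdeal t.1.1) x = Ideal.span {a} := by
    intro t
    obtain ⟨c, hc, C, _, f', q, hf', hq, hker, hs, ⟨bC⟩⟩ := h.exists_quotient {t.1} x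
      (by simpa using t.2)
    rw [Finset.card_singleton] at hc
    obtain rfl : d = c + 1 := by omega
    obtain ⟨a, ha⟩ := exists_ker_eq_span_singleton_hom hf' hB hs hq bB bC
    refine ⟨a, ?_⟩
    rw [← ha, hker]
    simp
  choose a ha using key
  have hprime : ∀ t, Prime (a t) := fun t => by
    have h1 := stalkIdeal_componentIdeal_isPrime t.1.1 t.2
    have h2 := stalkIdeal_componentIdeal_ne_bot (D.codim_one _ t.1.2) x
    rw [ha t] at h1 h2
    have h3 : a t ≠ 0 := fun h0 => h2 (by rw [h0, Ideal.span_singleton_eq_bot])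
    exact (Ideal.span_singleton_prime h3).mp h1
  obtain ⟨c, hc, C, _, f', q, hf', hq, hker, hs, ⟨bC⟩⟩ := h.exists_quotient
    ((Finset.univ : Finset (D.Through x)).map ⟨Subtype.val, Subtype.val_injective⟩) x
    (fun Z hZ => by
      obtain ⟨t, -, rfl⟩ := Finset.mem_map.mp hZ
      exact t.2)
  have hc : c + m + Fintype.card (D.Through x) = n := by
    rwa [Finset.card_map, Finset.card_univ] at hc
  obtain ⟨E, hE, hfin, hcard⟩ := exists_logFrame hf' hq a (by
    rw [hker, ← Set.iUnion_singleton_eq_range, Ideal.span_iUnion]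
    refine le_antisymm (iSup₂_le fun Z hZ => ?_) (iSup_le fun t => ?_)
    · obtain ⟨t, -, rfl⟩ := Finset.mem_map.mp hZ
      exact (ha t).le.trans (le_iSup (fun t => Ideal.span {a t}) t)
    · exact (ha t).ge.trans (le_iSup₂ (f := fun (Z : D.components) (_ : Z ∈ _) =>
        stalkIdeal (componentIdeal Z.1) x) t.1 (Finset.mem_map.mpr
          ⟨t, Finset.mem_univ t, rfl⟩))) hprime bB bC (by omega)
  exact ⟨E, fun t => by rw [hE, ha], hfin, hcard⟩

end ReducedDivisor

/-! ### Torsion of germs of forms on the divisor -/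

theorem ker_stalkMap_of_eq {X : Scheme.{u}} (I : X.IdealSheafData) (g : I.subscheme ⟶ X)
    (hg : g = I.subschemeι) (z : I.subscheme) (b : X.presheaf.stalk (g z)) :
    g.stalkMap z b = 0 ↔ b ∈ stalkIdeal I (g z) := by
  subst hg
  rw [← ker_stalkMap_subschemeι]
  rfl

theorem forms_map_eq_zero_congr {A B C : CommRingCat.{u}} {f : A ⟶ B} {f' f'' : A ⟶ C}
    {q q' : B ⟶ C} (h : f' = f'') (h' : q = q') (fac : 𝟙 A ≫ f' = f ≫ q)
    (fac' : 𝟙 A ≫ f'' = f ≫ q') {p : ℕ} (y : Forms f p) :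
    Forms.map fac p y = 0 ↔ Forms.map fac' p y = 0 := by
  subst h h'
  rfl

namespace ReducedDivisor

section Components

variable {X Y : Scheme.{0}} {D : ReducedDivisor X} {φ : X ⟶ Y}

theorem componentι_ι (Z : D.components) : D.componentι Z ≫ D.ι = (componentIdeal Z.1).subschemeι :=
  Scheme.IdealSheafData.inclusion_subschemeι _

theorem componentι_injective (Z : D.components) : Function.Injective (D.componentι Z) := by
  intro w w' h
  have h1 : (D.componentι Z ≫ D.ι) w = (D.componentι Z ≫ D.ι) w' := congrArg D.ι h
  rw [componentι_ι] at h1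
  exact (componentIdeal Z.1).subschemeι.isEmbedding.injective h1

theorem exists_componentι_eq (z : D.scheme) (t : D.Through (D.ι z)) :
    ∃ w, D.componentι t.1 w = z := by
  obtain ⟨w, hw⟩ := exists_subschemeι_eq _ ((mem_componentIdeal_support t.1.1 _).mpr t.2)
  refine ⟨w, D.ι.isEmbedding.injective ?_⟩
  exact (congrArg (fun g : D.component t.1 ⟶ X => g w) (componentι_ι t.1)).trans hw

/-- The stalk at a point of `D` of a component through it, as a quotient of the stalk of `D`. The
vanishing of forms is stated both for the quotient of the stalk at `z` and for `stalkPullback` at the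
points of the component over `z`; the form is a family over `D`, so that no identification of stalks
along an equality of points is needed. -/
theorem exists_component_stalk (z : D.scheme) (Z : D.components)
    (hZ : D.ι z ∈ (Z.1 : Set X)) :
    ∃ (C : CommRingCat.{0}) (_ : IsDomain C) (r : D.scheme.presheaf.stalk z ⟶ C),
      Function.Surjective r ∧
      (∀ b, r (D.ι.stalkMap z b) = 0 ↔ b ∈ stalkIdeal (componentIdeal Z.1) (D.ι z)) ∧
      ∀ (p : ℕ) (s : ∀ z, Forms ((D.ι ≫ φ).stalkMap z) p),
        Forms.map (Category.id_comp ((D.ι ≫ φ).stalkMap z ≫ r)) p (s z) = 0 ↔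
          ∀ w, D.componentι Z w = z → stalkPullback p (D.componentι Z) w
            (s (D.componentι Z w)) = 0 := by
  obtain ⟨w, hw⟩ : ∃ w, D.componentι Z w = z := exists_componentι_eq z ⟨Z, hZ⟩
  subst hw
  have hker : ∀ b, (D.componentι Z).stalkMap w (D.ι.stalkMap _ b) = 0 ↔
      b ∈ stalkIdeal (componentIdeal Z.1) (D.ι (D.componentι Z w)) := fun b => by
    refine Iff.trans ?_ (ker_stalkMap_of_eq _ _ (componentι_ι Z) w b)
    rw [Scheme.Hom.stalkMap_comp]
    rfl
  have hsurj : Function.Surjective ((D.componentι Z ≫ D.ι).stalkMap w) := by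
    rw [componentι_ι]
    exact stalkMap_subschemeι_surjective _ w
  have hsurj' : Function.Surjective ((D.componentι Z).stalkMap w) := by
    rw [Scheme.Hom.stalkMap_comp] at hsurj
    exact Function.Surjective.of_comp (g := D.ι.stalkMap _) hsurj
  refine ⟨_, ?_, (D.componentι Z).stalkMap w, hsurj', hker, fun p s => ?_⟩
  · refine isDomain_of_ker_isPrime ((D.componentι Z ≫ D.ι).stalkMap w).hom hsurj ?_
    have h1 : RingHom.ker ((D.componentι Z ≫ D.ι).stalkMap w).hom =
        stalkIdeal (componentIdeal Z.1) (D.ι (D.componentι Z w)) :=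
      Ideal.ext fun b => ker_stalkMap_of_eq _ _ (componentι_ι Z) w b
    rw [h1]
    exact stalkIdeal_componentIdeal_isPrime _ hZ
  · constructor
    · intro h w' hw'
      obtain rfl := componentι_injective Z hw'
      exact (forms_map_eq_zero_congr (Scheme.Hom.stalkMap_comp _ _ _).symm rfl _ _ _).mp h
    · intro h
      exact (forms_map_eq_zero_congr (Scheme.Hom.stalkMap_comp _ _ _).symm rfl _ _ _).mpr (h w rfl)

end Components

variable {X Y : Scheme.{0}} [IsIntegral X] (D : ReducedDivisor X) (φ : X ⟶ Y)

/-- The rational one-form defined by a germ of a one-form at `x`. -/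
noncomputable abbrev oneFormToGeneric (x : X) :
    CommRingCat.KaehlerDifferential (φ.stalkMap x) →ₛₗ[(toGeneric x).hom] RationalOneForms φ :=
  kaehlerMap (Scheme.Hom.stalkSpecializes_stalkMap φ _ _ _)

/-- Local coordinates on `X` relative to `Y` near `x` among which are the equations of all
components of `D` through `x`. The differentials of the coordinates are also a basis of the rational
one-forms. -/
structure Frame (x : X) extends LogFrame (φ.stalkMap x) (D.Through x) where
  span_equation : ∀ t, Ideal.span {equation t} = stalkIdeal (componentIdeal t.1.1) x
  /-- the basis of the rational one-forms given by the coordinates -/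
  rationalBasis : Module.Basis index X.functionField (RationalOneForms φ)
  rationalBasis_apply : ∀ i, rationalBasis i = oneFormToGeneric φ x (basis i)

variable {D φ}

theorem Frame.mem_stalkIdeal_iff {x : X} (E : D.Frame φ x) (t : D.Through x)
    (b : X.presheaf.stalk x) : b ∈ stalkIdeal (componentIdeal t.1.1) x ↔ E.equation t ∣ b := by
  rw [← E.span_equation, Ideal.mem_span_singleton]

theorem Frame.mem_stalkIdeal_ideal_iff {x : X} (E : D.Frame φ x)
    (b : X.presheaf.stalk x) : b ∈ stalkIdeal D.ideal x ↔ ∏ t, E.equation t ∣ b := by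
  rw [D.mem_stalkIdeal_ideal_iff]
  constructor
  · exact fun h => E.prod_dvd fun t => (E.mem_stalkIdeal_iff t b).mp (h t)
  · exact fun h t => (E.mem_stalkIdeal_iff t b).mpr
      ((Finset.dvd_prod_of_mem _ (Finset.mem_univ t)).trans h)

variable {p : ℕ}

/-- Locally, `D` is defined by the product of the equations of its components. -/
theorem Frame.span_prod_equation {x : X} (E : D.Frame φ x) :
    Ideal.span {∏ t, E.equation t} = stalkIdeal D.ideal x := by
  ext a
  rw [E.mem_stalkIdeal_ideal_iff, Ideal.mem_span_singleton]

/-- A germ of forms on `D` is torsion if and only if it vanishes on all components. The form is the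
member at `z` of an arbitrary family `s` over `D`, as in `exists_component_stalk`. -/
theorem Frame.mem_torsion_iff {z : D.scheme} (E : D.Frame φ (D.ι z))
    (s : ∀ z, Forms ((D.ι ≫ φ).stalkMap z) p) :
    s z ∈ Submodule.torsion (D.scheme.presheaf.stalk z) (Forms ((D.ι ≫ φ).stalkMap z) p) ↔
      ∀ (Z : D.components) (w : D.component Z), D.componentι Z w = z →
        stalkPullback p (D.componentι Z) w (s (D.componentι Z w)) = 0 := by
  choose C hC r hr hker hs using fun t : D.Through (D.ι z) =>
    exists_component_stalk (φ := φ) z t.1 t.2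
  refine (E.toLogFrame.mem_torsion_iff (qD := D.ι.stalkMap z)
    ((Category.id_comp _).trans (Scheme.Hom.stalkMap_comp D.ι φ z))
    (stalkMap_subschemeι_surjective _ z)
    (fun b => (ker_stalkMap_of_eq D.ideal D.ι rfl z b).trans (E.mem_stalkIdeal_ideal_iff b))
    (fun t => Category.id_comp ((D.ι ≫ φ).stalkMap z ≫ r t)) hr
    (fun t b => (hker t b).trans (E.mem_stalkIdeal_iff t b)) (s z)).trans ?_
  constructor
  · rintro h Z w rfl
    refine (hs ⟨Z, ?_⟩ p s).mp (h _) w rfl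
    rw [← mem_componentIdeal_support]
    have := subschemeι_mem_support (componentIdeal Z.1) w
    rwa [← componentι_ι] at this
  · exact fun h t => (hs t p s).mpr (h t.1)

/-- A germ of forms on `X` restricts to a torsion form on `D` if and only if its coordinates that
do not involve the differential of the equation of a component are divisible by that equation. -/
theorem Frame.stalkPullback_mem_torsion_iff {z : D.scheme} (E : D.Frame φ (D.ι z))
    (s : Forms (φ.stalkMap (D.ι z)) p) :
    stalkPullback p D.ι z s ∈
        Submodule.torsion (D.scheme.presheaf.stalk z) (Forms ((D.ι ≫ φ).stalkMap z) p) ↔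
      ∀ t i, E.pos t ∉ i → E.equation t ∣ E.repr s i := by
  choose C hC r hr hker hs using fun t : D.Through (D.ι z) =>
    exists_component_stalk (φ := φ) z t.1 t.2
  exact E.toLogFrame.map_mem_torsion_iff (qD := D.ι.stalkMap z)
    ((Category.id_comp _).trans (Scheme.Hom.stalkMap_comp D.ι φ z))
    (stalkMap_subschemeι_surjective _ z)
    (fun b => (ker_stalkMap_of_eq D.ideal D.ι rfl z b).trans (E.mem_stalkIdeal_ideal_iff b))
    (fun t => Category.id_comp ((D.ι ≫ φ).stalkMap z ≫ r t)) hr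
    (fun t b => (hker t b).trans (E.mem_stalkIdeal_iff t b)) s

end ReducedDivisor

/-! ### Bases of the rational one-forms -/

section RationalForms

/-- The quotient rule: the differentials of the elements of `B` span the differentials of a ring
of fractions of `B`. -/
theorem span_kaehlerMap_eq_top {A B A' K : CommRingCat.{u}} {f : A ⟶ B} {f' : A' ⟶ K}
    {g : A ⟶ A'} {σ : B ⟶ K} (fac : g ≫ f' = f ≫ σ)
    (hfrac : ∀ k : K, ∃ a b : B, σ b * k = σ a ∧ IsUnit (σ b)) {I : Type*}
    (e : Module.Basis I B (CommRingCat.KaehlerDifferential f)) :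
    Submodule.span K (Set.range fun i => kaehlerMap fac (e i)) = ⊤ := by
  set P : Submodule K (CommRingCat.KaehlerDifferential f') :=
    Submodule.span K (Set.range fun i => kaehlerMap fac (e i)) with hP
  have h1 : ∀ m, kaehlerMap fac m ∈ P := fun m => by
    induction e.mem_span m using Submodule.span_induction with
    | mem m hm =>
      obtain ⟨i, rfl⟩ := hm
      exact Submodule.subset_span ⟨i, rfl⟩
    | zero => rw [map_zero]; exact P.zero_mem
    | add x y _ _ hx hy => rw [map_add]; exact P.add_mem hx hy
    | smul r x _ hx => rw [map_smulₛₗ]; exact P.smul_mem _ hx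
  have h2 : ∀ b : B, CommRingCat.KaehlerDifferential.d (f := f') (σ b) ∈ P := fun b => by
    rw [← kaehlerMap_d fac]; exact h1 _
  rw [eq_top_iff, ← span_range_d f', Submodule.span_le]
  rintro _ ⟨k, rfl⟩
  obtain ⟨a, b, hab, hb⟩ := hfrac k
  have h3 : σ b • CommRingCat.KaehlerDifferential.d (f := f') k ∈ P := by
    have h4 := d_mul (f := f') (σ b) k
    rw [hab] at h4
    have h5 := sub_eq_iff_eq_add.mpr h4
    rw [← h5]
    exact P.sub_mem (h2 a) (P.smul_mem _ (h2 b))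
  exact (P.smul_mem_iff_of_isUnit hb).mp h3

variable {X Y : Scheme.{0}} [IsIntegral X] (φ : X ⟶ Y)

theorem toGeneric_injective (x : X) :
    Function.Injective (ReducedDivisor.toGeneric x) :=
  IsFractionRing.injective (X.presheaf.stalk x) X.functionField

theorem exists_fraction (x : X) (k : X.functionField) : ∃ a b : X.presheaf.stalk x,
    ReducedDivisor.toGeneric x b * k = ReducedDivisor.toGeneric x a ∧
      IsUnit (ReducedDivisor.toGeneric x b) := by
  obtain ⟨⟨a, b⟩, h⟩ := IsLocalization.surj (nonZeroDivisors (X.presheaf.stalk x)) k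
  exact ⟨a, b.1, (mul_comm _ _).trans h,
    IsLocalization.map_units (M := nonZeroDivisors (X.presheaf.stalk x)) X.functionField b⟩

namespace ReducedDivisor

variable {D : ReducedDivisor X} {φ}

/-- The differentials of local coordinates span the rational one-forms, by the quotient rule, hence are
a basis since their number is the dimension at the generic point. -/
theorem exists_rationalBasis {x : X} {I : Type} [Finite I]
    (e : Module.Basis I (X.presheaf.stalk x) (CommRingCat.KaehlerDifferential (φ.stalkMap x)))
    (d : ℕ) [SmoothOfRelativeDimension d φ] (hd : Nat.card I = d) :
    ∃ e' : Module.Basis I X.functionField (RationalOneForms φ),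
      ∀ i, e' i = oneFormToGeneric φ x (e i) := by
  obtain ⟨b⟩ := exists_basis_kaehler_stalkMap φ d (genericPoint X)
  have := Fintype.ofFinite I
  have hspan := span_kaehlerMap_eq_top (Scheme.Hom.stalkSpecializes_stalkMap φ _ _ _)
    (exists_fraction x) e
  have hrank : Module.finrank X.functionField (RationalOneForms φ) = d := by
    refine (Module.finrank_eq_card_basis (R := X.functionField) b).trans (Fintype.card_fin d)
  have hcard : Fintype.card I = Module.finrank X.functionField (RationalOneForms φ) := by
    rw [hrank, ← hd, Nat.card_eq_fintype_card]
  exact ⟨basisOfTopLeSpanOfCardEqFinrank _ hspan.ge hcard,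
    fun i => by rw [coe_basisOfTopLeSpanOfCardEqFinrank]⟩

/-- If `D` is relatively snc, there are adapted local coordinates at every point. -/
theorem IsRelativelySNC.nonempty_frame [IsLocallyNoetherian X] {n m : ℕ}
    (h : D.IsRelativelySNC φ n m) (x : X) : Nonempty (D.Frame φ x) := by
  have : Nonempty X := ⟨x⟩
  obtain ⟨d, hd, hsm⟩ := h.smoothOfRelativeDimension
  obtain ⟨E, hE, hfin, hcard⟩ := h.exists_frame x hd
  obtain ⟨e', he'⟩ := exists_rationalBasis E.basis d hcard
  exact ⟨⟨E, hE, e', he'⟩⟩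

end ReducedDivisor

end RationalForms

/-! ### Local generators of ideal sheaves -/

section LocalEquation

variable {X : Scheme.{u}} (I : X.IdealSheafData)

/-- A generator of the stalk of an ideal sheaf generates the ideal sheaf near the point. -/
theorem exists_ideal_eq_span [IsLocallyNoetherian X] {x : X} {a : X.presheaf.stalk x}
    (ha : Ideal.span {a} = stalkIdeal I x) {U : X.Opens} (hx : x ∈ U) :
    ∃ (V : X.affineOpens) (hxV : x ∈ V.1) (f : Γ(X, V.1)), V.1 ≤ U ∧ I.ideal V = Ideal.span {f} ∧
      X.presheaf.germ V.1 x hxV f = a := by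
  obtain ⟨V, hxV, f, hVU, hf, hfa⟩ := exists_mem_ideal_of_mem_stalkIdeal I
    (ha ▸ Ideal.mem_span_singleton_self a) hx
  have : IsNoetherianRing Γ(X, V.1) := IsLocallyNoetherian.component_noetherian V
  obtain ⟨S, hS⟩ := (isNoetherianRing_iff_ideal_fg _).mp this (I.ideal V)
  have key : ∀ g ∈ I.ideal V, ∃ W : X.Opens, x ∈ W ∧ ∀ W' : X.Opens, W' ≤ W → ∀ h : W' ≤ V.1,
      X.presheaf.map (homOfLE h).op f ∣ X.presheaf.map (homOfLE h).op g := by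
    intro g hg
    have h1 := germ_mem_stalkIdeal I V hxV hg
    rw [← ha, Ideal.mem_span_singleton] at h1
    obtain ⟨c, hc⟩ := h1
    obtain ⟨W, hW, c, rfl⟩ := X.presheaf.exists_germ_eq c
    have h2 : X.presheaf.germ V.1 x hxV g =
        X.presheaf.germ (V.1 ⊓ W) x ⟨hxV, hW⟩
          (X.presheaf.map (homOfLE (inf_le_left : V.1 ⊓ W ≤ V.1)).op f *
            X.presheaf.map (homOfLE (inf_le_right : V.1 ⊓ W ≤ W)).op c) := by
      rw [map_mul]
      refine hc.trans (congrArg₂ (· * ·) ?_ ?_)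
      · exact hfa.symm.trans (X.presheaf.germ_res_apply _ _ _ _).symm
      · exact (X.presheaf.germ_res_apply _ _ _ _).symm
    obtain ⟨W₁, hxW₁, i, j, e⟩ := X.presheaf.germ_eq x hxV
      (show x ∈ V.1 ⊓ W from ⟨hxV, hW⟩) _ _ h2
    refine ⟨W₁, hxW₁, fun W' hW' h => ?_⟩
    have h3 := congrArg (X.presheaf.map (homOfLE hW').op) e
    rw [map_mul, map_mul] at h3
    have h4 : ∀ {U₁ U₂ U₃ : X.Opens} (k : U₂ ⟶ U₁) (k' : U₃ ⟶ U₂) (k'' : U₃ ⟶ U₁) (t : Γ(X, U₁)),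
        X.presheaf.map k'.op (X.presheaf.map k.op t) = X.presheaf.map k''.op t :=
      fun k k' k'' t => by
        rw [← ConcreteCategory.comp_apply, ← Functor.map_comp]
        rfl
    refine ⟨X.presheaf.map (homOfLE (hW'.trans (j.le.trans inf_le_right))).op c, ?_⟩
    rw [h4 i (homOfLE hW') (homOfLE h) g] at h3
    rw [h3]
    exact congrArg₂ (· * ·) ((congrArg _ (h4 _ j (homOfLE (j.le.trans inf_le_left)) f)).trans
      (h4 _ _ _ f)) ((congrArg _ (h4 _ j (homOfLE (j.le.trans inf_le_right)) c)).trans (h4 _ _ _ c))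
  -- The finitely many generators of `I` over `V` become multiples of `f` on one neighbourhood.
  have key2 : ∀ S' : Finset Γ(X, V.1), (∀ g ∈ S', g ∈ I.ideal V) → ∃ W : X.Opens, x ∈ W ∧
      ∀ W' : X.Opens, W' ≤ W → ∀ h : W' ≤ V.1, ∀ g ∈ S',
        X.presheaf.map (homOfLE h).op f ∣ X.presheaf.map (homOfLE h).op g := by
    classical
    intro S' hS'
    induction S' using Finset.induction_on with
    | empty => exact ⟨⊤, Opens.mem_top x, fun _ _ _ g hg => by simp at hg⟩
    | insert g S' _ ih =>
      obtain ⟨W, hxW, hW⟩ := ih fun g hg => hS' g (Finset.mem_insert_of_mem hg)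
      obtain ⟨W₂, hxW₂, hW₂⟩ := key g (hS' g (Finset.mem_insert_self _ _))
      refine ⟨W ⊓ W₂, ⟨hxW, hxW₂⟩, fun W' hW' h g' hg' => ?_⟩
      rcases Finset.mem_insert.mp hg' with rfl | hg'
      · exact hW₂ W' (hW'.trans inf_le_right) h
      · exact hW W' (hW'.trans inf_le_left) h g' hg'
  obtain ⟨W, hxW, hW⟩ := key2 S fun g hg => hS ▸ Ideal.subset_span hg
  obtain ⟨V', hxV', hV'⟩ := exists_affine_le (U := W ⊓ V.1) ⟨hxW, hxV⟩
  have hle : V' ≤ V := hV'.trans inf_le_right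
  refine ⟨V', hxV', X.presheaf.map (homOfLE hle).op f, le_trans hle hVU, ?_, ?_⟩
  · refine le_antisymm ?_ ((Ideal.span_singleton_le_iff_mem _).mpr (map_mem_ideal I hle hf))
    rw [← I.map_ideal hle, ← hS, Ideal.map_span, Ideal.span_le]
    rintro _ ⟨g, hg, rfl⟩
    exact Ideal.mem_span_singleton.mpr (hW V'.1 (hV'.trans inf_le_left) hle g hg)
  · exact (X.presheaf.germ_res_apply _ _ _ _).trans hfa

end LocalEquation

/-! ### The stalks of the sheaf of logarithmic forms -/

section IntegralCoordinates

variable {B K I N : Type*} [CommRing B] [CommRing K] [AddCommGroup N] [Module K N]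

/-- A vector whose coordinates come from the subring of integral elements, the image of `σ`. -/
def HasIntegralCoordinates (σ : B →+* K) (b : Module.Basis I K N) (η : N) : Prop :=
  ∀ i, ∃ r, b.repr η i = σ r

variable {σ : B →+* K} {b : Module.Basis I K N} {η η' : N}

theorem HasIntegralCoordinates.zero : HasIntegralCoordinates σ b 0 := fun i =>
  ⟨0, by rw [map_zero, map_zero, Finsupp.zero_apply]⟩

theorem HasIntegralCoordinates.add (h : HasIntegralCoordinates σ b η)
    (h' : HasIntegralCoordinates σ b η') : HasIntegralCoordinates σ b (η + η') := fun i => by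
  obtain ⟨r, hr⟩ := h i
  obtain ⟨r', hr'⟩ := h' i
  exact ⟨r + r', by rw [map_add, Finsupp.add_apply, hr, hr', map_add]⟩

theorem HasIntegralCoordinates.smul (h : HasIntegralCoordinates σ b η) (a : B) :
    HasIntegralCoordinates σ b (σ a • η) := fun i => by
  obtain ⟨r, hr⟩ := h i
  exact ⟨a * r, by rw [map_smul, Finsupp.smul_apply, hr, smul_eq_mul, map_mul]⟩

theorem HasIntegralCoordinates.self (i : I) : HasIntegralCoordinates σ b (b i) := fun j => by
  rw [Module.Basis.repr_self]
  by_cases h : i = j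
  · exact ⟨1, by rw [h, Finsupp.single_eq_same, map_one]⟩
  · exact ⟨0, by rw [Finsupp.single_eq_of_ne (Ne.symm h), map_zero]⟩

end IntegralCoordinates

namespace ReducedDivisor

section RestrictsToTorsion

variable {X Y : Scheme.{0}} {D : ReducedDivisor X} {φ : X ⟶ Y} {p : ℕ}

/-- A germ of forms at `x` whose restriction to `D` is torsion; no condition if `x` is not a point
of `D`. -/
def RestrictsToTorsion (D : ReducedDivisor X) (φ : X ⟶ Y) (p : ℕ) (x : X)
    (s : Forms (φ.stalkMap x) p) : Prop :=
  ∀ (z : D.scheme) (h : x = D.ι z), stalkPullback p D.ι z (h ▸ s) ∈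
    Submodule.torsion (D.scheme.presheaf.stalk z) (Forms ((D.ι ≫ φ).stalkMap z) p)

theorem RestrictsToTorsion.smul {x : X} {s : Forms (φ.stalkMap x) p}
    (h : D.RestrictsToTorsion φ p x s) (a : X.presheaf.stalk x) :
    D.RestrictsToTorsion φ p x (a • s) := by
  rintro z rfl
  exact (((stalkPullback p D.ι z).map_smulₛₗ a s).symm ▸ Submodule.smul_mem _ _ (h z rfl) :)

/-- A point on a component of `D` is a point of `D`. -/
theorem exists_ι_eq_of_through {x : X} (t : D.Through x) : ∃ z, D.ι z = x := by
  refine exists_subschemeι_eq _ ?_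
  rw [mem_support_iff_stalkIdeal]
  refine le_trans (fun a ha => ?_) ((mem_support_iff_stalkIdeal _).mp
    ((mem_componentIdeal_support t.1.1 x).mpr t.2))
  exact (D.mem_stalkIdeal_ideal_iff x a).mp ha t

end RestrictsToTorsion

variable {X Y : Scheme.{0}} [IsIntegral X] {D : ReducedDivisor X} {φ : X ⟶ Y} {p : ℕ}

namespace Frame

variable {x : X} (E : D.Frame φ x)

open Classical in
/-- The denominators of the logarithmic basis: the equation of a component at the position of its
differential, and `1` elsewhere. -/
noncomputable def denominator (i : E.index) : X.presheaf.stalk x :=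
  if h : ∃ t, E.pos t = i then E.equation h.choose else 1

theorem denominator_pos (t : D.Through x) : E.denominator (E.pos t) = E.equation t := by
  have h : ∃ t', E.pos t' = E.pos t := ⟨t, rfl⟩
  rw [denominator, dif_pos h, E.pos_injective h.choose_spec]

theorem denominator_of_notMem {i : E.index} (hi : i ∉ Set.range E.pos) : E.denominator i = 1 :=
  dif_neg hi

theorem toGeneric_denominator_ne_zero (i : E.index) : toGeneric x (E.denominator i) ≠ 0 := by
  rw [Ne, map_eq_zero_iff _ (toGeneric_injective x)]
  by_cases hi : i ∈ Set.range E.pos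
  · obtain ⟨t, rfl⟩ := hi
    rw [denominator_pos]
    exact (E.prime t).ne_zero
  · rw [denominator_of_notMem E hi]
    exact one_ne_zero

/-- The logarithmic basis of the rational one-forms: the forms `df / f` for the equations `f` of the
components of `D`, and the remaining elements of the basis of the regular forms. -/
noncomputable def logBasis : Module.Basis E.index X.functionField (RationalOneForms φ) :=
  E.rationalBasis.isUnitSMul (w := fun i => (toGeneric x (E.denominator i))⁻¹)
    fun i => (inv_ne_zero (E.toGeneric_denominator_ne_zero i)).isUnit

theorem logBasis_apply (i : E.index) :
    E.logBasis i = (toGeneric x (E.denominator i))⁻¹ • E.rationalBasis i :=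
  Module.Basis.isUnitSMul_apply _ i

theorem smul_logBasis (i : E.index) :
    toGeneric x (E.denominator i) • E.logBasis i = E.rationalBasis i := by
  rw [logBasis_apply, smul_smul, mul_inv_cancel₀ (E.toGeneric_denominator_ne_zero i), one_smul]

theorem repr_logBasis (η : RationalOneForms φ) (i : E.index) :
    E.logBasis.repr η i = toGeneric x (E.denominator i) * E.rationalBasis.repr η i := by
  conv_rhs => rw [← E.logBasis.linearCombination_repr η]
  rw [Finsupp.linearCombination_apply, Finsupp.sum, map_sum, Finsupp.finsetSum_apply]
  simp only [map_smul, Finsupp.smul_apply, smul_eq_mul]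
  rw [Finset.sum_eq_single i]
  · rw [logBasis_apply, map_smul, Module.Basis.repr_self, Finsupp.smul_apply, Finsupp.single_eq_same,
      smul_eq_mul, mul_one, mul_left_comm, mul_inv_cancel₀ (E.toGeneric_denominator_ne_zero i),
      mul_one]
  · intro j _ hj
    rw [logBasis_apply, map_smul, Module.Basis.repr_self, Finsupp.smul_apply,
      Finsupp.single_eq_of_ne hj.symm, smul_zero, mul_zero]
  · intro hi
    rw [Finsupp.notMem_support_iff.mp hi, zero_mul]

theorem repr_oneFormToGeneric (m : CommRingCat.KaehlerDifferential (φ.stalkMap x)) (i : E.index) :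
    E.rationalBasis.repr (oneFormToGeneric φ x m) i = toGeneric x (E.basis.repr m i) := by
  induction E.basis.mem_span m using Submodule.span_induction with
  | mem m hm =>
    obtain ⟨j, rfl⟩ := hm
    rw [← E.rationalBasis_apply, Module.Basis.repr_self, Module.Basis.repr_self]
    by_cases h : j = i
    · subst h; simp
    · rw [Finsupp.single_eq_of_ne (Ne.symm h), Finsupp.single_eq_of_ne (Ne.symm h), map_zero]
  | zero => simp
  | add m m' _ _ hm hm' => simp only [map_add, Finsupp.add_apply, hm, hm']
  | smul r m _ hm =>
    rw [map_smulₛₗ, map_smul, map_smul, Finsupp.smul_apply, Finsupp.smul_apply, hm, smul_eq_mul,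
      smul_eq_mul, map_mul]

theorem hasIntegralCoordinates_oneFormToGeneric
    (m : CommRingCat.KaehlerDifferential (φ.stalkMap x)) :
    HasIntegralCoordinates (toGeneric x).hom E.logBasis (oneFormToGeneric φ x m) := fun i =>
  ⟨E.denominator i * E.basis.repr m i, by
    rw [repr_logBasis, repr_oneFormToGeneric, map_mul]⟩

theorem hasIntegralCoordinates_d (b : X.presheaf.stalk x) :
    HasIntegralCoordinates (toGeneric x).hom E.logBasis
    (CommRingCat.KaehlerDifferential.d (f := φ.stalkMap (genericPoint X)) (toGeneric x b)) := by
  rw [← kaehlerMap_d (Scheme.Hom.stalkSpecializes_stalkMap φ _ _ _) b]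
  exact E.hasIntegralCoordinates_oneFormToGeneric _

theorem rationalBasis_pos (t : D.Through x) : E.rationalBasis (E.pos t) =
    CommRingCat.KaehlerDifferential.d (f := φ.stalkMap (genericPoint X))
      (toGeneric x (E.equation t)) := by
  rw [E.rationalBasis_apply, E.basis_pos,
    ← kaehlerMap_d (Scheme.Hom.stalkSpecializes_stalkMap φ _ _ _)]

theorem logBasis_pos (t : D.Through x) : E.logBasis (E.pos t) =
    (toGeneric x (E.equation t))⁻¹ •
      CommRingCat.KaehlerDifferential.d (f := φ.stalkMap (genericPoint X))
        (toGeneric x (E.equation t)) := by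
  rw [logBasis_apply, denominator_pos, rationalBasis_pos]

theorem toGeneric_unit_inv (u : (X.presheaf.stalk x)ˣ) :
    (toGeneric x u)⁻¹ = toGeneric x (u⁻¹ : (X.presheaf.stalk x)ˣ) := by
  refine inv_eq_of_mul_eq_one_left ?_
  rw [← map_mul, Units.inv_mul, map_one]

/-- Logarithmic one-forms have integral coordinates in the logarithmic basis. Two equations of the same
component differ by a unit `u`, so that their logarithmic differentials differ by the regular form
`du / u`. -/
theorem hasIntegralCoordinates_of_mem_logOneForms
    {η : RationalOneForms φ} (h : η ∈ D.logOneForms φ x) :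
    HasIntegralCoordinates (toGeneric x).hom E.logBasis η := by
  have unit : ∀ u : (X.presheaf.stalk x)ˣ,
      HasIntegralCoordinates (toGeneric x).hom E.logBasis ((toGeneric x u)⁻¹ •
        CommRingCat.KaehlerDifferential.d (f := φ.stalkMap (genericPoint X)) (toGeneric x u)) :=
    fun u => by
      rw [toGeneric_unit_inv]
      exact (E.hasIntegralCoordinates_d _).smul _
  refine Submodule.span_induction
    (M := (ModuleCat.restrictScalars (toGeneric x).hom).obj (RationalOneForms φ))
    (p := fun η _ => HasIntegralCoordinates (toGeneric x).hom E.logBasis η) ?_ .zero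
    (fun η η' _ _ h h' => h.add h') (fun r η _ h => h.smul r) h
  · rintro η (⟨b, rfl⟩ | ⟨Z, hZ, V, hx, f, hf, rfl⟩)
    · exact E.hasIntegralCoordinates_d b
    · have ha : stalkIdeal (componentIdeal Z) x =
          Ideal.span {X.presheaf.germ V.1 x hx f} := by
        rw [stalkIdeal_eq_map _ x V hx, hf, Ideal.map_span, Set.image_singleton]
      generalize X.presheaf.germ V.1 x hx f = a at ha ⊢
      by_cases hxZ : x ∈ (Z : Set X)
      · have h1 := E.span_equation ⟨⟨Z, hZ⟩, hxZ⟩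
        rw [ha, Ideal.span_singleton_eq_span_singleton] at h1
        obtain ⟨u, rfl⟩ := h1
        set b := E.equation ⟨⟨Z, hZ⟩, hxZ⟩ with hb
        have hb0 : toGeneric x b ≠ 0 := by
          rw [Ne, map_eq_zero_iff _ (toGeneric_injective x)]
          exact (E.prime _).ne_zero
        have hu0 : toGeneric x (u : X.presheaf.stalk x) ≠ 0 :=
          (u.isUnit.map (toGeneric x).hom).ne_zero
        have h2 : (toGeneric x (b * u))⁻¹ • CommRingCat.KaehlerDifferential.d
            (f := φ.stalkMap (genericPoint X)) (toGeneric x (b * u)) =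
            E.logBasis (E.pos ⟨⟨Z, hZ⟩, hxZ⟩) + (toGeneric x u)⁻¹ •
              CommRingCat.KaehlerDifferential.d (f := φ.stalkMap (genericPoint X))
                (toGeneric x u) := by
          rw [logBasis_pos, ← hb, map_mul, d_mul, smul_add, smul_smul, smul_smul, add_comm]
          congr 2 <;> field_simp
        rw [h2]
        exact (HasIntegralCoordinates.self _).add (unit u)
      · rw [stalkIdeal_componentIdeal_eq_top hxZ] at ha
        obtain ⟨u, rfl⟩ := Ideal.span_singleton_eq_top.mp ha.symm
        exact unit u

theorem oneFormToGeneric_mem_logOneForms (m : CommRingCat.KaehlerDifferential (φ.stalkMap x)) :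
    oneFormToGeneric φ x m ∈ D.logOneForms φ x := by
  have hm : m ∈ Submodule.span (X.presheaf.stalk x)
      (Set.range fun b => CommRingCat.KaehlerDifferential.d (f := φ.stalkMap x) b) := by
    rw [span_range_d]; trivial
  induction hm using Submodule.span_induction with
  | mem m hm =>
    obtain ⟨b, rfl⟩ := hm
    exact Submodule.subset_span (Or.inl ⟨b, kaehlerMap_d _ b⟩)
  | zero => rw [map_zero]; exact Submodule.zero_mem _
  | add m m' _ _ hm hm' => rw [map_add]; exact Submodule.add_mem _ hm hm'
  | smul r m _ hm => rw [map_smulₛₗ]; exact Submodule.smul_mem _ r hm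

theorem logBasis_mem_logOneForms [IsLocallyNoetherian X] (i : E.index) :
    E.logBasis i ∈ D.logOneForms φ x := by
  by_cases hi : i ∈ Set.range E.pos
  · obtain ⟨t, rfl⟩ := hi
    obtain ⟨V, hx, f, -, hf, hft⟩ := exists_ideal_eq_span _ (E.span_equation t) (Opens.mem_top x)
    refine Submodule.subset_span (Or.inr ⟨t.1.1, t.1.2, V, hx, f, hf, ?_⟩)
    rw [logBasis_pos, hft]
  · have : E.logBasis i = oneFormToGeneric φ x (E.basis i) := by
      rw [logBasis_apply, denominator_of_notMem E hi, map_one, inv_one, one_smul,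
        E.rationalBasis_apply]
    rw [this]
    exact oneFormToGeneric_mem_logOneForms _

/-- The stalk of `Ω^p_{X/Y}(log D)` is free on the wedge products of the logarithmic basis. -/
theorem mem_logFormsStalk_iff_repr [IsLocallyNoetherian X] (ω : RationalForms φ p) :
    ω ∈ D.logFormsStalk φ p x ↔
      HasIntegralCoordinates (toGeneric x).hom (E.logBasis.exteriorPower p) ω := by
  constructor
  · intro h
    refine Submodule.span_induction
      (M := (ModuleCat.restrictScalars (toGeneric x).hom).obj (RationalForms φ p))
      (p := fun ω _ => HasIntegralCoordinates (toGeneric x).hom (E.logBasis.exteriorPower p) ω)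
      ?_ .zero (fun η η' _ _ h h' => h.add h') (fun r η _ h => h.smul r) h
    rintro ω ⟨η, hη, rfl⟩ s
    exact exists_repr_ιMulti_eq (σ := (toGeneric x).hom) E.logBasis η
      (fun j => E.hasIntegralCoordinates_of_mem_logOneForms (hη j)) s
  · intro h
    have key := (E.logBasis.exteriorPower p).linearCombination_repr ω
    rw [Finsupp.linearCombination_apply, Finsupp.sum] at key
    have h1 : ∀ s, ((E.logBasis.exteriorPower p).repr ω s •
        (E.logBasis.exteriorPower p) s : RationalForms φ p) ∈ D.logFormsStalk φ p x := by
      intro s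
      obtain ⟨r, hr⟩ := h s
      rw [hr]
      refine Submodule.smul_mem (D.logFormsStalk φ p x) r (Submodule.subset_span ?_)
      refine ⟨fun j => E.logBasis (Set.powersetCard.ofFinEmbEquiv.symm s j),
        fun j => E.logBasis_mem_logOneForms _, ?_⟩
      rw [exteriorPower.basis_apply]
      rfl
    have h2 := Submodule.sum_mem (D.logFormsStalk φ p x)
      (t := ((E.logBasis.exteriorPower p).repr ω).support)
      (f := fun s => ((E.logBasis.exteriorPower p).repr ω s • (E.logBasis.exteriorPower p) s :
        RationalForms φ p)) fun s _ => h1 s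
    exact Eq.mp (congrArg (fun z : RationalForms φ p => z ∈ D.logFormsStalk φ p x) key) h2

/-- Germs of forms are determined by their rational forms, since the forms are free. -/
theorem formToGeneric_injective (E : D.Frame φ x) :
    Function.Injective (formToGeneric φ p x) := by
  rw [injective_iff_map_eq_zero]
  intro s hs
  refine (E.basis.exteriorPower p).repr.map_eq_zero_iff.mp (Finsupp.ext fun i => ?_)
  refine toGeneric_injective x ?_
  refine (repr_exteriorPower_semilinear (σ := (toGeneric x).hom) (oneFormToGeneric φ x)
    (formToGeneric φ p x) (forms_map_ιMulti _ p) E.basis E.rationalBasis E.rationalBasis_apply s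
    i).symm.trans ?_
  exact (congrArg (fun z => (E.rationalBasis.exteriorPower p).repr z i) hs).trans
    ((DFunLike.congr_fun (map_zero (E.rationalBasis.exteriorPower p).repr) i).trans
      (map_zero _).symm)

/-- `mem_logFormsStalk_iff_repr` in terms of the coordinates of regular forms. -/
theorem mem_logFormsStalk_iff [IsLocallyNoetherian X] (ω : RationalForms φ p) :
    ω ∈ D.logFormsStalk φ p x ↔ ∃ s : Forms (φ.stalkMap x) p,
      formToGeneric φ p x s = toGeneric x (∏ t, E.equation t) • ω ∧
        ∀ t i, E.pos t ∉ i → E.equation t ∣ E.repr s i :=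
  (E.mem_logFormsStalk_iff_repr ω).trans <|
    exists_repr_eq_iff (σ := (toGeneric x).hom) (toGeneric_injective x) (oneFormToGeneric φ x)
      (formToGeneric φ p x) (forms_map_ιMulti _ p) E.basis E.rationalBasis E.rationalBasis_apply
      E.equation E.pos E.pos_injective E.prime (fun _ _ => E.eq_of_dvd) E.denominator
      E.denominator_pos (fun _ => E.denominator_of_notMem) E.logBasis E.smul_logBasis ω

end Frame

theorem Frame.restrictsToTorsion_iff {x : X} (E : D.Frame φ x) (s : Forms (φ.stalkMap x) p) :
    D.RestrictsToTorsion φ p x s ↔ ∀ t i, E.pos t ∉ i → E.equation t ∣ E.repr s i := by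
  constructor
  · intro h t
    obtain ⟨z, rfl⟩ := exists_ι_eq_of_through t
    exact E.stalkPullback_mem_torsion_iff s |>.mp (h z rfl) t
  · rintro h z rfl
    exact E.stalkPullback_mem_torsion_iff s |>.mpr h

/-- A rational form is logarithmic if and only if its product with an equation of `D` is a regular
form that restricts to a torsion form on `D`. -/
theorem Frame.mem_logFormsStalk_iff_restrictsToTorsion [IsLocallyNoetherian X] {x : X}
    (E : D.Frame φ x) {b : X.presheaf.stalk x} (hb : Ideal.span {b} = stalkIdeal D.ideal x)
    (ω : RationalForms φ p) :
    ω ∈ D.logFormsStalk φ p x ↔ ∃ s : Forms (φ.stalkMap x) p,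
      formToGeneric φ p x s = toGeneric x b • ω ∧ D.RestrictsToTorsion φ p x s := by
  have h1 : Ideal.span {∏ t, E.equation t} = Ideal.span {b} :=
    E.span_prod_equation.trans hb.symm
  rw [Ideal.span_singleton_eq_span_singleton] at h1
  obtain ⟨u, rfl⟩ := h1
  rw [E.mem_logFormsStalk_iff]
  constructor
  · rintro ⟨s, hs, h⟩
    refine ⟨(u : X.presheaf.stalk x) • s, ?_, ((E.restrictsToTorsion_iff s).mpr h).smul _⟩
    rw [mul_comm, map_mul, mul_smul, ← hs]
    exact (formToGeneric φ p x).map_smulₛₗ _ _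
  · rintro ⟨s, hs, h⟩
    refine ⟨((u⁻¹ : (X.presheaf.stalk x)ˣ) : X.presheaf.stalk x) • s, ?_,
      (E.restrictsToTorsion_iff _).mp (h.smul _)⟩
    refine ((formToGeneric φ p x).map_smulₛₗ _ _).trans ?_
    rw [hs, smul_smul]
    congr 1
    refine (map_mul (toGeneric x).hom _ _).symm.trans (congrArg _ ?_)
    rw [mul_comm, mul_assoc, Units.mul_inv, mul_one]

end ReducedDivisor

/-! ### Germs of forms and forms on open sets -/

section Spreading

theorem kaehlerMap_kaehlerMap {A B A' B' A'' B'' : CommRingCat.{u}} {f : A ⟶ B} {f' : A' ⟶ B'}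
    {f'' : A'' ⟶ B''} {g : A ⟶ A'} {g' : B ⟶ B'} {h : A' ⟶ A''} {h' : B' ⟶ B''} {k : A ⟶ A''}
    {k' : B ⟶ B''} (fac : g ≫ f' = f ≫ g') (fac' : h ≫ f'' = f' ≫ h') (fac'' : k ≫ f'' = f ≫ k')
    (hk : g ≫ h = k) (hk' : g' ≫ h' = k') (x : CommRingCat.KaehlerDifferential f) :
    kaehlerMap fac' (kaehlerMap fac x) = kaehlerMap fac'' x := by
  subst hk hk'
  exact kaehlerMap_comp fac fac' fac'' x

variable {X Y : Scheme.{u}} (φ : X ⟶ Y) (p : ℕ)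

/-- The germ at `y` of a one-form that is given over `W`. -/
noncomputable abbrev oneFormGerm {V : Y.Opens} {W : X.Opens} (e : W ≤ φ ⁻¹ᵁ V) (y : X)
    (hy : y ∈ W) : CommRingCat.KaehlerDifferential (φ.appLE V W e) →ₛₗ[(X.presheaf.germ W y hy).hom]
      CommRingCat.KaehlerDifferential (φ.stalkMap y) :=
  kaehlerMap (germ_appLE φ e y hy)

theorem oneFormGerm_restrict {V : Y.Opens} {W W' : X.Opens} (e : W ≤ φ ⁻¹ᵁ V)
    (e' : W' ≤ φ ⁻¹ᵁ V) (hW : W' ≤ W) (ω : CommRingCat.KaehlerDifferential (φ.appLE V W e))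
    (y : X) (hy : y ∈ W') :
    oneFormGerm φ e' y hy (kaehlerMap (appLE_restrict φ e e' le_rfl hW) ω) =
      oneFormGerm φ e y (hW hy) ω := by
  exact kaehlerMap_kaehlerMap (appLE_restrict φ e e' le_rfl hW) (germ_appLE φ e' y hy)
    (germ_appLE φ e y (hW hy)) (Y.presheaf.germ_res _ _ _) (X.presheaf.germ_res _ _ _) ω

theorem exists_oneFormGerm_eq {x : X} (s : CommRingCat.KaehlerDifferential (φ.stalkMap x))
    {U : X.Opens} (hx : x ∈ U) : ∃ (W : X.Opens) (hxW : x ∈ W) (_ : W ≤ U) (e : W ≤ φ ⁻¹ᵁ ⊤)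
      (ω : CommRingCat.KaehlerDifferential (φ.appLE ⊤ W e)), oneFormGerm φ e x hxW ω = s := by
  have hs : s ∈ Submodule.span (X.presheaf.stalk x)
      (Set.range fun b => CommRingCat.KaehlerDifferential.d (f := φ.stalkMap x) b) := by
    rw [span_range_d]; trivial
  induction hs using Submodule.span_induction with
  | mem s hs =>
    obtain ⟨b, rfl⟩ := hs
    obtain ⟨V, hxV, f, hV, rfl⟩ := exists_affine_germ_eq x b hx
    exact ⟨V.1, hxV, hV, le_top, CommRingCat.KaehlerDifferential.d f, kaehlerMap_d _ f⟩
  | zero => exact ⟨U, hx, le_rfl, le_top, 0, map_zero _⟩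
  | add s s' _ _ hs hs' =>
    obtain ⟨W, hxW, hW, e, ω, rfl⟩ := hs
    obtain ⟨W', hxW', hW', e', ω', rfl⟩ := hs'
    refine ⟨W ⊓ W', ⟨hxW, hxW'⟩, inf_le_left.trans hW, le_top,
      kaehlerMap (appLE_restrict φ e le_top le_rfl inf_le_left) ω +
        kaehlerMap (appLE_restrict φ e' le_top le_rfl inf_le_right) ω', ?_⟩
    rw [map_add]
    exact congrArg₂ (· + ·) (oneFormGerm_restrict φ e _ _ ω x _)
      (oneFormGerm_restrict φ e' _ _ ω' x _)
  | smul r s _ hs =>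
    obtain ⟨W, hxW, hW, e, ω, rfl⟩ := hs
    obtain ⟨V, hxV, f, hV, rfl⟩ := exists_affine_germ_eq x r hxW
    refine ⟨V.1, hxV, le_trans hV hW, le_top,
      f • kaehlerMap (appLE_restrict φ e le_top le_rfl hV) ω, ?_⟩
    rw [map_smulₛₗ]
    exact congrArg₂ (· • ·) rfl (oneFormGerm_restrict φ e _ _ ω x _)

/-- Every element of the stalk of the forms is the germ of a form over a neighbourhood. -/
theorem exists_formGerm_eq {x : X} (s : Forms (φ.stalkMap x) p)
    {U : X.Opens} (hx : x ∈ U) : ∃ (W : X.Opens) (hxW : x ∈ W) (_ : W ≤ U) (e : W ≤ φ ⁻¹ᵁ ⊤)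
      (ω : Forms (φ.appLE ⊤ W e) p), formGerm φ p e ω x hxW = s := by
  have hs : s ∈ Submodule.span (X.presheaf.stalk x) (M := Forms (φ.stalkMap x) p)
      (Set.range fun ω => wedge ω) :=
    Submodule.eq_top_iff'.mp (exteriorPower.ιMulti_span (X.presheaf.stalk x) p
      (CommRingCat.KaehlerDifferential (φ.stalkMap x))) s
  induction hs using Submodule.span_induction with
  | mem s hs =>
    obtain ⟨η, rfl⟩ := hs
    choose W hxW hW e ω hω using fun j => exists_oneFormGerm_eq φ (η j) hx
    have hfin : IsOpen (⋂ j, (W j : Set X)) := isOpen_iInter_of_finite fun j => (W j).2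
    let W' : X.Opens := ⟨⋂ j, (W j : Set X), hfin⟩ ⊓ U
    have hW' : ∀ j, W' ≤ W j := fun j y hy => Set.mem_iInter.mp hy.1 j
    refine ⟨W', ⟨Set.mem_iInter.mpr hxW, hx⟩, inf_le_right, le_top,
      wedge fun j => kaehlerMap (appLE_restrict φ (e j) le_top le_rfl (hW' j)) (ω j), ?_⟩
    refine (Forms.map_wedge _ _).trans (congrArg wedge (funext fun j => ?_))
    exact (oneFormGerm_restrict φ (e j) _ (hW' j) (ω j) x _).trans (hω j)
  | zero => exact ⟨U, hx, le_rfl, le_top, 0, map_zero _⟩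
  | add s s' _ _ hs hs' =>
    obtain ⟨W, hxW, hW, e, ω, rfl⟩ := hs
    obtain ⟨W', hxW', hW', e', ω', rfl⟩ := hs'
    refine ⟨W ⊓ W', ⟨hxW, hxW'⟩, inf_le_left.trans hW, le_top,
      Forms.map (appLE_restrict φ e le_top le_rfl inf_le_left) p ω +
        Forms.map (appLE_restrict φ e' le_top le_rfl inf_le_right) p ω', ?_⟩
    refine (map_add (Forms.map _ p) _ _).trans ?_
    exact congrArg₂ (· + ·) (formGerm_restrict φ p e _ le_rfl inf_le_left ω x _)
      (formGerm_restrict φ p e' _ le_rfl inf_le_right ω' x _)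
  | smul r s _ hs =>
    obtain ⟨W, hxW, hW, e, ω, rfl⟩ := hs
    obtain ⟨V, hxV, f, hV, rfl⟩ := exists_affine_germ_eq x r hxW
    refine ⟨V.1, hxV, le_trans hV hW, le_top,
      f • Forms.map (appLE_restrict φ e le_top le_rfl hV) p ω, ?_⟩
    refine ((Forms.map _ p).map_smulₛₗ _ _).trans ?_
    exact congrArg₂ (· • ·) rfl (formGerm_restrict φ p e _ le_rfl hV ω x _)

/-- The rational form defined by a form over `W` does not depend on the point of `W`. -/
theorem formToGeneric_formGerm [IsIntegral X] {V : Y.Opens} {W : X.Opens} (e : W ≤ φ ⁻¹ᵁ V)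
    (ω : Forms (φ.appLE V W e) p) (y : X) (hy : y ∈ W) (hW : genericPoint X ∈ W) :
    ReducedDivisor.formToGeneric φ p y (formGerm φ p e ω y hy) =
      formGerm φ p e ω (genericPoint X) hW :=
  Forms.map_comp (germ_appLE φ e y hy) (Scheme.Hom.stalkSpecializes_stalkMap φ _ _ _)
    (germ_appLE φ e (genericPoint X) hW) (Y.presheaf.germ_stalkSpecializes _ _)
    (X.presheaf.germ_stalkSpecializes _ _) p ω

theorem genericPoint_mem [IsIntegral X] {W : X.Opens} {x : X} (hx : x ∈ W) :
    genericPoint X ∈ W :=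
  (genericPoint_spec X).mem_open_set_iff W.2 |>.mpr ⟨x, trivial, hx⟩

variable {φ} {Z : Scheme.{u}} (g : Z ⟶ X)

theorem appLE_pullback {V : Y.Opens} {W : X.Opens} (e : W ≤ φ ⁻¹ᵁ V)
    (e' : g ⁻¹ᵁ W ≤ (g ≫ φ) ⁻¹ᵁ V) :
    𝟙 _ ≫ (g ≫ φ).appLE V (g ⁻¹ᵁ W) e' = φ.appLE V W e ≫ g.app W := by
  rw [Category.id_comp, Scheme.Hom.app_eq_appLE, Scheme.Hom.appLE_comp_appLE]

theorem stalkPullback_formGerm {V : Y.Opens} {W : X.Opens} (e : W ≤ φ ⁻¹ᵁ V)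
    (e' : g ⁻¹ᵁ W ≤ (g ≫ φ) ⁻¹ᵁ V) (ω : Forms (φ.appLE V W e) p) (z : Z) (hz : g z ∈ W) :
    stalkPullback p g z (formGerm φ p e ω (g z) hz) =
      formGerm (g ≫ φ) p e' (Forms.map (appLE_pullback g e e') p ω) z hz := by
  refine (Forms.map_comp (germ_appLE φ e (g z) hz) _
    (k := Y.presheaf.germ V (φ (g z)) (e hz))
    (k' := g.app W ≫ Z.presheaf.germ (g ⁻¹ᵁ W) z hz) ?_ (Category.comp_id _)
    (Scheme.Hom.germ_stalkMap g W z hz) p ω).trans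
    (Forms.map_comp (appLE_pullback g e e') (germ_appLE (g ≫ φ) e' z hz) _
      (Category.id_comp _) rfl p ω).symm
  rw [← Category.assoc, ← appLE_pullback g e e', Category.id_comp]
  exact germ_appLE (g ≫ φ) e' z hz

/-- Forms on a closed subscheme lift locally, since functions on it lift over affine open sets. -/
theorem exists_lift_form (I : X.IdealSheafData) {V : Y.Opens} {W : I.subscheme.Opens}
    (e : W ≤ (I.subschemeι ≫ φ) ⁻¹ᵁ V) (θ : Forms ((I.subschemeι ≫ φ).appLE V W e) p)
    (z : I.subscheme) (hz : z ∈ W) {U : X.Opens} (hU : I.subschemeι z ∈ U) :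
    ∃ (V' : X.Opens) (_ : I.subschemeι z ∈ V') (_ : V' ≤ U) (hW : I.subschemeι ⁻¹ᵁ V' ≤ W)
      (e' : V' ≤ φ ⁻¹ᵁ V) (ω : Forms (φ.appLE V V' e') p),
      ∀ (w : I.subscheme) (hw : I.subschemeι w ∈ V'),
        stalkPullback p I.subschemeι w (formGerm φ p e' ω (I.subschemeι w) hw) =
          formGerm (I.subschemeι ≫ φ) p e θ w (hW hw) := by
  obtain ⟨W', hW', hWW'⟩ :=
    (I.subschemeι.isEmbedding.isInducing.isOpen_iff (s := (W : Set I.subscheme))).mp W.2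
  obtain ⟨V', hxV', hV'⟩ := exists_affine_le (x := I.subschemeι z)
    (U := (φ ⁻¹ᵁ V ⊓ U) ⊓ ⟨W', hW'⟩)
    ⟨⟨e hz, hU⟩, show I.subschemeι z ∈ W' from (show z ∈ _ ⁻¹' W' from hWW' ▸ hz)⟩
  have hW : I.subschemeι ⁻¹ᵁ V'.1 ≤ W := fun y hy => by
    have : y ∈ I.subschemeι ⁻¹' W' := (hV' hy).2
    rw [hWW'] at this
    exact this
  have e' : V'.1 ≤ φ ⁻¹ᵁ V := fun y hy => (hV' hy).1.1
  have e'' : I.subschemeι ⁻¹ᵁ V'.1 ≤ (I.subschemeι ≫ φ) ⁻¹ᵁ V := hW.trans e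
  obtain ⟨ω, hω⟩ := forms_map_surjective (appLE_pullback I.subschemeι e' e'')
    (I.subschemeι_app_surjective V') p (Forms.map (appLE_restrict _ e e'' le_rfl hW) p θ)
  refine ⟨V'.1, hxV', fun y hy => (hV' hy).1.2, hW, e', ω, fun w hw => ?_⟩
  rw [stalkPullback_formGerm p I.subschemeι e' e'' ω w hw, hω]
  exact formGerm_restrict _ p e e'' le_rfl hW θ w hw

end Spreading

/-! ### Exactness of sequences of sheaves of modules in terms of sections -/

section Modules

variable {X : Scheme.{u}} {K M N : X.Modules}

theorem app_res (f : M ⟶ N) {U V : X.Opens} (i : V ⟶ U) (s : Γ(M, U)) :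
    f.app V (M.presheaf.map i.op s) = N.presheaf.map i.op (f.app U s) :=
  ConcreteCategory.congr_hom (f.mapPresheaf.naturality i.op) s

theorem res_res (M : X.Modules) {U V W : X.Opens} (i : V ⟶ U) (j : W ⟶ V) (s : Γ(M, U)) :
    M.presheaf.map j.op (M.presheaf.map i.op s) = M.presheaf.map (j ≫ i).op s :=
  (ConcreteCategory.congr_hom (M.presheaf.map_comp i.op j.op) s).symm

/-- A map of sheaves of modules is locally surjective if every section of the target is locally
the image of a section of the source. -/
def LocallySurjective (f : M ⟶ N) : Prop :=
  ∀ (U : X.Opens) (t : Γ(N, U)), ∀ x ∈ U, ∃ (V : X.Opens) (_ : x ∈ V) (i : V ⟶ U) (s : Γ(M, V)),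
    f.app V s = N.presheaf.map i.op t

/-- Locally surjective maps are epimorphisms; the converse is `locallySurjective_of_epi`. -/
theorem LocallySurjective.epi {f : M ⟶ N} (hf : LocallySurjective f) : Epi f where
  left_cancellation {K} g h e := by
    refine Scheme.Modules.hom_ext _ _ fun U => ?_
    ext t
    refine TopCat.Presheaf.IsSheaf.section_ext K.isSheaf fun x hx => ?_
    obtain ⟨V, hV, i, s, hs⟩ := hf U t x hx
    refine ⟨V, i.le, hV, ?_⟩
    change K.presheaf.map i.op _ = K.presheaf.map i.op _
    rw [← app_res g, ← app_res h, ← hs]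
    exact congr(Scheme.Modules.Hom.app $e V s)

/-- A map of sheaves of modules, given by linear maps on sections that commute with restriction. -/
noncomputable def homOfSections (f : ∀ U : X.Opens, Γ(M, U) →ₗ[Γ(X, U)] Γ(N, U))
    (hf : ∀ {U V : X.Opens} (i : V ⟶ U) (s : Γ(M, U)),
      f V (M.presheaf.map i.op s) = N.presheaf.map i.op (f U s)) : M ⟶ N where
  val := PresheafOfModules.homMk (R := X.ringCatSheaf.obj)
    { app := fun U => AddCommGrpCat.ofHom (f U.unop).toAddMonoidHom
      naturality := fun _ _ i => AddCommGrpCat.hom_ext <| AddMonoidHom.ext fun s => hf i.unop s }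
    fun U => (f U.unop).map_smul

/-- The sections of the target that are locally images of sections of the source. -/
def imageSections (f : M ⟶ N) : N.val.Submodule where
  obj U :=
    { carrier := {t : Γ(N, U.unop) | ∀ x ∈ U.unop, ∃ (V : X.Opens) (_ : x ∈ V) (i : V ⟶ U.unop)
        (s : Γ(M, V)), f.app V s = N.presheaf.map i.op t}
      zero_mem' := fun x hx => ⟨U.unop, hx, 𝟙 _, 0, by
        rw [map_zero]; exact (map_zero (N.presheaf.map (𝟙 U.unop).op).hom).symm⟩
      add_mem' := by
        intro t t' ht ht' x hx
        obtain ⟨V, hV, i, s, hs⟩ := ht x hx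
        obtain ⟨V', hV', i', s', hs'⟩ := ht' x hx
        refine ⟨V ⊓ V', ⟨hV, hV'⟩, homOfLE inf_le_left ≫ i,
          M.presheaf.map (homOfLE inf_le_left).op s + M.presheaf.map (homOfLE inf_le_right).op s',
          ?_⟩
        rw [map_add, app_res, app_res, hs, hs']
        exact (congrArg₂ (· + ·) (res_res N i _ t) (res_res N i' _ t')).trans
          (map_add (N.presheaf.map _).hom t t').symm
      smul_mem' := by
        intro r t ht x hx
        obtain ⟨V, hV, i, s, hs⟩ := ht x hx
        refine ⟨V, hV, i, (show Γ(X, V) from X.presheaf.map i.op r) • s, ?_⟩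
        rw [Scheme.Modules.Hom.app_smul, hs]
        exact (Scheme.Modules.map_smul N i r t).symm }
  map {U V} j := by
    intro t ht x hx
    obtain ⟨W, hW, i, s, hs⟩ := ht x (j.unop.le hx)
    refine ⟨W ⊓ V.unop, ⟨hW, hx⟩, homOfLE inf_le_right,
      M.presheaf.map (homOfLE inf_le_left).op s, ?_⟩
    rw [app_res, hs]
    exact (res_res N i _ t).trans (res_res N j.unop _ t).symm

/-- The image of a map of sheaves of modules. -/
noncomputable def imageSheaf (f : M ⟶ N) : X.Modules :=
  subsheaf N (imageSections f) fun U t ht x hx => by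
    obtain ⟨V, hV, i, h⟩ := ht x hx
    obtain ⟨W, hW, j, s, hs⟩ := h x hV
    exact ⟨W, hW, j ≫ i, s, hs.trans (res_res N i j t)⟩

theorem mono_of_injective {f : M ⟶ N} (hf : ∀ U, Function.Injective (f.app U)) : Mono f where
  right_cancellation {K} g h e := by
    refine Scheme.Modules.hom_ext _ _ fun U => ?_
    ext t
    exact hf U congr(Scheme.Modules.Hom.app $e U t)

theorem app_injective (f : M ⟶ N) [Mono f] (U : X.Opens) : Function.Injective (f.app U) := by
  have : Mono ((Scheme.Modules.toPresheaf X).map f) := inferInstance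
  have h : Mono (((Scheme.Modules.toPresheaf X).map f).app (op U)) := inferInstance
  exact (AddCommGrpCat.mono_iff_injective _).1 h

/-- An epimorphism is locally surjective, because the inclusion of its image is an isomorphism. -/
theorem locallySurjective_of_epi (f : M ⟶ N) [Epi f] : LocallySurjective f := by
  let g : M ⟶ imageSheaf f := homOfSections
    (fun U =>
      { toFun := fun s => ⟨f.app U s, fun x hx => ⟨U, hx, 𝟙 _, s,
          (ConcreteCategory.congr_hom (N.presheaf.map_id (op U)) _).symm⟩⟩
        map_add' := fun s t => Subtype.ext (map_add (f.app U).hom s t)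
        map_smul' := fun r s => Subtype.ext (f.app_smul r s) })
    fun i s => Subtype.ext (app_res f i s)
  let j : imageSheaf f ⟶ N := subsheafι _ _ _
  have hg : g ≫ j = f := by
    refine Scheme.Modules.hom_ext _ _ fun U => ?_
    ext s
    rfl
  have hgj : Epi (g ≫ j) := by rw [hg]; infer_instance
  have : Epi j := epi_of_epi g j
  have : Mono j := mono_of_injective fun U s t h => Subtype.ext h
  have : IsIso j := isIso_of_mono_of_epi j
  intro U t x hx
  have hj : Function.Surjective (j.app U) :=
    ((ConcreteCategory.isIso_iff_bijective (j.app U)).1 inferInstance).2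
  obtain ⟨s, rfl⟩ := hj t
  exact s.2 x hx

/-- A sequence is exact if the sections in the kernel are locally in the image. -/
theorem exact_of_locally (f : M ⟶ N) (g : N ⟶ K) (w : f ≫ g = 0)
    (h : ∀ (U : X.Opens) (t : Γ(N, U)), g.app U t = 0 → ∀ x ∈ U,
      ∃ (V : X.Opens) (_ : x ∈ V) (i : V ⟶ U) (s : Γ(M, V)),
        f.app V s = N.presheaf.map i.op t) : (ShortComplex.mk f g w).Exact := by
  rw [ShortComplex.exact_iff_epi_kernel_lift]
  refine LocallySurjective.epi fun U t x hx => ?_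
  obtain ⟨V, hV, i, s, hs⟩ := h U ((Limits.kernel.ι g).app U t)
    congr(Scheme.Modules.Hom.app $(Limits.kernel.condition g) U t) x hx
  refine ⟨V, hV, i, s, app_injective (Limits.kernel.ι g) V ?_⟩
  rw [app_res, ← hs]
  exact congr(Scheme.Modules.Hom.app $(Limits.kernel.lift_ι g f w) V s)

/-- The functor of sections is left exact. -/
theorem exists_app_eq (f : M ⟶ N) [Mono f] (g : N ⟶ K) {w : f ≫ g = 0}
    (h : (ShortComplex.mk f g w).Exact) {U : X.Opens} (t : Γ(N, U)) (ht : g.app U t = 0) :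
    ∃ s, f.app U s = t := by
  let F : X.Modules ⥤ Ab.{u} := Scheme.Modules.toPresheaf X ⋙ (evaluation _ _).obj (op U)
  have hF : F.PreservesZeroMorphisms := ⟨fun _ _ => rfl⟩
  have : Limits.PreservesLimitsOfShape Limits.WalkingParallelPair
      ((evaluation (Opens X)ᵒᵖ Ab.{u}).obj (op U)) := Limits.evaluation_preservesLimitsOfShape _
  have : Limits.PreservesLimitsOfShape Limits.WalkingParallelPair F :=
    Limits.comp_preservesLimitsOfShape _ _
  have := h.map_of_mono_of_preservesKernel F ‹_› inferInstance
  exact (ShortComplex.ab_exact_iff _).1 this t ht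

end Modules

/-! ### Sections of tensor products -/

section Tensor

variable {X : Scheme.{u}} {M N F : X.Modules}

/-- Every section of the tensor product comes locally from the presheaf tensor product. -/
theorem exists_presheafTensor {U : X.Opens} (t : Γ(tensor M N, U)) {x : X} (hx : x ∈ U) :
    ∃ (V : X.Opens) (_ : x ∈ V) (i : V ⟶ U) (q : TensorProduct Γ(X, V) Γ(M, V) Γ(N, V)),
      ((PresheafOfModules.sheafificationAdjunction (𝟙 X.ringCatSheaf.obj)).unit.app
        (presheafTensor M N)).app (op V) q = (tensor M N).presheaf.map i.op t := by
  have h := (Presheaf.isLocallySurjective_toSheafify' (Opens.grothendieckTopology X)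
    (presheafTensor M N).presheaf).imageSieve_mem t x hx
  obtain ⟨V, i, ⟨q, hq⟩, hV⟩ := h
  exact ⟨V, hV, i, q, hq⟩

theorem tmul_res {U V : X.Opens} (i : V ⟶ U) (m : Γ(M, U)) (n : Γ(N, U)) :
    (tensor M N).presheaf.map i.op (tmul m n) =
      tmul (M.presheaf.map i.op m) (N.presheaf.map i.op n) :=
  (PresheafOfModules.naturality_apply
    ((PresheafOfModules.sheafificationAdjunction (𝟙 X.ringCatSheaf.obj)).unit.app
      (presheafTensor M N)) i.op (TensorProduct.tmul Γ(X, U) m n)).symm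

/-- The universal property of the tensor product. -/
theorem exists_hom_tensor (f : ∀ U : X.Opens, Γ(M, U) →ₗ[Γ(X, U)] Γ(N, U) →ₗ[Γ(X, U)] Γ(F, U))
    (hf : ∀ {U V : X.Opens} (i : V ⟶ U) (m : Γ(M, U)) (n : Γ(N, U)),
      f V (M.presheaf.map i.op m) (N.presheaf.map i.op n) = F.presheaf.map i.op (f U m n)) :
    ∃ A : tensor M N ⟶ F, ∀ U m n, A.app U (tmul m n) = f U m n := by
  let g : presheafTensor M N ⟶ (PresheafOfModules.restrictScalars (𝟙 X.ringCatSheaf.obj)).obj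
      ((SheafOfModules.forget _).obj F) :=
    PresheafOfModules.homMk (R := X.ringCatSheaf.obj)
      { app := fun U => AddCommGrpCat.ofHom (TensorProduct.lift (f U.unop)).toAddMonoidHom
        naturality := fun U V i => AddCommGrpCat.hom_ext <| AddMonoidHom.ext fun q => by
          induction q using TensorProduct.induction_on with
          | zero => exact (map_zero _).trans (map_zero _).symm
          | tmul m n => exact hf i.unop m n
          | add q q' hq hq' =>
            exact (map_add _ q q').trans ((congrArg₂ (· + ·) hq hq').trans (map_add _ q q').symm) }
      fun U => (TensorProduct.lift (f U.unop)).map_smul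
  let e := (PresheafOfModules.sheafificationAdjunction (𝟙 X.ringCatSheaf.obj)).homEquiv
    (presheafTensor M N) F
  refine ⟨e.symm g, fun U m n => ?_⟩
  have h := (Adjunction.homEquiv_unit _ _ _ _).symm.trans (e.apply_symm_apply g)
  exact congr((PresheafOfModules.Hom.app $h (op U)) (TensorProduct.tmul Γ(X, U) m n))

end Tensor

/-! ### Multiplication of logarithmic forms by equations of the divisor -/

theorem germ_toSection_mem {X : Scheme.{u}} {I : X.IdealSheafData} {U : X.Opens}
    (f : Γ(idealModule I, U)) {x : X} (hx : x ∈ U) :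
    X.presheaf.germ U x hx (idealModule.toSection f) ∈ stalkIdeal I x := by
  rw [germ_mem_stalkIdeal_iff]
  obtain ⟨V, hV, hVU⟩ := exists_affine_le hx
  refine ⟨V, hV, hVU, (mem_ideal_iff_app I V _).mpr ?_⟩
  exact ((idealSections I).map (homOfLE hVU).op (show _ ∈ (idealSections I).obj (op U) from f.2) :)

namespace ReducedDivisor

variable {X Y : Scheme.{0}} [IsIntegral X] {D : ReducedDivisor X} {φ : X ⟶ Y} {p : ℕ}

/-- A section of `Ω^p_{X/Y}` defines locally a single rational form. -/
theorem formToGeneric_locally_constant {U : X.Opens} {s : ∀ x : U, Forms (φ.stalkMap x) p}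
    (hs : s ∈ (relForms φ p).sections U) (x : U) :
    ∃ (W : X.Opens) (_ : x.1 ∈ W) (h : W ≤ U), ∀ y : W,
      formToGeneric φ p y (s ⟨y, h y.2⟩) = formToGeneric φ p x (s x) := by
  obtain ⟨V, W, hx, h, e, ω, hω⟩ := hs x
  refine ⟨W, hx, h, fun y => ?_⟩
  rw [hω y, show s x = _ from hω ⟨x, hx⟩]
  exact (formToGeneric_formGerm φ p e ω y y.2 (genericPoint_mem hx)).trans
    (formToGeneric_formGerm φ p e ω x hx _).symm

/-- Germs of forms that define locally a single rational form are a section of `Ω^p_{X/Y}`, if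
forms are determined by their rational forms. -/
theorem mem_relForms_sections (hinj : ∀ x, Function.Injective (formToGeneric φ p x))
    {U : X.Opens} {s : ∀ x : U, Forms (φ.stalkMap x) p}
    (h : ∀ x : U, ∃ (W : X.Opens) (_ : x.1 ∈ W) (h : W ≤ U), ∀ y : W,
      formToGeneric φ p y (s ⟨y, h y.2⟩) = formToGeneric φ p x (s x)) :
    s ∈ (relForms φ p).sections U := by
  intro x
  obtain ⟨W, hx, hWU, hs⟩ := h x
  obtain ⟨W', hx', hW', e, ω, hω⟩ := exists_formGerm_eq φ p (s x) hx
  refine ⟨⊤, W', hx', hW'.trans hWU, e, ω, fun y => hinj y ?_⟩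
  refine (hs ⟨y, hW' y.2⟩).trans ?_
  rw [← hω]
  exact (formToGeneric_formGerm φ p e ω x hx' (genericPoint_mem hx')).trans
    (formToGeneric_formGerm φ p e ω y y.2 _).symm

/-- Sections of `Ω^p_{X/Y}` that define the same rational forms are equal. -/
theorem relForms_ext (hinj : ∀ x, Function.Injective (formToGeneric φ p x)) {U : X.Opens}
    {s t : Γ((relForms φ p).sheaf, U)} (h : ∀ x : U, formToGeneric φ p x
      ((relForms φ p).value s x) = formToGeneric φ p x ((relForms φ p).value t x)) : s = t :=
  Subtype.ext <| funext fun x => hinj x (h x)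

/-- The product of a logarithmic form and a function that vanishes on `D` is a regular form, and its
restriction to `D` is torsion. -/
theorem Frame.exists_formToGeneric_eq [IsLocallyNoetherian X] {x : X} (E : D.Frame φ x)
    {f : X.presheaf.stalk x} (hf : f ∈ stalkIdeal D.ideal x) {ω : RationalForms φ p}
    (hω : ω ∈ D.logFormsStalk φ p x) :
    ∃ s : Forms (φ.stalkMap x) p,
      formToGeneric φ p x s = toGeneric x f • ω ∧ D.RestrictsToTorsion φ p x s := by
  obtain ⟨s, hs, hs'⟩ :=
    (E.mem_logFormsStalk_iff_restrictsToTorsion E.span_prod_equation ω).mp hω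
  obtain ⟨g, rfl⟩ := (E.mem_stalkIdeal_ideal_iff f).mp hf
  refine ⟨g • s, ?_, hs'.smul g⟩
  refine ((formToGeneric φ p x).map_smulₛₗ g s).trans ?_
  rw [hs, smul_smul]
  exact congrArg (· • ω) ((mul_comm _ _).trans (map_mul (toGeneric x).hom _ g).symm)

/-- The multiplication `ω ⊗ f ↦ f ω` of logarithmic forms by functions that vanish on `D`, with regular
forms as values, is a map of sheaves. -/
theorem exists_isMultiplication [IsLocallyNoetherian X] (hF : ∀ x, Nonempty (D.Frame φ x)) :
    ∃ A : tensor (D.logForms φ p).sheaf (idealModule D.ideal) ⟶ (relForms φ p).sheaf,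
      D.IsMultiplication φ p A := by
  have hinj : ∀ x, Function.Injective (formToGeneric φ p x) := fun x =>
    (hF x).some.formToGeneric_injective
  have key : ∀ (U : X.Opens) (ω : Γ((D.logForms φ p).sheaf, U)) (f : Γ(idealModule D.ideal, U)),
      ∃ s : Γ((relForms φ p).sheaf, U), ∀ x : U,
        formToGeneric φ p x ((relForms φ p).value s x) =
          toGeneric x.1 (X.presheaf.germ U x x.2 (idealModule.toSection f)) •
            (show RationalForms φ p from (D.logForms φ p).value ω x) := by
    intro U ω f
    choose s hs _ using fun x : U => (hF x).some.exists_formToGeneric_eq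
      (germ_toSection_mem f x.2) (show _ ∈ D.logFormsStalk φ p x from (ω.2 x).1)
    refine ⟨⟨s, mem_relForms_sections hinj fun x => ?_⟩, hs⟩
    obtain ⟨-, W, hx, hWU, hW⟩ := ω.2 x
    refine ⟨W, hx, hWU, fun y => ?_⟩
    refine (hs ⟨y, hWU y.2⟩).trans (Eq.trans ?_ (hs x).symm)
    refine congrArg₂ (fun (a : X.functionField) (b : RationalForms φ p) => a • b) ?_ (hW y)
    exact (X.presheaf.germ_stalkSpecializes_apply _ _ _).trans
      (X.presheaf.germ_stalkSpecializes_apply _ _ _).symm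
  choose m hm using key
  obtain ⟨A, hA⟩ := exists_hom_tensor (M := (D.logForms φ p).sheaf) (N := idealModule D.ideal)
    (F := (relForms φ p).sheaf) (fun U => LinearMap.mk₂ Γ(X, U) (m U)
      (fun ω ω' f => relForms_ext hinj fun x => by
        refine (hm U _ f x).trans (Eq.trans ?_ ((congrArg₂ (· + ·) (hm U ω f x).symm
          (hm U ω' f x).symm).trans (map_add (formToGeneric φ p x) _ _).symm))
        exact smul_add (toGeneric x.1 (X.presheaf.germ U x x.2 (idealModule.toSection f)))
          (show RationalForms φ p from (D.logForms φ p).value ω x)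
          (show RationalForms φ p from (D.logForms φ p).value ω' x))
      (fun r ω f => relForms_ext hinj fun x => by
        refine (hm U _ f x).trans (Eq.trans ?_ ((formToGeneric φ p x).map_smulₛₗ
          (X.presheaf.germ U x x.2 r) ((relForms φ p).value (m U ω f) x)).symm)
        rw [hm U ω f x]
        exact smul_comm _ (toGeneric x.1 (X.presheaf.germ U x x.2 r))
          (show RationalForms φ p from (D.logForms φ p).value ω x))
      (fun ω f f' => relForms_ext hinj fun x => by
        refine (hm U ω _ x).trans (Eq.trans ?_ ((congrArg₂ (· + ·) (hm U ω f x).symm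
          (hm U ω f' x).symm).trans (map_add (formToGeneric φ p x) _ _).symm))
        refine Eq.trans ?_ (add_smul _ _ (show RationalForms φ p from (D.logForms φ p).value ω x))
        refine congrArg (· • (show RationalForms φ p from (D.logForms φ p).value ω x)) ?_
        refine Eq.trans ?_ (map_add (toGeneric x.1).hom _ _)
        exact congrArg (toGeneric x.1) (map_add (X.presheaf.germ U x x.2).hom _ _))
      (fun r ω f => relForms_ext hinj fun x => by
        refine (hm U ω _ x).trans (Eq.trans ?_ ((formToGeneric φ p x).map_smulₛₗ
          (X.presheaf.germ U x x.2 r) ((relForms φ p).value (m U ω f) x)).symm)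
        rw [hm U ω f x, smul_smul]
        refine congrArg (· • (show RationalForms φ p from (D.logForms φ p).value ω x)) ?_
        refine Eq.trans ?_ (map_mul (toGeneric x.1).hom _ _)
        exact congrArg (toGeneric x.1) (map_mul (X.presheaf.germ U x x.2).hom r _)))
    (fun {U V} i ω f => relForms_ext hinj fun x => by
      refine (hm V _ _ x).trans ?_
      refine Eq.trans ?_ (hm U ω f ⟨x, i.le x.2⟩).symm
      refine congrArg (fun a => toGeneric x.1 a •
        (show RationalForms φ p from (D.logForms φ p).value ω ⟨x, i.le x.2⟩)) ?_
      exact X.presheaf.germ_res_apply i x x.2 (idealModule.toSection f))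
  refine ⟨A, fun U ω f x => ?_⟩
  rw [hA]
  exact hm U ω f x

end ReducedDivisor

/-! ### Tensor products with invertible ideals -/

section Tensor

variable {X : Scheme.{u}} {M N F : X.Modules} {U : X.Opens}

/-- Maps from a tensor product are equal if they agree on the sections `m ⊗ n`. -/
theorem tensor_hom_ext {A A' : tensor M N ⟶ F}
    (h : ∀ (U : X.Opens) (m : Γ(M, U)) (n : Γ(N, U)),
      A.app U (tmul m n) = A'.app U (tmul m n)) : A = A' := by
  refine ((PresheafOfModules.sheafificationAdjunction (𝟙 X.ringCatSheaf.obj)).homEquiv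
    (presheafTensor M N) F).injective ?_
  refine ((Adjunction.homEquiv_unit _ _ _ _).trans ?_).trans
    (Adjunction.homEquiv_unit _ _ _ _).symm
  refine PresheafOfModules.hom_ext fun U => ModuleCat.hom_ext <| LinearMap.ext fun q => ?_
  induction q using TensorProduct.induction_on with
  | zero => exact (map_zero _).trans (map_zero _).symm
  | tmul m n => exact h U.unop m n
  | add q q' hq hq' =>
    exact (map_add _ q q').trans ((congrArg₂ (· + ·) hq hq').trans (map_add _ q q').symm)

theorem zero_tmul (n : Γ(N, U)) : tmul (0 : Γ(M, U)) n = 0 :=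
  (congrArg (((PresheafOfModules.sheafificationAdjunction (𝟙 X.ringCatSheaf.obj)).unit.app
    (presheafTensor M N)).app (op U)) (TensorProduct.zero_tmul (R := Γ(X, U)) Γ(M, U) n)).trans (map_zero _)

theorem add_tmul (m m' : Γ(M, U)) (n : Γ(N, U)) : tmul (m + m') n = tmul m n + tmul m' n :=
  (congrArg (((PresheafOfModules.sheafificationAdjunction (𝟙 X.ringCatSheaf.obj)).unit.app
    (presheafTensor M N)).app (op U)) (TensorProduct.add_tmul (R := Γ(X, U)) m m' n)).trans (map_add _ _ _)

theorem smul_tmul (r : Γ(X, U)) (m : Γ(M, U)) (n : Γ(N, U)) : tmul (r • m) n = tmul m (r • n) :=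
  congrArg (((PresheafOfModules.sheafificationAdjunction (𝟙 X.ringCatSheaf.obj)).unit.app
    (presheafTensor M N)).app (op U)) (TensorProduct.smul_tmul (R := Γ(X, U)) (R' := Γ(X, U)) r m n)

/-- Near a point at which its stalk is principal, an ideal sheaf is generated by one section. -/
theorem exists_generator [IsLocallyNoetherian X] (I : X.IdealSheafData) {x : X}
    (h : ∃ a, Ideal.span {a} = stalkIdeal I x) (hx : x ∈ U) :
    ∃ (V : X.Opens) (_ : x ∈ V) (_ : V ≤ U) (f : Γ(idealModule I, V)),
      (∀ b : Γ(idealModule I, V), ∃ c : Γ(X, V), b = c • f) ∧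
      ∀ (y : X) (hy : y ∈ V),
        Ideal.span {X.presheaf.germ V y hy (idealModule.toSection f)} = stalkIdeal I y := by
  obtain ⟨a, ha⟩ := h
  obtain ⟨V, hxV, f, hVU, hf, -⟩ := exists_ideal_eq_span I ha hx
  have hfV : I.subschemeι.app V.1 f = 0 :=
    (mem_ideal_iff_app I V f).mp (hf ▸ Ideal.mem_span_singleton_self f)
  refine ⟨V.1, hxV, hVU, ⟨f, hfV⟩, fun b => ?_, fun y hy => ?_⟩
  · have hb : idealModule.toSection b ∈ I.ideal V :=
      (mem_ideal_iff_app I V _).mpr (show _ ∈ (idealSections I).obj (op V.1) from b.2)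
    rw [hf, Ideal.mem_span_singleton'] at hb
    obtain ⟨c, hc⟩ := hb
    exact ⟨c, Subtype.ext hc.symm⟩
  · rw [stalkIdeal_eq_map I y V hy, hf, Ideal.map_span, Set.image_singleton]
    rfl

/-- Locally, every section of `M ⊗ I` has the form `m ⊗ f` with `f` a generator of `I`. -/
theorem exists_tmul_eq [IsLocallyNoetherian X] (I : X.IdealSheafData) {x : X}
    (h : ∃ a, Ideal.span {a} = stalkIdeal I x) (t : Γ(tensor M (idealModule I), U)) (hx : x ∈ U) :
    ∃ (V : X.Opens) (_ : x ∈ V) (i : V ⟶ U) (m : Γ(M, V)) (f : Γ(idealModule I, V)),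
      (tensor M (idealModule I)).presheaf.map i.op t = tmul m f ∧
      ∀ (y : X) (hy : y ∈ V),
        Ideal.span {X.presheaf.germ V y hy (idealModule.toSection f)} = stalkIdeal I y := by
  obtain ⟨W, hW, i, q, hq⟩ := exists_presheafTensor t hx
  obtain ⟨V, hV, hVW, f, hf, hf'⟩ := exists_generator I h hW
  have key : ∃ m : Γ(M, V), (tensor M (idealModule I)).presheaf.map (homOfLE hVW).op
      (((PresheafOfModules.sheafificationAdjunction (𝟙 X.ringCatSheaf.obj)).unit.app
        (presheafTensor M (idealModule I))).app (op W) q) = tmul m f := by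
    clear hq
    induction q using TensorProduct.induction_on with
    | zero =>
      refine ⟨0, Eq.trans ?_ (zero_tmul f).symm⟩
      exact (congrArg _ (map_zero _)).trans (map_zero _)
    | tmul m n =>
      obtain ⟨c, hc⟩ := hf ((idealModule I).presheaf.map (homOfLE hVW).op n)
      refine ⟨c • M.presheaf.map (homOfLE hVW).op m, ?_⟩
      rw [smul_tmul, ← hc]
      exact tmul_res (homOfLE hVW) m n
    | add q q' hq hq' =>
      obtain ⟨m, hm⟩ := hq
      obtain ⟨m', hm'⟩ := hq'
      refine ⟨m + m', ?_⟩
      rw [add_tmul, ← hm, ← hm']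
      exact (congrArg _ (map_add _ q q')).trans (map_add _ _ _)
  obtain ⟨m, hm⟩ := key
  refine ⟨V, hV, homOfLE hVW ≫ i, m, f, ?_, hf'⟩
  rw [← hm, hq]
  exact (res_res _ i (homOfLE hVW) t).symm

end Tensor

/-! ### Torsion sections -/

/-- The kernel of the projection to the torsion-free forms on sections consists of the torsion
sections. -/
theorem toTorsionFreeForms_app_eq_zero_iff {X Y : Scheme.{u}} (φ : X ⟶ Y) (p : ℕ) {U : X.Opens}
    (t : Γ((relForms φ p).sheaf, U)) : (toTorsionFreeForms φ p).app U t = 0 ↔ ∀ x : U,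
      (relForms φ p).value t x ∈
        Submodule.torsion (X.presheaf.stalk x) (Forms (φ.stalkMap x.1) p) := by
  constructor
  · intro h
    have : Mono (torsionFormsι φ p) := mono_of_injective fun U s t h => Subtype.ext h
    obtain ⟨s, rfl⟩ := exists_app_eq (torsionFormsι φ p) (toTorsionFreeForms φ p)
      (w := Limits.cokernel.condition _) (ShortComplex.exact_cokernel _) t h
    exact s.2
  · intro h
    exact congr(Scheme.Modules.Hom.app $(Limits.cokernel.condition (torsionFormsι φ p)) U
      (⟨t, h⟩ : (torsionSections φ p).obj (op U)))

namespace ReducedDivisor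

section Residue

variable {X Y : Scheme.{0}} {D : ReducedDivisor X} {φ : X ⟶ Y} {p : ℕ}

/-! ### The kernel and the surjectivity of the restriction to the divisor -/

/-- The sections in the kernel of `B`. -/
theorem restrictTorsionFree_app_eq_zero_iff {U : X.Opens} (t : Γ((relForms φ p).sheaf, U)) :
    (D.restrictTorsionFree φ p).app U t = 0 ↔
      ∀ x : U, D.RestrictsToTorsion φ p x ((relForms φ p).value t x) := by
  refine (toTorsionFreeForms_app_eq_zero_iff (D.ι ≫ φ) p
    ((kaehlerPullback p D.ι).app U t)).trans ⟨?_, fun h z => h ⟨D.ι z, z.2⟩ z rfl⟩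
  rintro h ⟨x, hx⟩ z (hz : x = D.ι z)
  subst hz
  exact h ⟨z, hx⟩

/-- The map `B` is an epimorphism: torsion-free forms on `D` lift locally to forms on `D`, and these
extend locally to `X`. -/
theorem epi_restrictTorsionFree : Epi (D.restrictTorsionFree φ p) := by
  refine LocallySurjective.epi fun U t x hx => ?_
  by_cases hxD : x ∈ D.ideal.support
  · obtain ⟨z, rfl⟩ := exists_subschemeι_eq D.ideal hxD
    have : Epi (toTorsionFreeForms (D.ι ≫ φ) p) :=
      inferInstanceAs (Epi (Limits.cokernel.π (torsionFormsι (D.ι ≫ φ) p)))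
    obtain ⟨V, hV, i, s, hs⟩ := locallySurjective_of_epi (toTorsionFreeForms (D.ι ≫ φ) p)
      (D.ι ⁻¹ᵁ U) t z hx
    obtain ⟨T, W, hW, hWV, e, θ, hθ⟩ := s.2 ⟨z, hV⟩
    obtain ⟨V', hV', hVU, hVW, e', ω, hω⟩ := exists_lift_form p D.ideal e θ z hW hx
    let σ : Γ((relForms φ p).sheaf, V') := ⟨fun y => formGerm φ p e' ω y y.2, fun y =>
      ⟨T, V', y.2, le_rfl, e', ω, fun _ => rfl⟩⟩
    refine ⟨V', hV', homOfLE hVU, σ, ?_⟩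
    have hσ : (kaehlerPullback p D.ι).app V' σ =
        (relForms (D.ι ≫ φ) p).sheaf.presheaf.map (homOfLE (hVW.trans hWV)).op s :=
      Subtype.ext <| funext fun w => (hω w w.2).trans (hθ ⟨w, hVW w.2⟩).symm
    refine (congrArg ((toTorsionFreeForms (D.ι ≫ φ) p).app (D.ι ⁻¹ᵁ V')) hσ).trans ?_
    refine (app_res (toTorsionFreeForms (D.ι ≫ φ) p) _ s).trans ?_
    rw [hs]
    exact res_res _ i _ t
  · -- Off `D` the target vanishes: its sections over `V` are sections over the empty set.
    let V : X.Opens := U ⊓ ⟨(D.ideal.support : Set X)ᶜ, D.ideal.support.isClosed.isOpen_compl⟩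
    refine ⟨V, ⟨hx, hxD⟩, homOfLE inf_le_left, 0, ?_⟩
    refine TopCat.Presheaf.IsSheaf.section_ext (F := (torsionFreeForms (D.ι ≫ φ) p).presheaf)
      (torsionFreeForms (D.ι ≫ φ) p).isSheaf (U := op (D.ι ⁻¹ᵁ V)) fun z hz => ?_
    exact absurd (subschemeι_mem_support D.ideal z) hz.2

variable [IsIntegral X]

/-- Local equations of `D` are not zero. -/
theorem Frame.toGeneric_ne_zero {x : X} (E : D.Frame φ x) {b : X.presheaf.stalk x}
    (hb : Ideal.span {b} = stalkIdeal D.ideal x) : toGeneric x b ≠ 0 := by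
  intro h
  have hb0 : b = 0 := toGeneric_injective x (h.trans (map_zero (toGeneric x).hom).symm)
  have h1 : ∏ t, E.equation t ∈ stalkIdeal D.ideal x :=
    (E.mem_stalkIdeal_ideal_iff _).mpr dvd_rfl
  rw [← hb, hb0, Ideal.span_singleton_zero, Ideal.mem_bot, Finset.prod_eq_zero_iff] at h1
  obtain ⟨t, -, ht⟩ := h1
  exact (E.prime t).ne_zero ht

variable [IsLocallyNoetherian X]
  {A : tensor (D.logForms φ p).sheaf (idealModule D.ideal) ⟶ (relForms φ p).sheaf}

/-- Regular forms that restrict to torsion forms on `D` become logarithmic forms when they are divided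
by an equation of `D`. -/
theorem Frame.inv_smul_mem_logFormsStalk {x : X} (E : D.Frame φ x) {b : X.presheaf.stalk x}
    (hb : Ideal.span {b} = stalkIdeal D.ideal x) {s : Forms (φ.stalkMap x) p}
    (hs : D.RestrictsToTorsion φ p x s) :
    ((toGeneric x b)⁻¹ • formToGeneric φ p x s : RationalForms φ p) ∈ D.logFormsStalk φ p x :=
  (E.mem_logFormsStalk_iff_restrictsToTorsion hb _).mpr
    ⟨s, (smul_inv_smul₀ (E.toGeneric_ne_zero hb) _).symm, hs⟩

/-- The map `A` is a monomorphism: locally a section of the tensor product is `ω ⊗ f` with `f` an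
equation of `D`, and `f ω = 0` implies `ω = 0`. -/
theorem IsMultiplication.mono (hA : D.IsMultiplication φ p A)
    (hF : ∀ x, Nonempty (D.Frame φ x)) : Mono A := by
  have key : ∀ (U : X.Opens) (t : Γ(tensor (D.logForms φ p).sheaf (idealModule D.ideal), U)),
      A.app U t = 0 → t = 0 := by
    intro U t ht
    refine TopCat.Presheaf.IsSheaf.section_ext
      (tensor (D.logForms φ p).sheaf (idealModule D.ideal)).isSheaf fun x hx => ?_
    obtain ⟨V, hV, i, ω, f, hm, hf⟩ := exists_tmul_eq D.ideal
      ⟨_, (hF x).some.span_prod_equation⟩ t hx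
    refine ⟨V, i.le, hV, hm.trans (Eq.trans ?_ (map_zero _).symm)⟩
    have h0 : A.app V (tmul ω f) = 0 := by
      rw [← hm, app_res, ht, map_zero]
    have hω : ω = 0 := by
      refine Subtype.ext <| funext fun y => ?_
      have h1 := hA V ω f y
      rw [h0] at h1
      have h2 := (map_zero (formToGeneric φ p y.1)).symm.trans h1
      exact (smul_eq_zero.mp h2.symm).resolve_left ((hF y).some.toGeneric_ne_zero (hf y y.2))
    rw [hω, zero_tmul]
  refine mono_of_injective fun U s t hst => sub_eq_zero.mp (key U _ ?_)
  rw [map_sub, hst, sub_self]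

theorem IsMultiplication.comp_eq_zero (hA : D.IsMultiplication φ p A)
    (hF : ∀ x, Nonempty (D.Frame φ x)) : A ≫ D.restrictTorsionFree φ p = 0 := by
  have key : ∀ (U : X.Opens) (ω : Γ((D.logForms φ p).sheaf, U)) (f : Γ(idealModule D.ideal, U))
      (x : U), D.RestrictsToTorsion φ p x ((relForms φ p).value (A.app U (tmul ω f)) x) := by
    intro U ω f x
    obtain ⟨s, hs, hs'⟩ := (hF x).some.exists_formToGeneric_eq
      (germ_toSection_mem f x.2) (show _ ∈ D.logFormsStalk φ p x from (ω.2 x).1)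
    exact (hF x).some.formToGeneric_injective ((hA U ω f x).trans hs.symm) ▸ hs'
  refine tensor_hom_ext fun U ω f => ?_
  have h : (D.restrictTorsionFree φ p).app U (A.app U (tmul ω f)) = 0 :=
    (restrictTorsionFree_app_eq_zero_iff (A.app U (tmul ω f))).mpr (key U ω f)
  rw [Scheme.Modules.Hom.comp_app, ConcreteCategory.comp_apply, h, Scheme.Modules.Hom.zero_app]
  rfl

/-- The sections in the kernel of `B` are locally in the image of `A`. -/
theorem IsMultiplication.exact (hA : D.IsMultiplication φ p A)
    (hF : ∀ x, Nonempty (D.Frame φ x)) (w : A ≫ D.restrictTorsionFree φ p = 0) :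
    (ShortComplex.mk A (D.restrictTorsionFree φ p) w).Exact := by
  refine exact_of_locally _ _ w fun U t ht x hx => ?_
  rw [restrictTorsionFree_app_eq_zero_iff] at ht
  obtain ⟨V, hV, hVU, f, -, hf⟩ := exists_generator D.ideal
    ⟨_, (hF x).some.span_prod_equation⟩ hx
  let ω : Γ((D.logForms φ p).sheaf, V) := ⟨fun y => (show RationalForms φ p from
      (toGeneric y.1 (X.presheaf.germ V y y.2 (idealModule.toSection f)))⁻¹ •
        formToGeneric φ p y ((relForms φ p).value t ⟨y, hVU y.2⟩)), fun y => by
    refine ⟨(hF y).some.inv_smul_mem_logFormsStalk (hf y y.2) (ht ⟨y, hVU y.2⟩), ?_⟩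
    obtain ⟨W, hW, hWU, h⟩ := formToGeneric_locally_constant t.2 ⟨y, hVU y.2⟩
    refine ⟨W ⊓ V, ⟨hW, y.2⟩, inf_le_right, fun y' => ?_⟩
    refine congrArg₂ (fun (a : X.functionField) (θ : RationalForms φ p) => a⁻¹ • θ) ?_
      (h ⟨y', y'.2.1⟩)
    exact (X.presheaf.germ_stalkSpecializes_apply _ _ _).trans
      (X.presheaf.germ_stalkSpecializes_apply _ _ _).symm⟩
  refine ⟨V, hV, homOfLE hVU, tmul ω f, relForms_ext
    (fun y => (hF y).some.formToGeneric_injective) fun y => (hA V ω f y).trans ?_⟩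
  exact smul_inv_smul₀ ((hF y).some.toGeneric_ne_zero (hf y y.2)) _

end Residue

/-! ### Torsion-free forms and the components of the divisor -/

section Components

variable {X Y : Scheme.{0}} {D : ReducedDivisor X} {φ : X ⟶ Y} {p : ℕ}

/-- A section of `Ω^p_{D/Y}` is torsion if and only if it vanishes on all components of `D`. -/
theorem toTorsionFreeForms_app_eq_zero_iff_components [IsIntegral X]
    (hF : ∀ x, Nonempty (D.Frame φ x))
    {U : D.scheme.Opens} (s : Γ((relForms (D.ι ≫ φ) p).sheaf, U)) :
    (toTorsionFreeForms (D.ι ≫ φ) p).app U s = 0 ↔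
      ∀ Z : D.components, (kaehlerPullback p (D.componentι Z)).app U s = 0 := by
  classical
  rw [toTorsionFreeForms_app_eq_zero_iff]
  -- The extension of `s` by zero to a family over all of `D`; its values off `U` play no role.
  let σ : ∀ z, Forms ((D.ι ≫ φ).stalkMap z) p := fun z =>
    if h : z ∈ U then (relForms (D.ι ≫ φ) p).value s ⟨z, h⟩ else 0
  have hσ : ∀ z : U, (relForms (D.ι ≫ φ) p).value s z = σ z := fun z => by
    simp only [σ, dif_pos z.2]
  constructor
  · intro h Z
    refine Subtype.ext <| funext fun w => ?_
    have h1 := h ⟨D.componentι Z w, w.2⟩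
    rw [hσ, (hF _).some.mem_torsion_iff] at h1
    exact (congrArg _ (hσ ⟨D.componentι Z w, w.2⟩)).trans (h1 Z w rfl)
  · intro h z
    rw [hσ, (hF _).some.mem_torsion_iff]
    intro Z w hw
    have hwU : D.componentι Z w ∈ U := hw ▸ z.2
    refine (congrArg _ (hσ ⟨_, hwU⟩).symm).trans ?_
    exact congrFun (congrArg Subtype.val (h Z)) ⟨w, hwU⟩

attribute [local instance] Abelian.hasFiniteBiproducts

theorem restrictComponents_app_eq_zero {U : D.scheme.Opens}
    {s : Γ((relForms (D.ι ≫ φ) p).sheaf, U)} (h : (D.restrictComponents φ p).app U s = 0)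
    (Z : D.components) : (kaehlerPullback p (D.componentι Z)).app U s = 0 := by
  have h1 : D.restrictComponents φ p ≫ Limits.biproduct.π _ Z =
      kaehlerPullback p (D.componentι Z) := Limits.biproduct.lift_π _ _
  rw [← h1]
  rw [Scheme.Modules.Hom.comp_app]
  exact (congrArg _ h).trans (map_zero (Scheme.Modules.Hom.app _ U).hom)

/-- The quotient of `Ω^p_{D/Y}` by its torsion is the image of the restriction to the components of
`D`. -/
theorem exists_iso_image_restrictComponents [IsIntegral X]
    (hF : ∀ x, Nonempty (D.Frame φ x)) :
    ∃ e : torsionFreeForms (D.ι ≫ φ) p ≅ Limits.image (D.restrictComponents φ p),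
      toTorsionFreeForms (D.ι ≫ φ) p ≫ e.hom ≫ Limits.image.ι (D.restrictComponents φ p) =
        D.restrictComponents φ p := by
  have w : torsionFormsι (D.ι ≫ φ) p ≫ D.restrictComponents φ p = 0 := by
    refine Limits.biproduct.hom_ext _ _ fun Z => ?_
    rw [Category.assoc, Limits.zero_comp, restrictComponents, Limits.biproduct.lift_π]
    refine Scheme.Modules.hom_ext _ _ fun U => ?_
    ext s
    refine (toTorsionFreeForms_app_eq_zero_iff_components hF _).mp ?_ Z
    exact (toTorsionFreeForms_app_eq_zero_iff _ _ _).mpr s.2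
  let ψ : torsionFreeForms (D.ι ≫ φ) p ⟶ _ :=
    Limits.cokernel.desc (torsionFormsι (D.ι ≫ φ) p) (D.restrictComponents φ p) w
  have hψ : toTorsionFreeForms (D.ι ≫ φ) p ≫ ψ = D.restrictComponents φ p :=
    Limits.cokernel.π_desc _ _ _
  have : Epi (toTorsionFreeForms (D.ι ≫ φ) p) :=
    inferInstanceAs (Epi (Limits.cokernel.π (torsionFormsι (D.ι ≫ φ) p)))
  have key : ∀ (U : D.scheme.Opens) (t : Γ(torsionFreeForms (D.ι ≫ φ) p, U)),
      ψ.app U t = 0 → t = 0 := by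
    intro U t ht
    refine TopCat.Presheaf.IsSheaf.section_ext (torsionFreeForms (D.ι ≫ φ) p).isSheaf
      fun x hx => ?_
    obtain ⟨V, hV, i, s, hs⟩ := locallySurjective_of_epi (toTorsionFreeForms (D.ι ≫ φ) p) U t x hx
    refine ⟨V, i.le, hV, hs.symm.trans (Eq.trans ?_ (map_zero _).symm)⟩
    rw [toTorsionFreeForms_app_eq_zero_iff_components hF]
    refine restrictComponents_app_eq_zero ?_
    rw [← hψ]
    refine (congrArg (ψ.app V) hs).trans ?_
    rw [app_res, ht]
    exact map_zero _
  have : Mono ψ := mono_of_injective fun U s t hst => sub_eq_zero.mp (key U _ (by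
    rw [map_sub, hst, sub_self]))
  have : StrongEpi (toTorsionFreeForms (D.ι ≫ φ) p) := strongEpi_of_epi _
  refine ⟨(Limits.image.isoStrongEpiMono (toTorsionFreeForms (D.ι ≫ φ) p) ψ hψ), ?_⟩
  rw [Limits.image.isoStrongEpiMono_hom_comp_ι, hψ]

end Components

end ReducedDivisor
end LogSequence

theorem proposition3p9
    {X Y : Scheme.{0}} (πX : X ⟶ Spec (CommRingCat.of ℂ)) (πY : Y ⟶ Spec (CommRingCat.of ℂ))
    [IsIntegral X] [IsSeparated πX] [LocallyOfFiniteType πX] [QuasiCompact πX]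
    [IsIntegral Y] [IsSeparated πY] [LocallyOfFiniteType πY] [QuasiCompact πY]
    (φ : X ⟶ Y) (hφ : φ ≫ πY = πX) (n m : ℕ) (hY : SmoothOfRelativeDimension m πY)
    (D : ReducedDivisor X) (hD : D.IsSNC πX n) (hrel : D.IsRelativelySNC φ n m) (p : ℕ) :
    (∃ (A : tensor (D.logForms φ p).sheaf (idealModule D.ideal) ⟶ (relForms φ p).sheaf)
      (w : A ≫ D.restrictTorsionFree φ p = 0),
      D.IsMultiplication φ p A ∧
      (ShortComplex.mk A (D.restrictTorsionFree φ p) w).ShortExact) ∧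
    ∃ e : torsionFreeForms (D.ι ≫ φ) p ≅ Limits.image (D.restrictComponents φ p),
      toTorsionFreeForms (D.ι ≫ φ) p ≫ e.hom ≫ Limits.image.ι (D.restrictComponents φ p) =
        D.restrictComponents φ p := by
  have : IsLocallyNoetherian X := LocallyOfFiniteType.isLocallyNoetherian πX
  have hF : ∀ x, Nonempty (D.Frame φ x) := hrel.nonempty_frame
  obtain ⟨A, hA⟩ := ReducedDivisor.exists_isMultiplication (p := p) hF
  have w := hA.comp_eq_zero hF
  exact ⟨⟨A, w, hA, .mk' (hA.exact hF w) (hA.mono hF)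
    ReducedDivisor.epi_restrictTorsionFree⟩,
    ReducedDivisor.exists_iso_image_restrictComponents hF⟩
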